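/- **Definitions.** Let $G$ be an infinite, connected, simple, locally finite graph. A *fundamental domain* of $G$ is a finite set $W$ of vertices meeting every orbit of $\mathrm{Aut}(G)$; $G$ is *quasi-transitive* if it has one. Then $\mu=\mu(G)$ denotes the *connective constant*, that is, the limit of $\sigma_n(v)^{1/n}$ (the same for every vertex $v$), where $\sigma_n(v)$ is the number of $n$-step self-avoiding walks (SAWs) from $v$. Fix a fundamental domain $W$ and let $X$ be the set of edges incident to vertices of $W$. Below, SAWs start and end at midpoints of edges (mid-edges) and visit no vertex and no mid-edge more than once; the length $|\pi|$ is the number of vertices visited, and $\|\pi\|$ is the graph-distance between the two end mid-edges. Let $\Sigma$ be the set of SAWs starting at mid-edges of $X$, $\Sigma_n$ the set of those of length $n$, $\sigma_n=|\Sigma_n|$, and $\langle\cdot\rangle_n$ the uniform average over $\Sigma_n$. * $\gamma(G)\in[-\infty,\infty]$ is the number such that $Y(y)=\sum_{\pi\in\Sigma}\mu^{-|\pi|}/|\pi|^{y}$ (denominator $1$ if $|\pi|=0$) is infinite for $y<\gamma$ and finite for $y>\gamma$. * $\nu(G)\in[-\infty,\infty]$ is the number such that $V(z)=\sum_{n\ge1}n^{-2z-1}\langle\|\pi\|^2\rangle_n$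 is infinite for $z<\nu$ and finite for $z>\nu$. * For $\alpha\in\mathrm{Aut}(G)$ let $Z_\alpha(x)=\sum x^{|\pi|}$, summed over the $\pi\in\Sigma$ that end at mid-edges of $\alpha X$. The exponent $\eta(G)$ *exists* and equals $\eta\in[-\infty,\infty]$ if, for every sequence of automorphisms $\alpha$ with $d_G(W,\alpha W)\to\infty$, $Z_\alpha(\mu^{-1})\,d_G(W,\alpha W)^{w}$ tends to $0$ for every real $w<\eta$ and to $\infty$ for every real $w>\eta$. A *gadget* is a finite connected simple graph with three distinct outer vertices, such that the automorphisms of the graph preserving the set of outer vertices act transitively on it. For a cubic graph $G_0$, the *local transformation* $G_1=\phi(G_0)$ is obtained by replacing every vertex $v$ by a copy $\phi(v)$ of one fixed gadget, the three edges at $v$ being attached bijectively to the three outer vertices of $\phi(v)$. For a set $S$ of vertices of $G_0$, let $\phi(S)$ be the set of all vertices of the gadgets $\phi(v)$, $v\in S$. **Theorem.** Let $G_0$ be an infinite, quasi-transitive, connected, cubic graph with fundamental domain $W_0$. Let $G_1=\phi(G_0)$ and $W_1=\phi(W_0)$, where the gadgets are attached so that automorphisms of $G_0$ induce automorphisms of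 $G_1$ in the following sense: for every $\alpha\in\mathrm{Aut}(G_0)$ there is $\beta\in\mathrm{Aut}(G_1)$ with $\beta W_1=\phi(\alpha W_0)$. (This is automatic if every permutation of the outer vertices extends to an automorphism of the gadget; it implies that $W_1$ is a fundamental domain of $G_1$.) Define the exponents of $G_k$ with $W=W_k$, $k=0,1$. Assume that $|\gamma(G_0)|<\infty$ and that $\eta(G_1)$ exists. (a) $\gamma(G_1)=\gamma(G_0)$; moreover $\eta(G_0)$ exists, $\eta(G_0)$ and $\eta(G_1)$ are uniquely determined, and $\eta(G_1)=\eta(G_0)$. (b) Let $\sigma_{n,k}$ be the number of $n$-step SAWs on $G_k$ from mid-edges of edges incident to $W_k$. Assume there are a slowly varying function $L$ (positive and measurable, with $L(tx)/L(x)\to1$ as $x\to\infty$ for every $t>0$), common to $k=0,1$, and constants $C_{1,k},C_{2,k}\in(0,\infty)$ such that $$C_{1,k}L(n)\,n^{\gamma(G_k)-1}\mu(G_k)^n\le\sigma_{n,k}\le C_{2,k}L(n)\,n^{\gamma(G_k)-1}\mu(G_k)^n,\qquad n\ge1,\ k=0,1.$$ Then $\nu(G_1)=\nu(G_0)$. 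-/

import Mathlib

open Filter Topology
open scoped ENNReal

namespace LocalSAW

universe u v

section Graph

variable {V : Type u}

/-- A (finite) fundamental domain of `G`: a finite set of vertices that meets every orbit of the
automorphism group. `G` is quasi-transitive iff it has one. Minimality is not required. -/
structure IsFundamentalDomain (G : SimpleGraph V) (W : Set V) : Prop where
  finite : W.Finite
  exists_mem : ∀ x : V, ∃ α : G ≃g G, α x ∈ W

/-! ### Self-avoiding walks between vertices, and the connective constant -/

/-- `σ_n(x)`: the number of self-avoiding walks with `n` edges that start at the vertex `x`. -/
noncomputable def vertexSAWCount (G : SimpleGraph V) (x : V) (n : ℕ) : ℕ :=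
  Nat.card {p : Σ y : V, G.Walk x y // p.2.IsPath ∧ p.2.length = n}

/-- `μ` is the limit of `σ_n(x)^{1/n}` for every vertex `x`. -/
def IsConnectiveConstant (G : SimpleGraph V) (μ : ℝ) : Prop :=
  ∀ x : V, Tendsto (fun n : ℕ => (vertexSAWCount G x n : ℝ) ^ ((1 : ℝ) / n)) atTop (𝓝 μ)

open Classical in
/-- The connective constant `μ(G)`. (The value `0` is taken only if the limits do not exist or
differ, which does not happen for infinite connected quasi-transitive graphs.) -/
noncomputable def connectiveConstant (G : SimpleGraph V) : ℝ :=
  if h : ∃ μ : ℝ, IsConnectiveConstant G μ then h.choose else 0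

/-! ### Self-avoiding walks between mid-edges -/

/-- A self-avoiding walk of length `n` between mid-edges: it runs through mid-edges
`e₀, …, e_n` and vertices `x₁, …, x_n` in the order `e₀ x₁ e₁ x₂ … x_n e_n`, each vertex being an
endpoint of the edges before and after it, and visits no vertex and no mid-edge twice.
Its length is the number of vertices visited. -/
@[ext]
structure MidSAW (G : SimpleGraph V) (n : ℕ) where
  edge : Fin (n + 1) → Sym2 V
  vert : Fin n → V
  edge_mem : ∀ i, edge i ∈ G.edgeSet
  vert_mem_left : ∀ i, vert i ∈ edge i.castSucc
  vert_mem_right : ∀ i, vert i ∈ edge i.succ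
  edge_injective : Function.Injective edge
  vert_injective : Function.Injective vert

/-- The edges of `G` incident to the vertices in `W`. -/
def incidentEdges (G : SimpleGraph V) (W : Set V) : Set (Sym2 V) :=
  {e | e ∈ G.edgeSet ∧ ∃ x ∈ W, x ∈ e}

/-- `Σ_n`: the `n`-step self-avoiding walks that start at mid-edges of edges incident to `W`. -/
abbrev SAWFrom (G : SimpleGraph V) (W : Set V) (n : ℕ) : Type u :=
  {π : MidSAW G n // π.edge 0 ∈ incidentEdges G W}

/-- `σ_n`: the number of elements of `Σ_n`. -/
noncomputable def sawCount (G : SimpleGraph V) (W : Set V) (n : ℕ) : ℕ :=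
  Nat.card (SAWFrom G W n)

/-- Distance between two sets of vertices. -/
noncomputable def setDist (G : SimpleGraph V) (A B : Set V) : ℕ :=
  sInf (Set.image2 G.dist A B)

open Classical in
/-- Graph distance between two mid-edges: for distinct edges, half an edge at either end plus the
distance between the two sets of endpoints. -/
noncomputable def midEdgeDist (G : SimpleGraph V) (e f : Sym2 V) : ℕ :=
  if e = f then 0 else setDist G {x | x ∈ e} {x | x ∈ f} + 1

/-- `‖π‖`: distance between the endpoints of a walk. -/
noncomputable def MidSAW.displacement {G : SimpleGraph V} {n : ℕ} (π : MidSAW G n) : ℕ :=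
  midEdgeDist G (π.edge 0) (π.edge (Fin.last n))

/-! ### Critical exponents -/

/-- The point of `[-∞, ∞]` where a non-increasing function `F` with values in `[0, ∞]` changes
from infinite to finite. -/
noncomputable def criticalIndex (F : ℝ → ℝ≥0∞) : EReal :=
  sInf (Real.toEReal '' {y : ℝ | F y < ⊤})

theorem criticalIndex_spec {F : ℝ → ℝ≥0∞} (hF : Antitone F) (y : ℝ) :
    ((y : EReal) < criticalIndex F → F y = ⊤) ∧ (criticalIndex F < (y : EReal) → F y < ⊤) := by
  constructor
  · intro h
    by_contra hne
    have hy : F y < ⊤ := lt_top_iff_ne_top.2 hne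
    have hle : criticalIndex F ≤ (y : EReal) := sInf_le (Set.mem_image_of_mem _ hy)
    exact absurd hle (not_le.2 h)
  · intro h
    obtain ⟨_, ⟨r, hr, rfl⟩, hlt⟩ := sInf_lt_iff.1 h
    exact lt_of_le_of_lt (hF (EReal.coe_lt_coe_iff.1 hlt).le) hr

/-- `Y(x, y) = ∑_{π ∈ Σ} x^{|π|} / |π|^y`, the denominator being `1` if `|π| = 0`. -/
noncomputable def seriesY (G : SimpleGraph V) (W : Set V) (x y : ℝ) : ℝ≥0∞ :=
  ∑' π : (Σ n : ℕ, SAWFrom G W n),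
    ENNReal.ofReal (x ^ π.1 / (if π.1 = 0 then 1 else (π.1 : ℝ) ^ y))

theorem seriesY_antitone (G : SimpleGraph V) (W : Set V) {x : ℝ} (hx : 0 ≤ x) :
    Antitone (seriesY G W x) := by
  intro y y' h
  refine ENNReal.tsum_le_tsum fun π => ENNReal.ofReal_le_ofReal ?_
  split_ifs with h0
  · exact le_rfl
  · have h1 : (1 : ℝ) ≤ π.1 := by exact_mod_cast Nat.one_le_iff_ne_zero.2 h0
    have h2 : (0 : ℝ) < (π.1 : ℝ) ^ y := Real.rpow_pos_of_pos (by linarith) _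
    exact div_le_div_of_nonneg_left (pow_nonneg hx _) h2
      (Real.rpow_le_rpow_of_exponent_le h1 h)

/-- The exponent `γ`: the `γ ∈ [-∞, ∞]` with `Y(μ⁻¹, y) = ∞` for `y < γ` and `Y(μ⁻¹, y) < ∞` for
`y > γ`. -/
noncomputable def gammaExp (G : SimpleGraph V) (W : Set V) : EReal :=
  criticalIndex (seriesY G W (connectiveConstant G)⁻¹)

/-- `⟨‖π‖²⟩_n`: the average of `‖π‖²` over the uniform measure on `Σ_n`. -/
noncomputable def meanSqDisplacement (G : SimpleGraph V) (W : Set V) (n : ℕ) : ℝ≥0∞ :=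
  (∑' π : SAWFrom G W n, (π.1.displacement : ℝ≥0∞) ^ 2) / (sawCount G W n : ℝ≥0∞)

/-- `V(z) = ∑_{n ≥ 1} n^{-(2z+1)} ⟨‖π‖²⟩_n`. -/
noncomputable def seriesV (G : SimpleGraph V) (W : Set V) (z : ℝ) : ℝ≥0∞ :=
  ∑' n : ℕ, meanSqDisplacement G W (n + 1) / ((n + 1 : ℕ) : ℝ≥0∞) ^ (2 * z + 1)

theorem seriesV_antitone (G : SimpleGraph V) (W : Set V) : Antitone (seriesV G W) := by
  intro z z' h
  refine ENNReal.tsum_le_tsum fun n => ENNReal.div_le_div_left ?_ _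
  refine ENNReal.rpow_le_rpow_of_exponent_le ?_ (by linarith)
  exact_mod_cast Nat.le_add_left 1 n

/-- The exponent `ν`: the `ν ∈ [-∞, ∞]` with `V(z) = ∞` for `z < ν` and `V(z) < ∞` for `z > ν`. -/
noncomputable def nuExp (G : SimpleGraph V) (W : Set V) : EReal :=
  criticalIndex (seriesV G W)

/-- `∑ x^{|π|}` over the walks `π ∈ Σ` that end at mid-edges of edges incident to `W'`; with
`W' = αW` this is `Z_α(x)`. -/
noncomputable def seriesZ (G : SimpleGraph V) (W W' : Set V) (x : ℝ) : ℝ≥0∞ :=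
  ∑' π : (Σ n : ℕ, {π : SAWFrom G W n // π.1.edge (Fin.last n) ∈ incidentEdges G W'}),
    ENNReal.ofReal (x ^ π.1)

/-- `η ∈ [-∞, ∞]` is the exponent `η`: for every sequence of automorphisms `α_k` with
`d(W, α_k W) → ∞`, `Z_{α_k}(μ⁻¹) d(W, α_k W)^w` tends to `0` if `w < η` and to `∞` if `w > η`. -/
def IsEta (G : SimpleGraph V) (W : Set V) (η : EReal) : Prop :=
  ∀ α : ℕ → (G ≃g G), Tendsto (fun k => setDist G W (α k '' W)) atTop atTop →
    ∀ w : ℝ,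
      ((w : EReal) < η →
        Tendsto (fun k => seriesZ G W (α k '' W) (connectiveConstant G)⁻¹ *
          (setDist G W (α k '' W) : ℝ≥0∞) ^ w) atTop (𝓝 0)) ∧
      (η < (w : EReal) →
        Tendsto (fun k => seriesZ G W (α k '' W) (connectiveConstant G)⁻¹ *
          (setDist G W (α k '' W) : ℝ≥0∞) ^ w) atTop (𝓝 ⊤))

/-- Slowly varying functions (at infinity), on the positive half-line. -/
structure SlowlyVarying (L : ℝ → ℝ) : Prop where
  measurable : Measurable L
  pos : ∀ x : ℝ, 0 < x → 0 < L x
  tendsto : ∀ t : ℝ, 0 < t → Tendsto (fun x => L (t * x) / L x) atTop (𝓝 1)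

/-- `C₁ L(n) n^{γ-1} μⁿ ≤ σ_n ≤ C₂ L(n) n^{γ-1} μⁿ` for all `n ≥ 1`, with `γ = γ(G)` (to be used
when `γ(G)` is finite), `μ = μ(G)` and some constants `C₁, C₂ ∈ (0, ∞)`. -/
def HasSlowCorrection (G : SimpleGraph V) (W : Set V) (L : ℝ → ℝ) : Prop :=
  ∃ C₁ C₂ : ℝ, 0 < C₁ ∧ 0 < C₂ ∧ ∀ n : ℕ, 1 ≤ n →
    C₁ * L n * (n : ℝ) ^ ((gammaExp G W).toReal - 1) * connectiveConstant G ^ n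
        ≤ (sawCount G W n : ℝ) ∧
      (sawCount G W n : ℝ)
        ≤ C₂ * L n * (n : ℝ) ^ ((gammaExp G W).toReal - 1) * connectiveConstant G ^ n

end Graph

/-! ### Local transformations -/

/-- A gadget: a connected graph with three distinct outer vertices, such that the automorphisms
of the graph that preserve the set of outer vertices act transitively on it. -/
structure Gadget (H : Type v) where
  graph : SimpleGraph H
  connected : graph.Connected
  outer : Fin 3 ↪ H
  symmetric : ∀ i j : Fin 3, ∃ f : graph ≃g graph,
    f (outer i) = outer j ∧ f '' Set.range outer = Set.range outer

/-- The graph `φ(G)`: every vertex `x` is replaced by a copy `{x} × H` of the gadget, and the edge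
`⟨x, y⟩` of `G` joins the outer vertex number `att x y` of the copy at `x` to the outer vertex
number `att y x` of the copy at `y`. At each `x` the outer vertices are attached bijectively to
the three edges incident to `x`. -/
def localTransform {V : Type u} {H : Type v} (G : SimpleGraph V) (φ : Gadget H)
    (att : ∀ x : V, G.neighborSet x ≃ Fin 3) : SimpleGraph (V × H) where
  Adj p q := (p.1 = q.1 ∧ φ.graph.Adj p.2 q.2) ∨
    ∃ h : G.Adj p.1 q.1, p.2 = φ.outer (att p.1 ⟨q.1, h⟩) ∧ q.2 = φ.outer (att q.1 ⟨p.1, h.symm⟩)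
  symm := ⟨by
    rintro p q (⟨h1, h2⟩ | ⟨h, h1, h2⟩)
    · exact Or.inl ⟨h1.symm, h2.symm⟩
    · exact Or.inr ⟨h.symm, h2, h1⟩⟩
  loopless := ⟨by
    rintro p (⟨_, h⟩ | ⟨h, _⟩)
    · exact φ.graph.loopless.irrefl _ h
    · exact G.loopless.irrefl _ h⟩

/-- `φ(W)`: all vertices of the gadgets placed at the vertices in `W`. -/
def gadgetsOver {V : Type u} (H : Type v) (W : Set V) : Set (V × H) :=
  {p | p.1 ∈ W}

end LocalSAW

/-! Write h for the number of vertices of the gadget and g(t) for the generating function, by number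
of vertices, of its paths between two outer vertices. By the symmetry of the gadget, g does not
depend on the pair of outer vertices.

A walk of G₁ that starts and ends on edges coming from G₀ crosses a sequence of gadgets, each from
one outer vertex to another. Since only three edges meet at a gadget and no edge is used twice, no
gadget is crossed twice, so the walk lies over a self-avoiding walk of G₀ (`exists_mem_liftSet`).
Conversely, the lifts of an n-step walk of G₀ are obtained by choosing independently a path in each
gadget crossed, so their generating function is g(t)^n (`tsum_liftSet`). A walk of G₁ with more than
2h vertices is such a lift with at most h further steps at either end (`exists_decomposition`), and
the number of possible end pieces is bounded.

Hence a sum over walks of G₁ with weight t^n F₁ is comparable with the sum over walks of G₀ with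
weight g(t)^n F₀, whenever F₁ and F₀ agree up to constants on corresponding endpoints and on lengths
m, n with n ≤ m ≤ 3hn (`walkSum_le_walkSum_localTransform`, `walkSum_localTransform_le`). Everything
else is an application of this comparison.

With F = 1 it compares radii of convergence. These are the inverse connective constants by
Hammersley's theorem, which is proved on the way, and continuity of g yields g(1/μ(G₁)) = 1/μ(G₀)
(`gadgetGF_inv_connectiveConstant`). At these critical points, powers of the length change by
bounded factors, so Y for G₁ and Y for G₀ are finite for the same y, which is the claim on γ.
Distances in G₁ and G₀ are comparable too, so restricting the end of the walk compares the two
functions Z (`seriesZ_comparison`), and an exponent η of G₁ is one of G₀. Uniqueness of η holds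
because some sequence of automorphisms moves the fundamental domain to infinity.

For ν, V is written as a sum over single walks with the factor 1/σ_n. The assumed asymptotics
replace 1/σ_n by μ^{-n} n^{1-γ}/L(n), with the same γ and L for both graphs. It remains to know that
L(m) and L(n) are comparable for n ≤ m ≤ Kn, which follows from the uniform convergence theorem for
slowly varying functions (`SlowlyVarying.exists_ratio_bound`). -/

namespace LocalSAW

/-! ### Mid-edge walks as lists -/

section Lists

variable {V : Type*}

/-- A walk between mid-edges starting at `e`, recorded as the list of pairs of a vertex and the
edge that follows it. -/
def MidChain (G : SimpleGraph V) : Sym2 V → List (V × Sym2 V) → Prop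
  | _, [] => True
  | e, p :: l => p.1 ∈ e ∧ p.1 ∈ p.2 ∧ p.2 ∈ G.edgeSet ∧ MidChain G p.2 l

/-- The last edge of a walk. -/
def endEdge : Sym2 V → List (V × Sym2 V) → Sym2 V
  | e, [] => e
  | _, p :: l => endEdge p.2 l

/-- The steps of the reversed walk. -/
def revSteps : Sym2 V → List (V × Sym2 V) → List (V × Sym2 V)
  | _, [] => []
  | e, p :: l => revSteps p.2 l ++ [(p.1, e)]

@[simp] theorem endEdge_nil (e : Sym2 V) : endEdge e [] = e := rfl

@[simp] theorem endEdge_cons (e : Sym2 V) (p : V × Sym2 V) (l : List (V × Sym2 V)) :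
    endEdge e (p :: l) = endEdge p.2 l := rfl

@[simp] theorem midChain_nil (G : SimpleGraph V) (e : Sym2 V) : MidChain G e [] := trivial

theorem midChain_cons {G : SimpleGraph V} {e : Sym2 V} {p : V × Sym2 V} {l : List (V × Sym2 V)} :
    MidChain G e (p :: l) ↔ p.1 ∈ e ∧ p.1 ∈ p.2 ∧ p.2 ∈ G.edgeSet ∧ MidChain G p.2 l := Iff.rfl

theorem endEdge_append (e : Sym2 V) (l l' : List (V × Sym2 V)) :
    endEdge e (l ++ l') = endEdge (endEdge e l) l' := by
  induction l generalizing e with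
  | nil => rfl
  | cons p l ih => exact ih _

theorem midChain_append {G : SimpleGraph V} {e : Sym2 V} {l l' : List (V × Sym2 V)} :
    MidChain G e (l ++ l') ↔ MidChain G e l ∧ MidChain G (endEdge e l) l' := by
  induction l generalizing e with
  | nil => simp
  | cons p l ih => simp only [List.cons_append, midChain_cons, ih, endEdge_cons, and_assoc]

theorem endEdge_mem (e : Sym2 V) (l : List (V × Sym2 V)) : endEdge e l ∈ e :: l.map Prod.snd := by
  induction l generalizing e with
  | nil => simp
  | cons p l ih => exact List.mem_cons_of_mem _ (ih p.2)

theorem MidChain.edge_mem {G : SimpleGraph V} {e : Sym2 V} {l : List (V × Sym2 V)}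
    (h : MidChain G e l) {p : V × Sym2 V} (hp : p ∈ l) : p.1 ∈ p.2 ∧ p.2 ∈ G.edgeSet := by
  induction l generalizing e with
  | nil => simp at hp
  | cons q l ih =>
    rcases List.mem_cons.1 hp with rfl | hp
    · exact ⟨h.2.1, h.2.2.1⟩
    · exact ih h.2.2.2 hp

theorem MidChain.endEdge_mem {G : SimpleGraph V} {e : Sym2 V} {l : List (V × Sym2 V)}
    (he : e ∈ G.edgeSet) (h : MidChain G e l) : endEdge e l ∈ G.edgeSet := by
  induction l generalizing e with
  | nil => exact he
  | cons q l ih => exact ih h.2.2.1 h.2.2.2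

theorem revSteps_length (e : Sym2 V) (l : List (V × Sym2 V)) :
    (revSteps e l).length = l.length := by
  induction l generalizing e with
  | nil => rfl
  | cons p l ih => simp [revSteps, ih]

theorem endEdge_revSteps (e : Sym2 V) (l : List (V × Sym2 V)) :
    endEdge (endEdge e l) (revSteps e l) = e := by
  induction l generalizing e with
  | nil => rfl
  | cons p l ih => simp [revSteps, endEdge_append]

theorem revSteps_append (e : Sym2 V) (l l' : List (V × Sym2 V)) :
    revSteps e (l ++ l') = revSteps (endEdge e l) l' ++ revSteps e l := by
  induction l generalizing e with
  | nil => simp [revSteps]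
  | cons p l ih => simp [revSteps, ih]

theorem revSteps_revSteps (e : Sym2 V) (l : List (V × Sym2 V)) :
    revSteps (endEdge e l) (revSteps e l) = l := by
  induction l generalizing e with
  | nil => rfl
  | cons p l ih =>
    rw [revSteps, endEdge_cons, revSteps_append, endEdge_revSteps, ih]
    simp [revSteps]

theorem MidChain.revSteps {G : SimpleGraph V} {e : Sym2 V} {l : List (V × Sym2 V)}
    (he : e ∈ G.edgeSet) (h : MidChain G e l) : MidChain G (endEdge e l) (revSteps e l) := by
  induction l generalizing e with
  | nil => trivial
  | cons p l ih =>
    rw [LocalSAW.revSteps, endEdge_cons, midChain_append, endEdge_revSteps]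
    exact ⟨ih h.2.2.1 h.2.2.2, h.2.1, h.1, he, trivial⟩

/-- The list `l` of steps from `e` is a self-avoiding walk. -/
structure IsMidSAW (G : SimpleGraph V) (e : Sym2 V) (l : List (V × Sym2 V)) : Prop where
  edge_mem : e ∈ G.edgeSet
  chain : MidChain G e l
  vert_nodup : (l.map Prod.fst).Nodup
  edge_nodup : (e :: l.map Prod.snd).Nodup

theorem IsMidSAW.of_append {G : SimpleGraph V} {e : Sym2 V} {l l' : List (V × Sym2 V)}
    (h : IsMidSAW G e (l ++ l')) : IsMidSAW G e l ∧ IsMidSAW G (endEdge e l) l' := by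
  obtain ⟨h1, h2, h3, h4⟩ := h
  rw [midChain_append] at h2
  rw [List.map_append] at h3 h4
  refine ⟨⟨h1, h2.1, h3.of_append_left, ?_⟩, h2.1.endEdge_mem h1, h2.2, h3.of_append_right, ?_⟩
  · rw [← List.cons_append] at h4
    exact h4.of_append_left
  · rw [← List.cons_append] at h4
    have := (List.nodup_append.1 h4)
    exact List.nodup_cons.2 ⟨fun hm => this.2.2 _ (endEdge_mem e l) _ hm rfl, this.2.1⟩

theorem midChain_ofFn {G : SimpleGraph V} {n : ℕ} (e : Sym2 V) (g : Fin n → V × Sym2 V) :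
    MidChain G e (List.ofFn g) ↔ ∀ i : Fin n,
      (g i).1 ∈ (Fin.cons e (fun j => (g j).2) : Fin (n + 1) → Sym2 V) i.castSucc ∧
      (g i).1 ∈ (g i).2 ∧ (g i).2 ∈ G.edgeSet := by
  induction n generalizing e with
  | zero => simp
  | succ n ih =>
    rw [List.ofFn_succ, midChain_cons, ih, Fin.forall_fin_succ, and_assoc, and_assoc]
    refine and_congr Iff.rfl (and_congr Iff.rfl (and_congr Iff.rfl (forall_congr' fun i => ?_)))
    have : (Fin.cons (g 0).2 (fun j => (g (Fin.succ j)).2) : Fin (n + 1) → Sym2 V) i.castSucc =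
        (Fin.cons e (fun j => (g j).2) : Fin (n + 2) → Sym2 V) i.succ.castSucc := by
      rw [← Fin.succ_castSucc, Fin.cons_succ]
      refine Fin.cases ?_ (fun j => ?_) i.castSucc <;> simp
    rw [this]

theorem endEdge_ofFn {n : ℕ} (e : Sym2 V) (g : Fin n → V × Sym2 V) :
    endEdge e (List.ofFn g) =
      (Fin.cons e (fun j => (g j).2) : Fin (n + 1) → Sym2 V) (Fin.last n) := by
  induction n generalizing e with
  | zero => simp
  | succ n ih =>
    rw [List.ofFn_succ, endEdge_cons, ih, ← Fin.succ_last, Fin.cons_succ]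
    refine Fin.cases ?_ (fun j => ?_) (Fin.last n) <;> simp

/-- The steps of a self-avoiding walk. -/
def MidSAW.steps {G : SimpleGraph V} {n : ℕ} (π : MidSAW G n) : List (V × Sym2 V) :=
  List.ofFn fun i => (π.vert i, π.edge i.succ)

theorem MidSAW.steps_length {G : SimpleGraph V} {n : ℕ} (π : MidSAW G n) :
    π.steps.length = n := by simp [MidSAW.steps]

theorem MidSAW.cons_edge {G : SimpleGraph V} {n : ℕ} (π : MidSAW G n) :
    (Fin.cons (π.edge 0) (fun j => π.edge j.succ) : Fin (n + 1) → Sym2 V) = π.edge :=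
  Fin.cons_self_tail π.edge

theorem MidSAW.endEdge_steps {G : SimpleGraph V} {n : ℕ} (π : MidSAW G n) :
    endEdge (π.edge 0) π.steps = π.edge (Fin.last n) := by
  rw [MidSAW.steps, endEdge_ofFn]
  exact congrFun π.cons_edge _

theorem MidSAW.isMidSAW {G : SimpleGraph V} {n : ℕ} (π : MidSAW G n) :
    IsMidSAW G (π.edge 0) π.steps := by
  refine ⟨π.edge_mem 0, ?_, ?_, ?_⟩
  · rw [MidSAW.steps, midChain_ofFn]
    intro i
    refine ⟨?_, π.vert_mem_right i, π.edge_mem _⟩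
    have := π.vert_mem_left i
    rwa [← π.cons_edge] at this
  · rw [MidSAW.steps, List.map_ofFn, List.nodup_ofFn]
    exact π.vert_injective
  · have : π.edge 0 :: π.steps.map Prod.snd = List.ofFn π.edge := by
      rw [MidSAW.steps, List.map_ofFn, List.ofFn_succ]
      rfl
    rw [this, List.nodup_ofFn]
    exact π.edge_injective

theorem MidSAW.ext_steps {G : SimpleGraph V} {n : ℕ} {π π' : MidSAW G n}
    (h0 : π.edge 0 = π'.edge 0) (h : π.steps = π'.steps) : π = π' := by
  have h1 := List.ofFn_injective h
  ext1
  · rw [← π.cons_edge, ← π'.cons_edge, h0]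
    congr 1
    funext i
    exact congrArg Prod.snd (congrFun h1 i)
  · funext i
    exact congrArg Prod.fst (congrFun h1 i)

/-- Lists are the working form of walks, because cutting, joining and reversing are needed
throughout. This is the way back to the indexed structure. -/
theorem IsMidSAW.exists_midSAW {G : SimpleGraph V} {e : Sym2 V} {l : List (V × Sym2 V)}
    (h : IsMidSAW G e l) : ∃ π : MidSAW G l.length, π.edge 0 = e ∧ π.steps = l := by
  obtain ⟨n, g, rfl⟩ : ∃ n, ∃ g : Fin n → V × Sym2 V, l = List.ofFn g :=
    ⟨l.length, l.get, (List.ofFn_get l).symm⟩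
  suffices ∃ π : MidSAW G n, π.edge 0 = e ∧ π.steps = List.ofFn g by
    rw [List.length_ofFn]; exact this
  obtain ⟨h1, h2, h3, h4⟩ := h
  rw [midChain_ofFn] at h2
  rw [List.map_ofFn, List.nodup_ofFn] at h3
  have : e :: (List.ofFn g).map Prod.snd =
      List.ofFn (Fin.cons e (fun j => (g j).2) : Fin (n + 1) → Sym2 V) := by
    rw [List.map_ofFn, List.ofFn_succ]
    rfl
  rw [this, List.nodup_ofFn] at h4
  exact ⟨⟨Fin.cons e fun j => (g j).2, fun i => (g i).1,
    fun i => Fin.cases h1 (fun j => (h2 j).2.2) i, fun i => (h2 i).1, fun i => (h2 i).2.1,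
    h4, h3⟩, rfl, rfl⟩

/-- Self-avoiding walks from `W` of any length, as lists. -/
abbrev ListSAW (G : SimpleGraph V) (W : Set V) : Type _ :=
  {p : Sym2 V × List (V × Sym2 V) // IsMidSAW G p.1 p.2 ∧ p.1 ∈ incidentEdges G W}

/-- Self-avoiding walks as structures and as lists. -/
noncomputable def sawEquiv (G : SimpleGraph V) (W : Set V) :
    (Σ n : ℕ, SAWFrom G W n) ≃ ListSAW G W :=
  Equiv.ofBijective (fun π => ⟨(π.2.1.edge 0, π.2.1.steps), π.2.1.isMidSAW, π.2.2⟩) <| by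
    constructor
    · rintro ⟨n, π, hπ⟩ ⟨n', π', hπ'⟩ h
      simp only [Subtype.mk.injEq, Prod.mk.injEq] at h
      obtain rfl : n = n' := by rw [← π.steps_length, h.2, π'.steps_length]
      obtain rfl := MidSAW.ext_steps h.1 h.2
      rfl
    · rintro ⟨⟨e, l⟩, h1, h2⟩
      obtain ⟨π, h0, h⟩ := h1.exists_midSAW
      exact ⟨⟨l.length, π, h0 ▸ h2⟩, Subtype.ext (Prod.ext h0 h)⟩

/-- The sum of a function of start, end and length over the self-avoiding walks from `W`. -/
noncomputable def walkSum (G : SimpleGraph V) (W : Set V) (F : Sym2 V → Sym2 V → ℕ → ℝ≥0∞) :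
    ℝ≥0∞ :=
  ∑' p : ListSAW G W, F p.1.1 (endEdge p.1.1 p.1.2) p.1.2.length

theorem walkSum_eq (G : SimpleGraph V) (W : Set V) (F : Sym2 V → Sym2 V → ℕ → ℝ≥0∞) :
    walkSum G W F =
      ∑' n, ∑' π : SAWFrom G W n, F (π.1.edge 0) (π.1.edge (Fin.last n)) n := by
  rw [walkSum, ← (sawEquiv G W).tsum_eq, ENNReal.tsum_sigma']
  refine tsum_congr fun n => tsum_congr fun π => ?_
  have : sawEquiv G W ⟨n, π⟩ = ⟨(π.1.edge 0, π.1.steps), π.1.isMidSAW, π.2⟩ := rfl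
  rw [this, MidSAW.endEdge_steps, MidSAW.steps_length]

theorem walkSum_mono {G : SimpleGraph V} {W : Set V} {F F' : Sym2 V → Sym2 V → ℕ → ℝ≥0∞}
    (h : ∀ e l, IsMidSAW G e l → e ∈ incidentEdges G W →
      F e (endEdge e l) l.length ≤ F' e (endEdge e l) l.length) :
    walkSum G W F ≤ walkSum G W F' :=
  ENNReal.tsum_le_tsum fun p => h _ _ p.2.1 p.2.2

theorem walkSum_add (G : SimpleGraph V) (W : Set V) (F F' : Sym2 V → Sym2 V → ℕ → ℝ≥0∞) :
    walkSum G W (fun s t n => F s t n + F' s t n) = walkSum G W F + walkSum G W F' :=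
  ENNReal.tsum_add

theorem seriesY_eq_walkSum (G : SimpleGraph V) (W : Set V) (x y : ℝ) :
    seriesY G W x y =
      walkSum G W fun _ _ n => ENNReal.ofReal (x ^ n / (if n = 0 then 1 else (n : ℝ) ^ y)) := by
  rw [walkSum_eq, seriesY, ENNReal.tsum_sigma']

open Classical in
theorem seriesZ_eq_walkSum (G : SimpleGraph V) (W W' : Set V) (x : ℝ) :
    seriesZ G W W' x = walkSum G W fun _ t n =>
      if t ∈ incidentEdges G W' then ENNReal.ofReal (x ^ n) else 0 := by
  rw [walkSum_eq, seriesZ, ENNReal.tsum_sigma']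
  refine tsum_congr fun n => ?_
  refine (tsum_subtype {π : SAWFrom G W n | π.1.edge (Fin.last n) ∈ incidentEdges G W'}
    fun _ => ENNReal.ofReal (x ^ n)).trans ?_
  refine tsum_congr fun π => ?_
  simp [Set.indicator_apply]

/-- Each average is spread over its walks, every walk carrying the factor 1/σ_n, so that V has the
same shape as Y and Z. The zero weight at n = 0 accounts for the series starting at n = 1. -/
theorem seriesV_eq_walkSum (G : SimpleGraph V) (W : Set V) (z : ℝ) :
    seriesV G W z = walkSum G W fun s t n => if n = 0 then 0 else
      (midEdgeDist G s t : ℝ≥0∞) ^ 2 / (sawCount G W n : ℝ≥0∞) /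
        (n : ℝ≥0∞) ^ (2 * z + 1) := by
  rw [walkSum_eq, tsum_eq_zero_add' ENNReal.summable, seriesV]
  simp only [if_true, tsum_zero, zero_add, Nat.add_eq_zero_iff, one_ne_zero, and_false, if_false]
  refine tsum_congr fun n => ?_
  rw [meanSqDisplacement]
  simp only [div_eq_mul_inv]
  rw [ENNReal.tsum_mul_right, ENNReal.tsum_mul_right]
  rfl

end Lists

/-! ### Counting walks -/

section Count

variable {V : Type*}

/-- All vertices have at most `Δ` neighbours. -/
def DegreeBounded (G : SimpleGraph V) (Δ : ℕ) : Prop :=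
  ∀ x : V, (G.neighborSet x).encard ≤ Δ

theorem DegreeBounded.encard_incidenceSet {G : SimpleGraph V} {Δ : ℕ} (h : DegreeBounded G Δ)
    (x : V) : (G.incidenceSet x).encard ≤ Δ := by
  classical
  refine le_trans (le_of_eq ?_) (h x)
  exact ENat.card_congr (G.incidenceSetEquivNeighborSet x)

/-- The possible first steps from an edge. -/
def stepSet (G : SimpleGraph V) (e : Sym2 V) : Set (V × Sym2 V) :=
  {p | p.1 ∈ e ∧ p.1 ∈ p.2 ∧ p.2 ∈ G.edgeSet}

theorem DegreeBounded.encard_stepSet {G : SimpleGraph V} {Δ : ℕ} (h : DegreeBounded G Δ)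
    (e : Sym2 V) : (stepSet G e).encard ≤ (2 * Δ : ℕ) := by
  induction e using Sym2.ind with
  | _ a b =>
  have hsub : stepSet G s(a, b) ⊆
      (fun f => (a, f)) '' G.incidenceSet a ∪ (fun f => (b, f)) '' G.incidenceSet b := by
    rintro ⟨x, f⟩ ⟨h1, h2, h3⟩
    rcases Sym2.mem_iff.1 h1 with rfl | rfl
    · exact Or.inl ⟨f, ⟨h3, h2⟩, rfl⟩
    · exact Or.inr ⟨f, ⟨h3, h2⟩, rfl⟩
  refine (Set.encard_le_encard hsub).trans ((Set.encard_union_le _ _).trans ?_)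
  refine (add_le_add (Set.encard_image_le _ _) (Set.encard_image_le _ _)).trans ?_
  refine (add_le_add (h.encard_incidenceSet a) (h.encard_incidenceSet b)).trans ?_
  rw [two_mul]; exact le_of_eq (by norm_cast)

/-- The walks of `k` steps from an edge, not necessarily self-avoiding. -/
def chainSet (G : SimpleGraph V) (e : Sym2 V) (k : ℕ) : Set (List (V × Sym2 V)) :=
  {l | MidChain G e l ∧ l.length = k}

theorem DegreeBounded.finite_chainSet {G : SimpleGraph V} {Δ : ℕ} (h : DegreeBounded G Δ)
    (e : Sym2 V) (k : ℕ) : (chainSet G e k).Finite ∧ (chainSet G e k).encard ≤ ((2 * Δ) ^ k : ℕ) := by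
  rw [← Set.encard_lt_top_iff]
  suffices (chainSet G e k).encard ≤ ((2 * Δ) ^ k : ℕ) from
    ⟨this.trans_lt (ENat.natCast_lt_top _), this⟩
  induction k generalizing e with
  | zero =>
    have : chainSet G e 0 ⊆ {[]} := fun l hl => List.length_eq_zero_iff.1 hl.2
    refine (Set.encard_le_encard this).trans ?_
    simp
  | succ k ih =>
    have hfin : (stepSet G e).Finite :=
      Set.encard_lt_top_iff.1 ((h.encard_stepSet e).trans_lt (ENat.natCast_lt_top _))
    have hsub : chainSet G e (k + 1) ⊆
        ⋃ p ∈ hfin.toFinset, (fun l => p :: l) '' chainSet G p.2 k := by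
      rintro l ⟨h1, h2⟩
      match l, h1, h2 with
      | p :: l, h1, h2 =>
        simp only [Set.mem_iUnion]
        exact ⟨p, hfin.mem_toFinset.2 ⟨h1.1, h1.2.1, h1.2.2.1⟩, l,
          ⟨h1.2.2.2, by simpa using h2⟩, rfl⟩
    refine (Set.encard_le_encard hsub).trans ?_
    refine (Finset.set_encard_biUnion_le _ _).trans ?_
    refine (Finset.sum_le_sum fun p _ => (Set.encard_image_le _ _).trans (ih p.2)).trans ?_
    rw [Finset.sum_const, nsmul_eq_mul, pow_succ']
    push_cast
    gcongr
    have := h.encard_stepSet e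
    rw [hfin.encard_eq_coe_toFinset_card] at this
    exact_mod_cast this

/-- The walks of at most `k` steps from an edge. -/
abbrev ShortChain (G : SimpleGraph V) (e : Sym2 V) (k : ℕ) : Type _ :=
  {l : List (V × Sym2 V) // MidChain G e l ∧ l.length ≤ k}

/-- The bound does not depend on the starting edge. It counts the possible end pieces of a walk of
the transformed graph, for which self-avoidance can be dropped. -/
theorem DegreeBounded.tsum_shortChain {G : SimpleGraph V} {Δ : ℕ} (h : DegreeBounded G Δ)
    (e : Sym2 V) (k : ℕ) (c : ℝ≥0∞) :
    ∑' _ : ShortChain G e k, c ≤ (∑ i ∈ Finset.range (k + 1), (2 * Δ) ^ i : ℕ) * c := by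
  have hsub : {l | MidChain G e l ∧ l.length ≤ k} ⊆
      ⋃ i ∈ Finset.range (k + 1), chainSet G e i := by
    intro l hl
    simp only [Set.mem_iUnion, Finset.mem_range]
    exact ⟨l.length, Nat.lt_succ_of_le hl.2, hl.1, rfl⟩
  have hcard : ({l | MidChain G e l ∧ l.length ≤ k} : Set _).encard ≤
      (∑ i ∈ Finset.range (k + 1), (2 * Δ) ^ i : ℕ) := by
    refine (Set.encard_le_encard hsub).trans ((Finset.set_encard_biUnion_le _ _).trans ?_)
    refine (Finset.sum_le_sum fun i _ => (h.finite_chainSet e i).2).trans ?_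
    exact_mod_cast le_rfl
  rw [ENNReal.tsum_const]
  gcongr
  have := ENat.toENNReal_le.2 hcard
  rw [ENat.toENNReal_coe] at this
  exact this

theorem DegreeBounded.finite_incidentEdges {G : SimpleGraph V} {Δ : ℕ} (h : DegreeBounded G Δ)
    {W : Set V} (hW : W.Finite) : (incidentEdges G W).Finite := by
  refine (hW.biUnion fun x _ => Set.encard_lt_top_iff.1
    ((h.encard_incidenceSet x).trans_lt (ENat.natCast_lt_top _))).subset ?_
  rintro e ⟨he, x, hx, hxe⟩
  exact Set.mem_biUnion hx ⟨he, hxe⟩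

theorem DegreeBounded.finite_sawFrom {G : SimpleGraph V} {Δ : ℕ} (h : DegreeBounded G Δ)
    {W : Set V} (hW : W.Finite) (n : ℕ) : Finite (SAWFrom G W n) := by
  have := (h.finite_incidentEdges hW).to_subtype
  have := fun e : incidentEdges G W => (h.finite_chainSet e.1 n).1.to_subtype
  refine Finite.of_injective (β := Σ e : incidentEdges G W, chainSet G e.1 n)
    (fun π => ⟨⟨π.1.edge 0, π.2⟩, π.1.steps, π.1.isMidSAW.chain, π.1.steps_length⟩) ?_
  intro π π' hh
  have h1 := congrArg (fun q => q.1.1) hh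
  have h2 := congrArg (fun q => q.2.1) hh
  exact Subtype.ext (MidSAW.ext_steps h1 h2)

/-- Terms of bounded length do not affect finiteness of a sum over walks. -/
theorem DegreeBounded.walkSum_short_lt_top {G : SimpleGraph V} {Δ : ℕ} (h : DegreeBounded G Δ)
    {W : Set V} (hW : W.Finite) (N : ℕ) {F : Sym2 V → Sym2 V → ℕ → ℝ≥0∞}
    (hF : ∀ s t n, F s t n ≠ ⊤) :
    walkSum G W (fun s t n => if n ≤ N then F s t n else 0) < ⊤ := by
  rw [walkSum_eq, tsum_eq_sum (s := Finset.range (N + 1))]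
  · refine ENNReal.sum_lt_top.2 fun n _ => ?_
    have := h.finite_sawFrom hW n
    have := Fintype.ofFinite (SAWFrom G W n)
    rw [tsum_fintype]
    refine ENNReal.sum_lt_top.2 fun π _ => ?_
    split_ifs
    · exact (hF _ _ _).lt_top
    · exact ENNReal.zero_lt_top
  · intro n hn
    have : ¬ n ≤ N := fun hle => hn (Finset.mem_range.2 (Nat.lt_succ_of_le hle))
    simp [this]

end Count

/-! ### Self-avoiding walks between vertices as lists -/

section Paths

variable {V : Type*}

/-- Self-avoiding walks with `n` edges from `x`, as lists of the vertices after `x`. -/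
def pathSet (G : SimpleGraph V) (x : V) (n : ℕ) : Set (List V) :=
  {l | (x :: l).IsChain G.Adj ∧ (x :: l).Nodup ∧ l.length = n}

theorem vertexSAWCount_eq (G : SimpleGraph V) (x : V) (n : ℕ) :
    vertexSAWCount G x n = (pathSet G x n).ncard := by
  rw [vertexSAWCount, ← Nat.card_coe_set_eq]
  refine Nat.card_congr (Equiv.ofBijective (fun p => ⟨p.1.2.support.tail, ?_, ?_, ?_⟩) ⟨?_, ?_⟩)
  · rw [SimpleGraph.Walk.cons_tail_support]
    exact p.1.2.isChain_adj_support
  · rw [SimpleGraph.Walk.cons_tail_support]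
    exact p.2.1.support_nodup
  · rw [List.length_tail, SimpleGraph.Walk.length_support, p.2.2, Nat.add_sub_cancel]
  · rintro ⟨⟨y, p⟩, hp⟩ ⟨⟨y', p'⟩, hp'⟩ h
    have h1 : p.support = p'.support := by
      rw [← p.cons_tail_support, ← p'.cons_tail_support]
      exact congrArg (fun q => x :: q.1) h
    have h2 : y = y' := by
      rw [← p.getLast_support, ← p'.getLast_support]
      simp only [h1]
    subst h2
    have := SimpleGraph.Walk.ext_support h1
    subst this
    rfl
  · rintro ⟨l, h1, h2, h3⟩
    obtain ⟨p, hs⟩ : ∃ p : G.Walk x ((x :: l).getLast (List.cons_ne_nil x l)),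
        p.support = x :: l :=
      ⟨_, SimpleGraph.Walk.support_ofSupport (G := G) (List.cons_ne_nil x l) h1⟩
    refine ⟨⟨⟨_, p⟩, ?_, ?_⟩, ?_⟩
    · rw [SimpleGraph.Walk.isPath_def, hs]; exact h2
    · have := p.length_support
      rw [hs, List.length_cons, h3] at this
      exact (Nat.succ.inj this).symm
    · exact Subtype.ext (by simp [hs])

theorem pathSet_zero (G : SimpleGraph V) (x : V) : pathSet G x 0 = {[]} := by
  ext l
  simp only [pathSet, Set.mem_ofPred_eq, List.length_eq_zero_iff, Set.mem_singleton_iff]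
  exact ⟨fun h => h.2.2, fun h => by simp [h]⟩

/-- The steps of the walk through the vertices `a :: l` between the first and the last edge. -/
def pathSteps : V → List V → List (V × Sym2 V)
  | _, [] => []
  | a, b :: l => (a, s(a, b)) :: pathSteps b l

theorem pathSteps_length (a : V) (l : List V) : (pathSteps a l).length = l.length := by
  induction l generalizing a with
  | nil => rfl
  | cons b l ih => simp [pathSteps, ih]

theorem map_fst_pathSteps (a : V) (l : List V) :
    (pathSteps a l).map Prod.fst = (a :: l).dropLast := by
  induction l generalizing a with
  | nil => rfl
  | cons b l ih => simp [pathSteps, ih]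

theorem pathSteps_injective (a : V) : Function.Injective (pathSteps a) := by
  intro l l' h
  induction l generalizing a l' with
  | nil => cases l' with
    | nil => rfl
    | cons b' l' => simp [pathSteps] at h
  | cons b l ih => cases l' with
    | nil => simp [pathSteps] at h
    | cons b' l' =>
      simp only [pathSteps, List.cons.injEq, Prod.mk.injEq, true_and] at h
      obtain rfl := Sym2.congr_right.1 h.1
      rw [ih b h.2]

theorem midChain_pathSteps {G : SimpleGraph V} {e : Sym2 V} {a : V} {l : List V} (ha : a ∈ e)
    (h : (a :: l).IsChain G.Adj) : MidChain G e (pathSteps a l) ∧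
      (a :: l).getLast (List.cons_ne_nil a l) ∈ endEdge e (pathSteps a l) := by
  induction l generalizing a e with
  | nil => exact ⟨trivial, ha⟩
  | cons b l ih =>
    rw [List.isChain_cons_cons] at h
    obtain ⟨h1, h2⟩ := ih (e := s(a, b)) (Sym2.mem_mk_right a b) h.2
    refine ⟨⟨ha, Sym2.mem_mk_left a b, h.1, h1⟩, ?_⟩
    simpa [pathSteps] using h2

theorem mem_of_mem_pathSteps {a : V} {l : List V} {p : V × Sym2 V} (hp : p ∈ pathSteps a l)
    {x : V} (hx : x ∈ p.2) : x ∈ a :: l := by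
  induction l generalizing a with
  | nil => simp [pathSteps] at hp
  | cons b l ih =>
    rcases List.mem_cons.1 hp with rfl | hp
    · rcases Sym2.mem_iff.1 hx with rfl | rfl <;> simp
    · exact List.mem_cons_of_mem _ (ih hp)

theorem edges_pathSteps_nodup {a : V} {l : List V} (h : (a :: l).Nodup) :
    ((pathSteps a l).map Prod.snd).Nodup := by
  induction l generalizing a with
  | nil => simp [pathSteps]
  | cons b l ih =>
    obtain ⟨h1, h2⟩ := List.nodup_cons.1 h
    refine List.nodup_cons.2 ⟨fun hm => ?_, ih h2⟩
    obtain ⟨p, hp, he⟩ := List.mem_map.1 hm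
    exact h1 (mem_of_mem_pathSteps hp (he ▸ Sym2.mem_mk_left a b))

/-- Both ends of the vertex path are cut off at the midpoints of its extreme edges: neither the
first nor the last vertex counts as visited. The starting edge is not repeated because its end `x`
lies on no later edge. -/
theorem isMidSAW_of_path {G : SimpleGraph V} {x y : V} {l : List V}
    (h1 : (x :: y :: l).IsChain G.Adj) (h2 : (x :: y :: l).Nodup) :
    IsMidSAW G s(x, y) (pathSteps y l) := by
  rw [List.isChain_cons_cons] at h1
  obtain ⟨h3, h4⟩ := List.nodup_cons.1 h2
  refine ⟨h1.1, (midChain_pathSteps (Sym2.mem_mk_right x y) h1.2).1, ?_, ?_⟩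
  · rw [map_fst_pathSteps]
    exact h4.sublist (List.dropLast_sublist _)
  · refine List.nodup_cons.2 ⟨fun hm => ?_, edges_pathSteps_nodup h4⟩
    obtain ⟨p, hp, he⟩ := List.mem_map.1 hm
    exact h3 (mem_of_mem_pathSteps hp (he ▸ Sym2.mem_mk_left x y))

/-- A walk without repeated vertices is determined by its vertices and its last edge. -/
theorem MidChain.eq_pathSteps {G : SimpleGraph V} {e : Sym2 V} {p : V × Sym2 V}
    {l : List (V × Sym2 V)} (h : MidChain G e (p :: l)) (hn : ((p :: l).map Prod.fst).Nodup) :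
    (p.1 :: l.map Prod.fst).IsChain G.Adj ∧
    p :: l = pathSteps p.1 (l.map Prod.fst) ++
      [((p.1 :: l.map Prod.fst).getLast (List.cons_ne_nil _ _), endEdge e (p :: l))] := by
  induction l generalizing e p with
  | nil => simp [pathSteps]
  | cons q l ih =>
    obtain ⟨h1, h2⟩ := ih h.2.2.2 (List.nodup_cons.1 hn).2
    have hne : p.1 ≠ q.1 := by
      intro he
      refine (List.nodup_cons.1 hn).1 ?_
      simp [he]
    have hpe : p.2 = s(p.1, q.1) := ((Sym2.mem_and_mem_iff hne).1 ⟨h.2.1, h.2.2.2.1⟩)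
    have hadj : G.Adj p.1 q.1 := by
      have := h.2.2.1
      rwa [hpe] at this
    refine ⟨List.isChain_cons_cons.2 ⟨hadj, h1⟩, ?_⟩
    have : p = (p.1, s(p.1, q.1)) := Prod.ext rfl hpe
    simp only [List.map_cons, pathSteps, List.cons_append, endEdge_cons] at h2 ⊢
    rw [← this]
    congr 1

end Paths

/-! ### Growth of the number of self-avoiding walks from a vertex -/

section Growth

variable {V : Type*} {G : SimpleGraph V} {Δ : ℕ} {W : Set V}

theorem DegreeBounded.finite_pathSet (hΔ : DegreeBounded G Δ) (x : V) (n : ℕ) :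
    (pathSet G x n).Finite := by
  cases n with
  | zero => rw [pathSet_zero]; exact Set.finite_singleton _
  | succ n =>
    have h1 : (G.neighborSet x).Finite :=
      Set.encard_lt_top_iff.1 ((hΔ x).trans_lt (ENat.natCast_lt_top _))
    have h2 : ∀ y, {l | (y :: l) ∈ pathSet G x (n + 1)}.Finite := by
      intro y
      refine Set.Finite.of_finite_image (f := pathSteps y)
        ((hΔ.finite_chainSet s(x, y) n).1.subset ?_) (pathSteps_injective y).injOn
      rintro _ ⟨l, ⟨hl1, hl2, hl3⟩, rfl⟩
      refine ⟨(isMidSAW_of_path hl1 hl2).chain, ?_⟩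
      rw [pathSteps_length]
      simpa using hl3
    refine (h1.biUnion fun y _ => (h2 y).image (List.cons y)).subset ?_
    rintro l hl
    match l, hl with
    | [], hl => simp [pathSet] at hl
    | y :: l, hl =>
      exact Set.mem_biUnion (x := y) (List.isChain_cons_cons.1 hl.1).1 ⟨l, hl, rfl⟩

theorem DegreeBounded.encard_pathSet (hΔ : DegreeBounded G Δ) (x : V) (n : ℕ) :
    (pathSet G x n).encard = (vertexSAWCount G x n : ℕ∞) := by
  rw [vertexSAWCount_eq, Set.Finite.cast_ncard_eq (hΔ.finite_pathSet x n)]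

/-- Cutting a walk after m steps leaves two self-avoiding walks. The second starts at an arbitrary
vertex, hence the bound `S` over all vertices. -/
theorem DegreeBounded.vertexSAWCount_add_le (hΔ : DegreeBounded G Δ) (x : V) (m n S : ℕ)
    (hS : ∀ y, vertexSAWCount G y n ≤ S) :
    vertexSAWCount G x (m + n) ≤ vertexSAWCount G x m * S := by
  have hsub : pathSet G x (m + n) ⊆ ⋃ l ∈ (hΔ.finite_pathSet x m).toFinset,
      (fun l' => l ++ l') '' pathSet G ((x :: l).getLast (List.cons_ne_nil x l)) n := by
    rintro l ⟨h1, h2, h3⟩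
    have hl := List.take_append_drop m l
    generalize hA : l.take m = A at hl
    generalize l.drop m = B at hl
    have hA' : A.length = m := by rw [← hA, List.length_take]; omega
    subst hl
    rw [← List.cons_append] at h1 h2
    simp only [Set.mem_iUnion, Set.Finite.mem_toFinset]
    refine ⟨A, ⟨(List.isChain_append.1 h1).1, h2.of_append_left, hA'⟩, B, ⟨?_, ?_, ?_⟩, rfl⟩
    · have h4 := List.dropLast_append_getLast (List.cons_ne_nil x A)
      rw [← h4, List.append_assoc] at h1
      exact (List.isChain_append.1 h1).2.1
    · have h4 := List.dropLast_append_getLast (List.cons_ne_nil x A)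
      rw [← h4, List.append_assoc] at h2
      exact h2.of_append_right
    · rw [List.length_append] at h3; omega
  have := (Set.encard_le_encard hsub).trans (Finset.set_encard_biUnion_le _ _)
  have := this.trans (Finset.sum_le_sum (g := fun _ => (S : ℕ∞)) fun l _ =>
    (Set.encard_image_le _ _).trans (by rw [hΔ.encard_pathSet]; exact_mod_cast hS _))
  rw [hΔ.encard_pathSet, Finset.sum_const, nsmul_eq_mul,
    ← Set.ncard_eq_toFinset_card _ (hΔ.finite_pathSet x m), ← vertexSAWCount_eq] at this
  exact_mod_cast this

/-- If a walk from `w` avoids `v`, it can be extended backwards to `v`. If it visits `v`, it splits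
there into two walks from `v`, the first one reversed. This transfers bounds from a vertex to its
neighbours. -/
theorem DegreeBounded.vertexSAWCount_adj_le (hΔ : DegreeBounded G Δ) {v w : V} (h : G.Adj v w)
    (n : ℕ) : vertexSAWCount G w n ≤ vertexSAWCount G v (n + 1) +
      ∑ j ∈ Finset.range (n + 1), vertexSAWCount G v j * vertexSAWCount G v (n - j) := by
  have hsub : pathSet G w n ⊆ List.tail '' pathSet G v (n + 1) ∪
      ⋃ j ∈ Finset.range (n + 1), (fun p : List V × List V => (p.1.reverse ++ v :: p.2).tail) ''
        (pathSet G v j ×ˢ pathSet G v (n - j)) := by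
    rintro l ⟨h1, h2, h3⟩
    by_cases hv : v ∈ w :: l
    · right
      obtain ⟨P, Q, hPQ⟩ := List.append_of_mem hv
      have hlen := congrArg List.length hPQ
      simp only [List.length_cons, List.length_append] at hlen
      simp only [Set.mem_iUnion, Finset.mem_range]
      refine ⟨P.length, by omega, (P.reverse, Q), ⟨⟨?_, ?_, by simp⟩, ⟨?_, ?_, ?_⟩⟩, ?_⟩
      · rw [hPQ, List.append_cons] at h1
        have := List.isChain_reverse.2 (List.isChain_append.1 h1).1
        simp only [List.reverse_append, List.reverse_cons, List.reverse_nil, List.nil_append,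
          List.cons_append] at this
        exact this.imp fun _ _ hab => SimpleGraph.Adj.symm hab
      · rw [hPQ, List.append_cons] at h2
        have := List.nodup_reverse.2 h2.of_append_left
        simpa using this
      · rw [hPQ] at h1
        exact (List.isChain_append.1 h1).2.1
      · rw [hPQ] at h2
        exact h2.of_append_right
      · simp only; omega
      · simp only [List.reverse_reverse, ← hPQ, List.tail_cons]
    · left
      exact ⟨w :: l, ⟨List.isChain_cons_cons.2 ⟨h, h1⟩, List.nodup_cons.2 ⟨hv, h2⟩,
        by simp [h3]⟩, rfl⟩
  have := (Set.encard_le_encard hsub).trans (Set.encard_union_le _ _)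
  have := this.trans (add_le_add (Set.encard_image_le _ _) (Finset.set_encard_biUnion_le _ _))
  have := this.trans (add_le_add_right (Finset.sum_le_sum
    (g := fun j => (vertexSAWCount G v j * vertexSAWCount G v (n - j) : ℕ∞)) fun j _ =>
    (Set.encard_image_le _ _).trans
      (by rw [Set.encard_prod, hΔ.encard_pathSet, hΔ.encard_pathSet])) _)
  rw [hΔ.encard_pathSet, hΔ.encard_pathSet] at this
  exact_mod_cast this

theorem DegreeBounded.vertexSAWCount_iso (hΔ : DegreeBounded G Δ) (α : G ≃g G) (x : V) (n : ℕ) :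
    vertexSAWCount G (α x) n = vertexSAWCount G x n := by
  have key : ∀ (α : G ≃g G) (x : V),
      vertexSAWCount G x n ≤ vertexSAWCount G (α x) n := by
    intro α x
    have hsub : List.map α '' pathSet G x n ⊆ pathSet G (α x) n := by
      rintro _ ⟨l, ⟨h1, h2, h3⟩, rfl⟩
      refine ⟨?_, ?_, by simpa using h3⟩
      · rw [← List.map_cons]
        refine (List.isChain_map α).2 (h1.imp fun a b hab => α.map_adj_iff.2 hab)
      · rw [← List.map_cons]
        exact h2.map α.injective
    have := Set.encard_le_encard hsub
    rw [(List.map_injective_iff.2 α.injective).encard_image, hΔ.encard_pathSet,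
      hΔ.encard_pathSet] at this
    exact_mod_cast this
  refine le_antisymm ?_ (key α x)
  simpa using key α.symm (α x)

/-- Balls are finite, since their points are ends of short paths from the centre, and the vertex set
is infinite. -/
theorem exists_le_dist [Infinite V] (hΔ : DegreeBounded G Δ) (hG : G.Connected) (x : V)
    (N : ℕ) : ∃ y, N ≤ G.dist x y := by
  by_contra! hlt
  have hfin : (⋃ k ∈ Finset.range N,
      (fun l => (x :: l).getLast (List.cons_ne_nil x l)) '' pathSet G x k).Finite :=
    Set.Finite.biUnion (Finset.finite_toSet _) fun k _ => (hΔ.finite_pathSet x k).image _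
  refine Set.infinite_univ (hfin.subset fun y _ => ?_)
  obtain ⟨p, hp, hd⟩ := hG.exists_path_of_dist x y
  have hs := p.cons_tail_support.symm
  have h1 := p.isChain_adj_support
  have h2 := hp.support_nodup
  rw [hs] at h1 h2
  simp only [Set.mem_iUnion, Finset.mem_range]
  refine ⟨p.length, hd ▸ hlt y, p.support.tail, ⟨h1, h2, by simp⟩, ?_⟩
  simp only [← hs]
  exact p.getLast_support

theorem DegreeBounded.one_le_vertexSAWCount [Infinite V] (hΔ : DegreeBounded G Δ)
    (hG : G.Connected) (x : V) (n : ℕ) : 1 ≤ vertexSAWCount G x n := by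
  rw [vertexSAWCount_eq, Nat.one_le_iff_ne_zero, ← Nat.pos_iff_ne_zero,
    Set.ncard_pos (hΔ.finite_pathSet x n)]
  obtain ⟨y, hy⟩ := exists_le_dist hΔ hG x n
  obtain ⟨p, hp, hd⟩ := hG.exists_path_of_dist x y
  have h1 := p.isChain_adj_support
  have h2 := hp.support_nodup
  rw [← p.cons_tail_support] at h1 h2
  -- The required walk is the initial segment of a geodesic to a vertex at distance at least n.
  have hpre : (x :: p.support.tail.take n) <+: x :: p.support.tail :=
    (List.prefix_cons_inj x).2 (List.take_prefix _ _)
  refine ⟨p.support.tail.take n, h1.prefix hpre, h2.sublist hpre.sublist, ?_⟩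
  rw [List.length_take, List.length_tail, SimpleGraph.Walk.length_support]
  omega

end Growth

/-! ### Existence of the connective constant -/

section Hammersley

variable {V : Type*} {G : SimpleGraph V} {Δ : ℕ} {W : Set V}

/-- The largest number of `n`-step self-avoiding walks from a vertex of `W`. -/
noncomputable def maxCount (G : SimpleGraph V) (hW : IsFundamentalDomain G W) (n : ℕ) : ℕ :=
  hW.finite.toFinset.sup fun x => vertexSAWCount G x n

theorem vertexSAWCount_le_maxCount (hΔ : DegreeBounded G Δ) (hW : IsFundamentalDomain G W)
    (x : V) (n : ℕ) : vertexSAWCount G x n ≤ maxCount G hW n := by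
  obtain ⟨α, hα⟩ := hW.exists_mem x
  rw [← hΔ.vertexSAWCount_iso α x n]
  exact Finset.le_sup (f := fun x => vertexSAWCount G x n) (hW.finite.mem_toFinset.2 hα)

theorem IsFundamentalDomain.nonempty [Nonempty V] (hW : IsFundamentalDomain G W) : W.Nonempty :=
  let ⟨x⟩ := ‹Nonempty V›
  let ⟨α, hα⟩ := hW.exists_mem x
  ⟨α x, hα⟩

theorem exists_eq_maxCount [Nonempty V] (hW : IsFundamentalDomain G W) (n : ℕ) :
    ∃ x ∈ W, vertexSAWCount G x n = maxCount G hW n := by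
  obtain ⟨x, hx⟩ := hW.nonempty
  obtain ⟨y, hy, h⟩ := Finset.exists_mem_eq_sup hW.finite.toFinset
    ⟨x, hW.finite.mem_toFinset.2 hx⟩ fun x => vertexSAWCount G x n
  exact ⟨y, hW.finite.mem_toFinset.1 hy, h.symm⟩

theorem one_le_maxCount [Infinite V] (hG : G.Connected) (hΔ : DegreeBounded G Δ)
    (hW : IsFundamentalDomain G W) (n : ℕ) : 1 ≤ maxCount G hW n := by
  obtain ⟨x, _, h⟩ := exists_eq_maxCount hW n
  exact h ▸ hΔ.one_le_vertexSAWCount hG x n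

/-- Fekete's lemma for the largest numbers of self-avoiding walks. -/
theorem exists_maxCount_growth [Infinite V] (hG : G.Connected) (hΔ : DegreeBounded G Δ)
    (hW : IsFundamentalDomain G W) : ∃ μ : ℝ, 1 ≤ μ ∧ (∀ n, μ ^ n ≤ maxCount G hW n) ∧
      ∀ lam, μ < lam → ∀ᶠ n in atTop, (maxCount G hW n : ℝ) < lam ^ n := by
  have hpos : ∀ n, (1 : ℝ) ≤ maxCount G hW n := fun n => by
    exact_mod_cast one_le_maxCount hG hΔ hW n
  have hlog : ∀ n, 0 ≤ Real.log (maxCount G hW n) := fun n => Real.log_nonneg (hpos n)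
  have hsub : Subadditive fun n => Real.log (maxCount G hW n) := by
    intro m n
    rw [← Real.log_mul (by linarith [hpos m]) (by linarith [hpos n])]
    refine Real.log_le_log (by linarith [hpos (m + n)]) ?_
    obtain ⟨x, _, h⟩ := exists_eq_maxCount hW (m + n)
    rw [← h]
    have h1 := hΔ.vertexSAWCount_add_le x m n _ fun y => vertexSAWCount_le_maxCount hΔ hW y n
    exact_mod_cast h1.trans (Nat.mul_le_mul_right _ (vertexSAWCount_le_maxCount hΔ hW x m))
  have hbdd : BddBelow (Set.range fun n : ℕ => Real.log (maxCount G hW n) / n) :=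
    ⟨0, by rintro _ ⟨n, rfl⟩; exact div_nonneg (hlog n) (Nat.cast_nonneg n)⟩
  have htend := hsub.tendsto_lim hbdd
  refine ⟨Real.exp hsub.lim, Real.one_le_exp ?_, fun n => ?_, fun lam hlam => ?_⟩
  · exact ge_of_tendsto' htend fun n => div_nonneg (hlog n) (Nat.cast_nonneg n)
  · rcases Nat.eq_zero_or_pos n with rfl | hn
    · simpa using hpos 0
    have h1 := hsub.lim_le_div hbdd hn.ne'
    have hn' : (0 : ℝ) < n := by exact_mod_cast hn
    rw [le_div_iff₀ hn'] at h1
    rw [← Real.exp_nat_mul, ← Real.exp_log (lt_of_lt_of_le one_pos (hpos n))]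
    exact Real.exp_le_exp.2 (by linarith)
  · have hl0 : 0 < lam := (Real.exp_pos _).trans hlam
    have h1 : hsub.lim < Real.log lam := (Real.lt_log_iff_exp_lt hl0).2 hlam
    filter_upwards [htend.eventually_lt_const h1, eventually_gt_atTop 0] with n h2 hn
    have hn' : (0 : ℝ) < n := by exact_mod_cast hn
    rw [div_lt_iff₀ hn', mul_comm, ← Real.log_pow] at h2
    exact (Real.log_lt_log_iff (lt_of_lt_of_le one_pos (hpos n)) (pow_pos hl0 n)).1 h2

theorem exists_bound_of_eventually_lt_pow {s : ℕ → ℕ} {lam : ℝ} (hl : 0 < lam)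
    (h : ∀ᶠ n in atTop, (s n : ℝ) < lam ^ n) : ∃ C : ℝ, 1 ≤ C ∧ ∀ n, (s n : ℝ) ≤ C * lam ^ n := by
  obtain ⟨N, hN⟩ := eventually_atTop.1 h
  have hnn : ∀ n, 0 ≤ (s n : ℝ) / lam ^ n := fun n => by positivity
  have hsum : 0 ≤ ∑ n ∈ Finset.range N, (s n : ℝ) / lam ^ n := Finset.sum_nonneg fun n _ => hnn n
  refine ⟨1 + ∑ n ∈ Finset.range N, (s n : ℝ) / lam ^ n, by linarith, fun n => ?_⟩
  by_cases hn : N ≤ n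
  · nlinarith [hN n hn, pow_pos hl n]
  · rw [← div_le_iff₀ (pow_pos hl n)]
    have := Finset.single_le_sum (f := fun n => (s n : ℝ) / lam ^ n) (fun n _ => hnn n)
      (Finset.mem_range.2 (not_le.1 hn))
    linarith

/-- When a walk of 2N steps from `w` is split at `v`, one of the two parts has at least N steps.
Both parts start at `v`, so the first N steps of the longer one contribute only ρ^N, and the
remaining N steps in total cost about lam^N. The factor linear in N counts the places to split. -/
theorem count_double_le (hΔ : DegreeBounded G Δ) {C lam ρ : ℝ} {s : ℕ → ℕ}
    (hs : ∀ x n, vertexSAWCount G x n ≤ s n) (hC : 1 ≤ C) (hl : 1 ≤ lam) (hρ : 0 < ρ)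
    (hsC : ∀ n, (s n : ℝ) ≤ C * lam ^ n) {N : ℕ} {v w : V} (hvw : v = w ∨ G.Adj v w)
    (hv : (vertexSAWCount G v N : ℝ) ≤ ρ ^ N) :
    (vertexSAWCount G w (2 * N) : ℝ) ≤ (2 * N + 2) * (C ^ 2 * lam) * (ρ * lam) ^ N := by
  have hlong : ∀ k, (vertexSAWCount G v (N + k) : ℝ) ≤ ρ ^ N * (C * lam ^ k) := by
    intro k
    have h1 := hΔ.vertexSAWCount_add_le v N k _ fun y => hs y k
    have h2 : (vertexSAWCount G v (N + k) : ℝ) ≤ vertexSAWCount G v N * s k := by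
      exact_mod_cast h1
    exact h2.trans (mul_le_mul hv (hsC k) (Nat.cast_nonneg _) (by positivity))
  have hshort : ∀ k, (vertexSAWCount G v k : ℝ) ≤ C * lam ^ k := fun k =>
    le_trans (by exact_mod_cast hs v k) (hsC k)
  have hCC : C ≤ C ^ 2 := by nlinarith
  have hX : 0 < ρ ^ N * lam ^ N := by positivity
  rcases hvw with rfl | hadj
  · rw [two_mul]
    refine (hlong N).trans ?_
    rw [mul_pow]
    have h3 : C ≤ (2 * N + 2) * (C ^ 2 * lam) := by
      have h4 : C ^ 2 ≤ C ^ 2 * lam := le_mul_of_one_le_right (by positivity) hl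
      have h5 : 0 ≤ (N : ℝ) := Nat.cast_nonneg N
      nlinarith
    nlinarith
  · have h1 := hΔ.vertexSAWCount_adj_le hadj (2 * N)
    have h2 : (vertexSAWCount G w (2 * N) : ℝ) ≤ vertexSAWCount G v (2 * N + 1) +
        ∑ j ∈ Finset.range (2 * N + 1),
          (vertexSAWCount G v j : ℝ) * vertexSAWCount G v (2 * N - j) := by exact_mod_cast h1
    refine h2.trans ?_
    have h3 : (vertexSAWCount G v (2 * N + 1) : ℝ) ≤ C ^ 2 * lam * (ρ * lam) ^ N := by
      have := hlong (N + 1)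
      rw [show N + (N + 1) = 2 * N + 1 by ring] at this
      refine this.trans ?_
      rw [mul_pow, pow_succ]
      have : ρ ^ N * (C * (lam ^ N * lam)) = C * (lam * (ρ ^ N * lam ^ N)) := by ring
      rw [this, mul_assoc]
      exact mul_le_mul_of_nonneg_right hCC (by positivity)
    have h4 : ∀ j ∈ Finset.range (2 * N + 1),
        (vertexSAWCount G v j : ℝ) * vertexSAWCount G v (2 * N - j) ≤
          C ^ 2 * lam * (ρ * lam) ^ N := by
      intro j hj
      have hj' := Finset.mem_range.1 hj
      have key : ∀ k k', k + k' = N →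
          (vertexSAWCount G v (N + k) : ℝ) * vertexSAWCount G v k' ≤
            C ^ 2 * lam * (ρ * lam) ^ N := by
        rintro k k' rfl
        refine (mul_le_mul (hlong k) (hshort k') (Nat.cast_nonneg _) (by positivity)).trans ?_
        have e1 : ρ ^ (k + k') * (C * lam ^ k) * (C * lam ^ k') =
            C ^ 2 * 1 * (ρ * lam) ^ (k + k') := by
          rw [mul_pow, pow_add lam]; ring
        rw [e1]
        gcongr
      by_cases hjN : N ≤ j
      · have := key (j - N) (2 * N - j) (by omega)
        rwa [show N + (j - N) = j by omega] at this
      · have := key (N - j) j (by omega)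
        rw [show N + (N - j) = 2 * N - j by omega] at this
        rwa [mul_comm]
    have h5 := Finset.sum_le_sum h4
    rw [Finset.sum_const, Finset.card_range, nsmul_eq_mul] at h5
    push_cast at h5
    linarith

theorem exists_rate_double (hΔ : DegreeBounded G Δ) {μ : ℝ} {s : ℕ → ℕ}
    (hs : ∀ x n, vertexSAWCount G x n ≤ s n) (hμ : 1 ≤ μ)
    (hlim : ∀ lam, μ < lam → ∀ᶠ n in atTop, (s n : ℝ) < lam ^ n) {ρ : ℝ} (hρ : 0 < ρ)
    (hρμ : ρ < μ) : ∃ ρ', 0 < ρ' ∧ ρ' < μ ∧ ∃ N₁ : ℕ, ∀ N ≥ N₁, ∀ v w : V, v = w ∨ G.Adj v w →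
      (vertexSAWCount G v N : ℝ) ≤ ρ ^ N →
        (vertexSAWCount G w (2 * N) : ℝ) ≤ ρ' ^ (2 * N) := by
  have hμ0 : 0 < μ := by linarith
  -- Over 2N steps the bound is about (ρ lam)^N. With lam close to μ this stays below (q)^N for some
  -- q < μ², which absorbs the linear factor, so the new rate √q is still below μ.
  obtain ⟨lam, hl1, hl2⟩ : ∃ lam, μ < lam ∧ ρ * lam < μ ^ 2 := by
    have : μ < μ ^ 2 / ρ := by rw [lt_div_iff₀ hρ]; nlinarith
    obtain ⟨lam, h1, h2⟩ := exists_between this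
    refine ⟨lam, h1, ?_⟩
    rw [lt_div_iff₀ hρ] at h2
    linarith
  have hl0 : 0 < lam := hμ0.trans hl1
  obtain ⟨q, hq1, hq2⟩ := exists_between hl2
  have hq0 : 0 < q := lt_trans (by positivity) hq1
  obtain ⟨C, hC, hsC⟩ := exists_bound_of_eventually_lt_pow hl0 (hlim lam hl1)
  have hr0 : 0 ≤ ρ * lam / q := by positivity
  have hr1 : ρ * lam / q < 1 := (div_lt_one hq0).2 hq1
  have ht : Tendsto (fun N : ℕ => (2 * N + 2) * (C ^ 2 * lam) * (ρ * lam / q) ^ N) atTop (𝓝 0) := by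
    have h1 := (tendsto_self_mul_const_pow_of_lt_one hr0 hr1).const_mul (2 * (C ^ 2 * lam))
    have h2 := (tendsto_pow_atTop_nhds_zero_of_lt_one hr0 hr1).const_mul (2 * (C ^ 2 * lam))
    have h3 := h1.add h2
    simp only [mul_zero, add_zero] at h3
    refine h3.congr fun N => ?_
    ring
  obtain ⟨N₁, hN₁⟩ := eventually_atTop.1 (ht.eventually_le_const one_pos)
  refine ⟨Real.sqrt q, Real.sqrt_pos.2 hq0, ?_, N₁, fun N hN v w hvw hv => ?_⟩
  · rw [Real.sqrt_lt' hμ0]; exact hq2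
  · refine (count_double_le hΔ hs hC (by linarith) hρ hsC hvw hv).trans ?_
    have h1 := hN₁ N hN
    rw [pow_mul, Real.sq_sqrt hq0.le]
    rw [div_pow, ← mul_div_assoc, div_le_one (pow_pos hq0 N)] at h1
    exact h1

/-- The doubling step is iterated along a geodesic. Each edge doubles the number of steps and
worsens the rate, which nevertheless stays below μ. -/
theorem exists_rate_dist (hG : G.Connected) (hΔ : DegreeBounded G Δ) {μ : ℝ} {s : ℕ → ℕ}
    (hs : ∀ x n, vertexSAWCount G x n ≤ s n) (hμ : 1 ≤ μ)
    (hlim : ∀ lam, μ < lam → ∀ᶠ n in atTop, (s n : ℝ) < lam ^ n) (D : ℕ) {ρ : ℝ} (hρ : 0 < ρ)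
    (hρμ : ρ < μ) : ∃ ρ', 0 < ρ' ∧ ρ' < μ ∧ ∃ N₁ : ℕ, ∀ N ≥ N₁, ∀ v w : V, G.dist v w ≤ D →
      (vertexSAWCount G v N : ℝ) ≤ ρ ^ N →
        (vertexSAWCount G w (2 ^ D * N) : ℝ) ≤ ρ' ^ (2 ^ D * N) := by
  induction D with
  | zero =>
    refine ⟨ρ, hρ, hρμ, 0, fun N _ v w hd hv => ?_⟩
    obtain rfl := (hG v w).dist_eq_zero_iff.1 (Nat.le_zero.1 hd)
    simpa using hv
  | succ D ih =>
    obtain ⟨ρ₁, h1, h2, N₁, hN₁⟩ := ih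
    obtain ⟨ρ₂, h3, h4, N₂, hN₂⟩ := exists_rate_double hΔ hs hμ hlim h1 h2
    refine ⟨ρ₂, h3, h4, max N₁ N₂, fun N hN v w hd hv => ?_⟩
    obtain ⟨u, hu1, hu2⟩ : ∃ u, G.dist v u ≤ D ∧ (u = w ∨ G.Adj u w) := by
      obtain ⟨p, hp⟩ := hG.exists_walk_length_eq_dist w v
      cases p with
      | nil => exact ⟨v, by simp, Or.inl rfl⟩
      | @cons _ u _ hadj p =>
        refine ⟨u, ?_, Or.inr hadj.symm⟩
        rw [SimpleGraph.Walk.length_cons, SimpleGraph.dist_comm] at hp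
        have := SimpleGraph.dist_le p
        rw [SimpleGraph.dist_comm] at this
        omega
    have h5 := hN₁ N (le_trans (le_max_left _ _) hN) v u hu1 hv
    have h6 : N₂ ≤ 2 ^ D * N :=
      ((le_max_right _ _).trans hN).trans (Nat.le_mul_of_pos_left N (by positivity))
    have h7 := hN₂ _ h6 u w hu2 h5
    rwa [show 2 ^ (D + 1) * N = 2 * (2 ^ D * N) by ring]

/-- If `v` had too few walks of N steps, then so would every vertex of `W` at the single length 2^D
N, with D the largest distance from `v` to `W`. This contradicts the lower bound μ^n for the vertex
of `W` with the most walks of that length. -/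
theorem eventually_pow_lt_count [Infinite V] (hG : G.Connected) (hΔ : DegreeBounded G Δ)
    (hW : IsFundamentalDomain G W) {μ : ℝ} (hμ : 1 ≤ μ) (hlow : ∀ n, μ ^ n ≤ maxCount G hW n)
    (hlim : ∀ lam, μ < lam → ∀ᶠ n in atTop, (maxCount G hW n : ℝ) < lam ^ n) {ρ : ℝ} (hρ : 0 < ρ)
    (hρμ : ρ < μ) (v : V) : ∀ᶠ n in atTop, ρ ^ n < vertexSAWCount G v n := by
  obtain ⟨ρ', h1, h2, N₁, hN₁⟩ := exists_rate_dist hG hΔ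
    (vertexSAWCount_le_maxCount hΔ hW) hμ hlim (hW.finite.toFinset.sup fun w => G.dist v w) hρ hρμ
  filter_upwards [eventually_ge_atTop N₁, eventually_gt_atTop 0] with N hN hN0
  by_contra hlt
  set D := hW.finite.toFinset.sup fun w => G.dist v w
  obtain ⟨w, hw, hwe⟩ := exists_eq_maxCount hW (2 ^ D * N)
  have h3 := hN₁ N hN v w
    (Finset.le_sup (f := fun w => G.dist v w) (hW.finite.mem_toFinset.2 hw)) (not_lt.1 hlt)
  have h4 := hlow (2 ^ D * N)
  rw [← hwe] at h4
  have h5 : ρ' ^ (2 ^ D * N) < μ ^ (2 ^ D * N) :=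
    pow_lt_pow_left₀ h2 h1.le (by positivity)
  linarith

/-- Hammersley's theorem: the connective constant of an infinite connected quasi-transitive
graph exists. -/
theorem exists_isConnectiveConstant [Infinite V] (hG : G.Connected) (hΔ : DegreeBounded G Δ)
    (hW : IsFundamentalDomain G W) : ∃ μ : ℝ, 1 ≤ μ ∧ IsConnectiveConstant G μ ∧
      (∀ ρ, 0 < ρ → ρ < μ → ∀ x, ∀ᶠ n in atTop, ρ ^ n < vertexSAWCount G x n) ∧
      ∀ lam, μ < lam → ∃ C : ℝ, 1 ≤ C ∧ ∀ x n, (vertexSAWCount G x n : ℝ) ≤ C * lam ^ n := by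
  obtain ⟨μ, hμ, hlow, hlim⟩ := exists_maxCount_growth hG hΔ hW
  have hμ0 : 0 < μ := by linarith
  have hge := fun (ρ : ℝ) (h0 : 0 < ρ) (h1 : ρ < μ) (x : V) =>
    eventually_pow_lt_count hG hΔ hW hμ hlow hlim h0 h1 x
  refine ⟨μ, hμ, fun x => ?_, hge, fun lam hlam => ?_⟩
  · have hroot : ∀ (a : ℝ) (n : ℕ), 0 ≤ a → 0 < n → (a ^ n) ^ ((1 : ℝ) / n) = a := by
      intro a n ha hn
      rw [one_div]
      exact Real.pow_rpow_inv_natCast ha hn.ne'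
    rw [tendsto_order]
    constructor
    · intro ρ hρ
      have h1 : max ρ (μ / 2) < μ := max_lt hρ (by linarith)
      have h0 : 0 < max ρ (μ / 2) := lt_max_of_lt_right (by linarith)
      filter_upwards [hge _ h0 h1 x, eventually_gt_atTop 0] with n hn hn0
      refine (le_max_left ρ (μ / 2)).trans_lt ?_
      rw [← hroot _ n h0.le hn0]
      exact Real.rpow_lt_rpow (by positivity) hn (by positivity)
    · intro lam hlam
      filter_upwards [hlim lam hlam, eventually_gt_atTop 0] with n hn hn0
      rw [← hroot lam n (by linarith) hn0]
      refine Real.rpow_lt_rpow (by positivity) (lt_of_le_of_lt ?_ hn) (by positivity)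
      exact_mod_cast vertexSAWCount_le_maxCount hΔ hW x n
  · obtain ⟨C, hC, h⟩ := exists_bound_of_eventually_lt_pow (hμ0.trans hlam) (hlim lam hlam)
    exact ⟨C, hC, fun x n =>
      le_trans (by exact_mod_cast vertexSAWCount_le_maxCount hΔ hW x n) (h n)⟩

theorem connectiveConstant_spec [Infinite V] (hG : G.Connected) (hΔ : DegreeBounded G Δ)
    (hW : IsFundamentalDomain G W) : 1 ≤ connectiveConstant G ∧
      (∀ ρ, 0 < ρ → ρ < connectiveConstant G →
        ∀ x, ∀ᶠ n in atTop, ρ ^ n < vertexSAWCount G x n) ∧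
      ∀ lam, connectiveConstant G < lam →
        ∃ C : ℝ, 1 ≤ C ∧ ∀ x n, (vertexSAWCount G x n : ℝ) ≤ C * lam ^ n := by
  obtain ⟨μ, h1, h2, h3⟩ := exists_isConnectiveConstant hG hΔ hW
  have hex : ∃ μ : ℝ, IsConnectiveConstant G μ := ⟨μ, h2⟩
  have : connectiveConstant G = μ := by
    rw [connectiveConstant, dif_pos hex]
    obtain ⟨x⟩ := hG.nonempty
    exact tendsto_nhds_unique (hex.choose_spec x) (h2 x)
  rw [this]
  exact ⟨h1, h3⟩

end Hammersley

/-! ### The radius of convergence of the generating function of mid-edge walks -/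

section Radius

variable {V : Type*} {G : SimpleGraph V} {Δ : ℕ} {W : Set V}

/-- A mid-edge walk visiting n + 1 vertices is given by its first vertex (two choices), a path with
n edges, and its last edge (at most Δ choices). -/
theorem DegreeBounded.encard_isMidSAW_le (hΔ : DegreeBounded G Δ) {n S : ℕ}
    (hS : ∀ x, vertexSAWCount G x n ≤ S) (e : Sym2 V) :
    {l | IsMidSAW G e l ∧ l.length = n + 1}.encard ≤ (2 * (S * Δ) : ℕ) := by
  classical
  have hsub : {l | IsMidSAW G e l ∧ l.length = n + 1} ⊆ ⋃ x ∈ e.toFinset,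
      ⋃ r ∈ (hΔ.finite_pathSet x n).toFinset,
        (fun f => pathSteps x r ++ [((x :: r).getLast (List.cons_ne_nil x r), f)]) ''
          G.incidenceSet ((x :: r).getLast (List.cons_ne_nil x r)) := by
    rintro l ⟨h, hl⟩
    match l, h, hl with
    | p :: l, h, hl =>
      obtain ⟨h1, h2⟩ := h.chain.eq_pathSteps h.vert_nodup
      simp only [Set.mem_iUnion, Set.Finite.mem_toFinset, Sym2.mem_toFinset]
      refine ⟨p.1, h.chain.1, l.map Prod.fst, ⟨h1, h.vert_nodup, by simpa using hl⟩,
        endEdge e (p :: l), ?_, h2.symm⟩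
      have h3 := List.mem_append_right (pathSteps p.1 (l.map Prod.fst)) (List.mem_singleton_self
        ((p.1 :: l.map Prod.fst).getLast (List.cons_ne_nil _ _), endEdge e (p :: l)))
      rw [← h2] at h3
      exact ⟨(h.chain.edge_mem h3).2, (h.chain.edge_mem h3).1⟩
  refine (Set.encard_le_encard hsub).trans ((Finset.set_encard_biUnion_le _ _).trans ?_)
  have hinner : ∀ x ∈ e.toFinset, (⋃ r ∈ (hΔ.finite_pathSet x n).toFinset,
        (fun f => pathSteps x r ++ [((x :: r).getLast (List.cons_ne_nil x r), f)]) ''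
          G.incidenceSet ((x :: r).getLast (List.cons_ne_nil x r))).encard ≤ (S * Δ : ℕ) := by
    intro x _
    refine (Finset.set_encard_biUnion_le _ _).trans ?_
    refine (Finset.sum_le_sum (g := fun _ => (Δ : ℕ∞)) fun r _ =>
      (Set.encard_image_le _ _).trans (hΔ.encard_incidenceSet _)).trans ?_
    rw [Finset.sum_const, nsmul_eq_mul, ← Set.ncard_eq_toFinset_card _ (hΔ.finite_pathSet x n),
      ← vertexSAWCount_eq]
    have := Nat.mul_le_mul_right Δ (hS x)
    exact_mod_cast this
  refine (Finset.sum_le_sum hinner).trans ?_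
  rw [Finset.sum_const, nsmul_eq_mul]
  have : e.toFinset.card ≤ 2 := by
    rcases Sym2.card_toFinset e with h
    rw [h]; split_ifs <;> norm_num
  have := Nat.mul_le_mul_right (S * Δ) this
  exact_mod_cast this

theorem DegreeBounded.card_sawFrom_le (hΔ : DegreeBounded G Δ) (hW : W.Finite) {n S : ℕ}
    (hS : ∀ x, vertexSAWCount G x n ≤ S) :
    Nat.card (SAWFrom G W (n + 1)) ≤ (incidentEdges G W).ncard * (2 * (S * Δ)) := by
  have hE := hΔ.finite_incidentEdges hW
  have hfin : ∀ e, {l | IsMidSAW G e l ∧ l.length = n + 1}.Finite := fun e =>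
    (hΔ.finite_chainSet e (n + 1)).1.subset fun l hl => ⟨hl.1.chain, hl.2⟩
  have := hE.to_subtype
  have := Fintype.ofFinite (incidentEdges G W)
  have := fun e => (hfin e).to_subtype
  refine (Nat.card_le_card_of_injective
    (β := Σ e : incidentEdges G W, {l | IsMidSAW G e.1 l ∧ l.length = n + 1})
    (fun π => ⟨⟨π.1.edge 0, π.2⟩, π.1.steps, π.1.isMidSAW, π.1.steps_length⟩) ?_).trans ?_
  · intro π π' hh
    have h1 := congrArg (fun q => q.1.1) hh
    have h2 := congrArg (fun q => q.2.1) hh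
    exact Subtype.ext (MidSAW.ext_steps h1 h2)
  · rw [Nat.card_sigma]
    refine (Finset.sum_le_sum (g := fun _ => 2 * (S * Δ)) fun e _ => ?_).trans ?_
    · rw [Nat.card_coe_set_eq]
      have := hΔ.encard_isMidSAW_le hS e.1
      rw [← (hfin e.1).cast_ncard_eq] at this
      exact_mod_cast this
    · rw [Finset.sum_const, smul_eq_mul, Finset.card_univ, ← Nat.card_eq_fintype_card,
        Nat.card_coe_set_eq]

/-- A path with n + 1 edges, cut at the midpoints of its first and last edges, visits n vertices.
Knowing `x`, the path is recovered from the first edge and the steps. -/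
theorem DegreeBounded.vertexSAWCount_le_card_sawFrom (hΔ : DegreeBounded G Δ) (hW : W.Finite)
    {x : V} (hx : x ∈ W) (n : ℕ) :
    vertexSAWCount G x (n + 1) ≤ Nat.card (SAWFrom G W n) := by
  have := hΔ.finite_sawFrom hW n
  rw [vertexSAWCount_eq, ← Nat.card_coe_set_eq]
  have hex : ∀ l : pathSet G x (n + 1), ∃ π : SAWFrom G W n, ∃ y l', l.1 = y :: l' ∧
      π.1.edge 0 = s(x, y) ∧ π.1.steps = pathSteps y l' := by
    rintro ⟨l, h1, h2, h3⟩
    match l, h1, h2, h3 with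
    | y :: l, h1, h2, h3 =>
      have h4 := isMidSAW_of_path h1 h2
      obtain ⟨π, hπ1, hπ2⟩ := h4.exists_midSAW
      obtain rfl : (pathSteps y l).length = n := by
        rw [pathSteps_length]; simpa using h3
      refine ⟨⟨π, ?_⟩, y, l, rfl, hπ1, hπ2⟩
      rw [hπ1]
      exact ⟨h4.edge_mem, x, hx, Sym2.mem_mk_left x y⟩
  choose f y l' h1 h2 h3 using hex
  refine Nat.card_le_card_of_injective f fun l m h => ?_
  have hy : y l = y m := by
    have := h2 l
    rw [h, h2 m] at this
    exact (Sym2.congr_right.1 this).symm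
  have hl : l' l = l' m := by
    have := h3 l
    rw [h, h3 m, hy] at this
    exact (pathSteps_injective _ this).symm
  exact Subtype.ext (by rw [h1 l, h1 m, hy, hl])

theorem walkSum_pow_eq (G : SimpleGraph V) (W : Set V) [∀ n, Finite (SAWFrom G W n)] (t : ℝ≥0∞) :
    walkSum G W (fun _ _ n => t ^ n) = ∑' n, (Nat.card (SAWFrom G W n) : ℝ≥0∞) * t ^ n := by
  rw [walkSum_eq]
  refine tsum_congr fun n => ?_
  rw [ENNReal.tsum_const, ENat.card_eq_coe_natCard]
  simp

variable [Infinite V]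

/-- With its counterpart for larger x, this identifies the radius of convergence for mid-edge walks
from `W` with the inverse of the connective constant, which is defined by walks from vertices. -/
theorem walkSum_pow_lt_top (hG : G.Connected) (hΔ : DegreeBounded G Δ)
    (hW : IsFundamentalDomain G W) {x : ℝ} (hx0 : 0 ≤ x) (hx : x < (connectiveConstant G)⁻¹) :
    walkSum G W (fun _ _ n => ENNReal.ofReal x ^ n) < ⊤ := by
  obtain ⟨h1, _, h3⟩ := connectiveConstant_spec hG hΔ hW
  have hμ0 : 0 < connectiveConstant G := by linarith
  have := fun n => hΔ.finite_sawFrom hW.finite n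
  obtain ⟨lam, hl1, hl2⟩ : ∃ lam, connectiveConstant G < lam ∧ lam * x < 1 := by
    rcases hx0.eq_or_lt with rfl | hx0
    · exact ⟨connectiveConstant G + 1, by linarith, by simp⟩
    · have : connectiveConstant G < x⁻¹ := (lt_inv_comm₀ hx0 hμ0).1 hx
      obtain ⟨lam, h4, h5⟩ := exists_between this
      exact ⟨lam, h4, by rwa [← one_div, lt_div_iff₀ hx0] at h5⟩
  have hl0 : 0 < lam := hμ0.trans hl1
  obtain ⟨C, hC, hbd⟩ := h3 lam hl1
  have hS : ∀ n y, vertexSAWCount G y n ≤ ⌊C * lam ^ n⌋₊ := fun n y => Nat.le_floor (hbd y n)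
  rw [walkSum_pow_eq]
  simp_rw [← ENNReal.ofReal_natCast, ← ENNReal.ofReal_pow hx0,
    ← ENNReal.ofReal_mul (Nat.cast_nonneg _)]
  refine Summable.tsum_ofReal_lt_top ?_
  rw [← summable_nat_add_iff 1]
  set A : ℝ := (incidentEdges G W).ncard * (2 * Δ) * C * x
  refine Summable.of_nonneg_of_le (fun n => by positivity) (fun n => ?_)
    ((summable_geometric_of_lt_one (by positivity) hl2).mul_left A)
  have h4 := hΔ.card_sawFrom_le hW.finite (hS n)
  have h5 : (Nat.card (SAWFrom G W (n + 1)) : ℝ) ≤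
      (incidentEdges G W).ncard * (2 * (⌊C * lam ^ n⌋₊ * Δ)) := by exact_mod_cast h4
  have h6 : (⌊C * lam ^ n⌋₊ : ℝ) ≤ C * lam ^ n := Nat.floor_le (by positivity)
  have h7 : (Nat.card (SAWFrom G W (n + 1)) : ℝ) ≤
      (incidentEdges G W).ncard * (2 * (C * lam ^ n * Δ)) := h5.trans (by gcongr)
  refine (mul_le_mul_of_nonneg_right h7 (by positivity)).trans (le_of_eq ?_)
  simp only [A]
  rw [mul_pow]
  ring

theorem walkSum_pow_eq_top (hG : G.Connected) (hΔ : DegreeBounded G Δ)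
    (hW : IsFundamentalDomain G W) {x : ℝ} (hx : (connectiveConstant G)⁻¹ < x) :
    walkSum G W (fun _ _ n => ENNReal.ofReal x ^ n) = ⊤ := by
  obtain ⟨h1, h2, _⟩ := connectiveConstant_spec hG hΔ hW
  have hμ0 : 0 < connectiveConstant G := by linarith
  have hx0 : 0 < x := (inv_pos.2 hμ0).trans hx
  have := fun n => hΔ.finite_sawFrom hW.finite n
  obtain ⟨v, hv⟩ := hW.nonempty
  have h3 := h2 x⁻¹ (inv_pos.2 hx0) ((inv_lt_comm₀ hμ0 hx0).1 hx) v
  obtain ⟨N, hN⟩ := eventually_atTop.1 h3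
  rw [walkSum_pow_eq]
  by_contra hne
  have ht := ENNReal.tendsto_atTop_zero_of_tsum_ne_top hne
  -- The terms eventually exceed x⁻¹ and so cannot tend to zero. The factor x⁻¹ comes from the shift
  -- by one between edges of a path and vertices of a mid-edge walk.
  have hc : 0 < ENNReal.ofReal x⁻¹ := ENNReal.ofReal_pos.2 (inv_pos.2 hx0)
  obtain ⟨n, hn1, hn2⟩ := ((ht.eventually_lt_const hc).and (eventually_ge_atTop N)).exists
  refine absurd hn1 (not_lt.2 ?_)
  rw [← ENNReal.ofReal_natCast, ← ENNReal.ofReal_pow hx0.le,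
    ← ENNReal.ofReal_mul (Nat.cast_nonneg _)]
  refine ENNReal.ofReal_le_ofReal ?_
  have h4 := hN (n + 1) (by omega)
  have h5 : (vertexSAWCount G v (n + 1) : ℝ) ≤ Nat.card (SAWFrom G W n) := by
    exact_mod_cast hΔ.vertexSAWCount_le_card_sawFrom hW.finite hv n
  calc x⁻¹ = x⁻¹ ^ (n + 1) * x ^ n := by
        rw [pow_succ, mul_right_comm, ← mul_pow, inv_mul_cancel₀ hx0.ne', one_pow, one_mul]
    _ ≤ Nat.card (SAWFrom G W n) * x ^ n :=
        mul_le_mul_of_nonneg_right (h4.le.trans h5) (by positivity)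

end Radius

/-! ### Slowly varying functions -/

section Slow

open MeasureTheory

/-- By pointwise convergence these sets increase with j to the whole interval, so their measures
tend to its length. -/
theorem eventually_lt_volume_of_tendsto_sub {f : ℝ → ℝ}
    (hlim : ∀ u, Tendsto (fun x => f (x + u) - f x) atTop (𝓝 0)) {z : ℕ → ℝ}
    (hz : Tendsto z atTop atTop) {S c : ℝ} (hc : c < S) (hc0 : 0 ≤ c) : ∀ᶠ j in atTop,
      ENNReal.ofReal c <
        volume {y | y ∈ Set.Icc 0 S ∧ ∀ k ≥ j, |f (z k + y) - f (z k)| ≤ 1} := by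
  set A : ℕ → Set ℝ := fun j => {y | y ∈ Set.Icc 0 S ∧ ∀ k ≥ j, |f (z k + y) - f (z k)| ≤ 1}
  have hmono : Monotone A := fun i j hij y hy => ⟨hy.1, fun k hk => hy.2 k (le_trans hij hk)⟩
  have hunion : ⋃ j, A j = Set.Icc 0 S := by
    refine Set.Subset.antisymm (Set.iUnion_subset fun j y hy => hy.1) fun y hy => ?_
    have h1 := (hlim y).comp hz
    have h2 : ∀ᶠ k in atTop, |f (z k + y) - f (z k)| ≤ 1 := by
      have := (h1.abs).eventually_le_const (u := 1) (by simp)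
      exact this
    obtain ⟨j, hj⟩ := eventually_atTop.1 h2
    exact Set.mem_iUnion.2 ⟨j, hy, hj⟩
  have ht := tendsto_measure_iUnion_atTop (μ := volume) hmono
  rw [hunion, Real.volume_Icc, sub_zero] at ht
  exact ht.eventually_const_lt ((ENNReal.ofReal_lt_ofReal_iff (hc0.trans_lt hc)).2 hc)

/-- The uniform convergence theorem, in the form of local boundedness of the increments. -/
theorem abs_sub_le_two_of_tendsto_sub {f : ℝ → ℝ} (hf : Measurable f)
    (hlim : ∀ u, Tendsto (fun x => f (x + u) - f x) atTop (𝓝 0)) {T : ℝ} (hT : 0 ≤ T)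
    {z u : ℕ → ℝ} (hz : Tendsto z atTop atTop) (hu : ∀ k, u k ∈ Set.Icc 0 T) :
    ∃ k, |f (z k + u k) - f (z k)| ≤ 2 := by
  have hz' : Tendsto (fun k => z k + u k) atTop atTop :=
    tendsto_atTop_mono (fun k => le_add_of_nonneg_right (hu k).1) hz
  -- Two sets of measure above (3/4)(2T + 1) inside an interval of length 3T + 1 must meet, since
  -- (3/2)(2T + 1) > 3T + 1.
  have hc : 3 / 4 * (2 * T + 1) < 2 * T + 1 := by linarith
  have hc0 : 0 ≤ 3 / 4 * (2 * T + 1) := by linarith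
  obtain ⟨j, h1, h2⟩ := ((eventually_lt_volume_of_tendsto_sub hlim hz hc hc0).and
    (eventually_lt_volume_of_tendsto_sub hlim hz' hc hc0)).exists
  set A := {y | y ∈ Set.Icc 0 (2 * T + 1) ∧ ∀ k ≥ j, |f (z k + y) - f (z k)| ≤ 1}
  set B := {y | y ∈ Set.Icc 0 (2 * T + 1) ∧
    ∀ k ≥ j, |f (z k + u k + y) - f (z k + u k)| ≤ 1} with hB
  -- Additivity of the measure on a disjoint union needs measurability of only one of the two sets.
  have hBm : MeasurableSet B := by
    rw [hB, Set.ofPred_and]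
    refine measurableSet_Icc.inter ?_
    simp only [Set.ofPred_forall]
    refine MeasurableSet.iInter fun k => MeasurableSet.iInter fun _ => ?_
    refine measurableSet_le ?_ measurable_const
    exact ((hf.comp (measurable_const.add measurable_id)).sub measurable_const).abs
  -- After this translation, a common point of `A` and `B'` gives one point z j + y at which f is
  -- within 1 of both f(z j) and f(z j + u j).
  set B' := (fun y => y - u j) ⁻¹' B with hB'
  have hvB : volume B' = volume B := by
    have := measure_preimage_add_right volume (-u j) B
    simpa only [← sub_eq_add_neg] using this
  by_cases hd : Disjoint A B'
  · exfalso
    have h3 := measure_union (μ := volume) hd (hBm.preimage (measurable_id.sub measurable_const))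
    have h4 : A ∪ B' ⊆ Set.Icc 0 (3 * T + 1) := by
      have hj := hu j
      rintro y (hy | hy)
      · exact ⟨hy.1.1, by linarith [hy.1.2]⟩
      · have h5 : 0 ≤ y - u j := hy.1.1
        have h6 : y - u j ≤ 2 * T + 1 := hy.1.2
        exact ⟨by linarith [hj.1], by linarith [hj.2]⟩
    have h5 := measure_mono (μ := volume) h4
    rw [h3, hvB, Real.volume_Icc, sub_zero] at h5
    have h6 := (ENNReal.add_lt_add h1 h2).trans_le h5
    rw [← ENNReal.ofReal_add hc0 hc0, ENNReal.ofReal_lt_ofReal_iff (by linarith)] at h6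
    linarith
  · obtain ⟨y, hyA, hyB⟩ := Set.not_disjoint_iff.1 hd
    refine ⟨j, ?_⟩
    have h3 := hyA.2 j le_rfl
    have h4 := hyB.2 j le_rfl
    rw [add_add_sub_cancel] at h4
    have h5 := abs_sub_le (f (z j + u j)) (f (z j + y)) (f (z j))
    rw [abs_sub_comm (f (z j + u j)) (f (z j + y))] at h5
    linarith

/-- In logarithmic coordinates slow variation says that the increments of f(x) = log L(e^x) tend to
zero. A sequence of counterexamples n_k → ∞ with shifts log(m_k/n_k) in [0, log K] would contradict
the uniform bound on increments. -/
theorem SlowlyVarying.eventually_log_le {L : ℝ → ℝ} (hL : SlowlyVarying L) (K : ℕ) :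
    ∃ N : ℕ, 1 ≤ N ∧ ∀ n m : ℕ, N ≤ n → n ≤ m → m ≤ K * n →
      |Real.log (L m) - Real.log (L n)| ≤ 2 := by
  by_contra hcon
  push Not at hcon
  choose n m h1 h2 h3 h4 using fun k : ℕ => hcon (k + 1) (Nat.le_add_left 1 k)
  have hn0 : ∀ k, (0 : ℝ) < n k := fun k => by
    have := h1 k
    exact_mod_cast (by omega : 0 < n k)
  have hm0 : ∀ k, (0 : ℝ) < m k := fun k =>
    lt_of_lt_of_le (hn0 k) (by exact_mod_cast h2 k)
  have hK : (1 : ℝ) ≤ K := by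
    have h5 := (h2 0).trans (h3 0)
    have h6 := h1 0
    have : 1 ≤ K := by
      by_contra hlt
      obtain rfl : K = 0 := by omega
      omega
    exact_mod_cast this
  have hn : Tendsto (fun k => Real.log (n k)) atTop atTop :=
    Real.tendsto_log_atTop.comp (tendsto_natCast_atTop_atTop.comp
      (tendsto_atTop_mono (fun k => (Nat.le_succ k).trans (h1 k)) tendsto_id))
  have hf : Measurable fun x => Real.log (L (Real.exp x)) :=
    Real.measurable_log.comp (hL.measurable.comp Real.measurable_exp)
  have hlim : ∀ u, Tendsto (fun x => Real.log (L (Real.exp (x + u))) - Real.log (L (Real.exp x)))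
      atTop (𝓝 0) := by
    intro u
    have h5 := (hL.tendsto (Real.exp u) (Real.exp_pos u)).comp Real.tendsto_exp_atTop
    have h6 := ((Real.continuousAt_log one_ne_zero).tendsto.comp h5)
    rw [Real.log_one] at h6
    refine h6.congr fun x => ?_
    simp only [Function.comp_apply]
    rw [Real.log_div (hL.pos _ (by positivity)).ne' (hL.pos _ (by positivity)).ne', add_comm x,
      Real.exp_add]
  have hu : ∀ k, Real.log (m k) - Real.log (n k) ∈ Set.Icc 0 (Real.log K) := by
    refine fun k => ⟨sub_nonneg.2 (Real.log_le_log (hn0 k) (by exact_mod_cast h2 k)), ?_⟩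
    rw [sub_le_iff_le_add, ← Real.log_mul (by linarith) (hn0 k).ne']
    exact Real.log_le_log (hm0 k) (by exact_mod_cast h3 k)
  obtain ⟨k, hk⟩ := abs_sub_le_two_of_tendsto_sub hf hlim (Real.log_nonneg hK) hn hu
  simp only [add_sub_cancel, Real.exp_log (hn0 k), Real.exp_log (hm0 k)] at hk
  exact absurd hk (not_le.2 (h4 k))

theorem SlowlyVarying.exists_ratio_bound {L : ℝ → ℝ} (hL : SlowlyVarying L) (K : ℕ) :
    ∃ C : ℝ, 0 < C ∧ ∀ n m : ℕ, 1 ≤ n → n ≤ m → m ≤ K * n →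
      L m ≤ C * L n ∧ L n ≤ C * L m := by
  obtain ⟨N, hN1, hN⟩ := hL.eventually_log_le K
  have hpos : ∀ n : ℕ, 1 ≤ n → 0 < L n := fun n hn => hL.pos _ (by exact_mod_cast hn)
  set P := (Finset.Icc 1 N ×ˢ Finset.Icc 1 (K * N))
  have hP : ∀ p ∈ P, 0 ≤ L p.2 / L p.1 + L p.1 / L p.2 := by
    intro p hp
    obtain ⟨h1, h2⟩ := Finset.mem_product.1 hp
    have h3 := hpos _ (Finset.mem_Icc.1 h1).1
    have h4 := hpos _ (Finset.mem_Icc.1 h2).1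
    positivity
  have hsum := Finset.sum_nonneg hP
  set D := ∑ p ∈ P, (L (p.2 : ℕ) / L (p.1 : ℕ) + L (p.1 : ℕ) / L (p.2 : ℕ)) with hD
  -- The term e² serves n ≥ N. The sum `D` dominates both ratios for each of the finitely many
  -- remaining pairs.
  refine ⟨Real.exp 2 + D, by positivity, fun n m h1 h2 h3 => ?_⟩
  have hn := hpos n h1
  have hm := hpos m (h1.trans h2)
  by_cases hnN : N ≤ n
  · have h4 := abs_le.1 (hN n m hnN h2 h3)
    have key : ∀ a b : ℝ, 0 < a → 0 < b → Real.log a - Real.log b ≤ 2 →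
        a ≤ (Real.exp 2 + D) * b := by
      intro a b ha hb hab
      have : a ≤ Real.exp 2 * b := by
        rw [← Real.log_le_log_iff ha (by positivity),
          Real.log_mul (Real.exp_pos 2).ne' hb.ne', Real.log_exp]
        linarith
      nlinarith
    exact ⟨key _ _ hm hn (by linarith), key _ _ hn hm (by linarith)⟩
  · have hmem : (n, m) ∈ P := Finset.mem_product.2 ⟨Finset.mem_Icc.2 ⟨h1, by omega⟩,
      Finset.mem_Icc.2 ⟨h1.trans h2, h3.trans (Nat.mul_le_mul_left K (by omega))⟩⟩
    have h4 := Finset.single_le_sum hP hmem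
    rw [← hD] at h4
    simp only at h4
    have h5 : 0 ≤ L m / L n := by positivity
    have h6 : 0 ≤ L n / L m := by positivity
    have he := Real.exp_pos 2
    exact ⟨(div_le_iff₀ hn).1 (by linarith), (div_le_iff₀ hm).1 (by linarith)⟩

end Slow

/-! ### Edges and distances of the transformed graph -/

section Transform

variable {V H : Type*} {G : SimpleGraph V}

open Classical in
/-- The number of the outer vertex of the gadget at `x` to which the edge `e` is attached. -/
noncomputable def portIdx (att : ∀ x : V, G.neighborSet x ≃ Fin 3) (x : V) (e : Sym2 V) : Fin 3 :=
  if h : ∃ y : V, ∃ _ : G.Adj x y, e = s(x, y) then att x ⟨h.choose, h.choose_spec.choose⟩ else 0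

theorem portIdx_mk (att : ∀ x : V, G.neighborSet x ≃ Fin 3) {x y : V} (h : G.Adj x y) :
    portIdx att x s(x, y) = att x ⟨y, h⟩ := by
  have hex : ∃ z : V, ∃ _ : G.Adj x z, s(x, y) = s(x, z) := ⟨y, h, rfl⟩
  rw [portIdx, dif_pos hex]
  have := hex.choose_spec.choose_spec
  congr 2
  exact (Sym2.congr_right.1 this).symm

theorem portIdx_inj (att : ∀ x : V, G.neighborSet x ≃ Fin 3) {x : V} {e f : Sym2 V}
    (he : e ∈ G.edgeSet) (hf : f ∈ G.edgeSet) (hxe : x ∈ e) (hxf : x ∈ f)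
    (h : portIdx att x e = portIdx att x f) : e = f := by
  obtain ⟨y, rfl⟩ := hxe
  obtain ⟨z, rfl⟩ := hxf
  rw [SimpleGraph.mem_edgeSet] at he hf
  rw [portIdx_mk att he, portIdx_mk att hf] at h
  have := (att x).injective h
  rw [show y = z from congrArg Subtype.val this]

/-- The edge of the transformed graph that comes from the edge `e`. -/
noncomputable def liftEdge (φ : Gadget H) (att : ∀ x : V, G.neighborSet x ≃ Fin 3) (e : Sym2 V) :
    Sym2 (V × H) :=
  e.map fun x => (x, φ.outer (portIdx att x e))

variable {φ : Gadget H} {att : ∀ x : V, G.neighborSet x ≃ Fin 3}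

@[simp] theorem map_fst_liftEdge (e : Sym2 V) : (liftEdge φ att e).map Prod.fst = e := by
  rw [liftEdge, Sym2.map_map]
  exact congrFun Sym2.map_id' e

theorem liftEdge_injective : Function.Injective (liftEdge φ att) :=
  Function.LeftInverse.injective map_fst_liftEdge

theorem mem_liftEdge {e : Sym2 V} {p : V × H} :
    p ∈ liftEdge φ att e ↔ p.1 ∈ e ∧ p.2 = φ.outer (portIdx att p.1 e) := by
  rw [liftEdge, Sym2.mem_map]
  constructor
  · rintro ⟨x, hx, rfl⟩
    exact ⟨hx, rfl⟩
  · rintro ⟨h1, h2⟩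
    exact ⟨p.1, h1, Prod.ext rfl h2.symm⟩

theorem fst_mem_map {e : Sym2 (V × H)} {p : V × H} (h : p ∈ e) : p.1 ∈ e.map Prod.fst :=
  Sym2.mem_map.2 ⟨p, h, rfl⟩

theorem liftEdge_mk {x y : V} (h : G.Adj x y) : liftEdge φ att s(x, y) =
    s((x, φ.outer (att x ⟨y, h⟩)), (y, φ.outer (att y ⟨x, h.symm⟩))) := by
  have h2 := portIdx_mk att h.symm
  rw [Sym2.eq_swap] at h2
  change s((x, φ.outer (portIdx att x s(x, y))), (y, φ.outer (portIdx att y s(x, y)))) = _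
  rw [portIdx_mk att h, h2]

theorem liftEdge_mem {e : Sym2 V} (he : e ∈ G.edgeSet) :
    liftEdge φ att e ∈ (localTransform G φ att).edgeSet := by
  induction e using Sym2.ind with
  | _ x y =>
  rw [liftEdge_mk he]
  exact Or.inr ⟨he, rfl, rfl⟩

theorem mem_edgeSet_localTransform {f : Sym2 (V × H)}
    (hf : f ∈ (localTransform G φ att).edgeSet) :
    (∃ x a b, φ.graph.Adj a b ∧ f = s((x, a), (x, b))) ∨
      ∃ e ∈ G.edgeSet, f = liftEdge φ att e := by
  induction f using Sym2.ind with
  | _ p q =>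
  obtain ⟨x, a⟩ := p
  obtain ⟨y, b⟩ := q
  rcases hf with ⟨h1, h2⟩ | ⟨h, h1, h2⟩
  · obtain rfl : x = y := h1
    exact Or.inl ⟨x, a, b, h2, rfl⟩
  · simp only at h h1 h2
    refine Or.inr ⟨s(x, y), h, ?_⟩
    rw [h1, h2, liftEdge_mk h]

theorem not_mem_edgeSet_diag (x : V) : s(x, x) ∉ G.edgeSet := fun h => G.loopless.irrefl x h

/-- An edge of the transformed graph lies inside a gadget or comes from an edge. -/
theorem map_fst_mem_or {f : Sym2 (V × H)} (hf : f ∈ (localTransform G φ att).edgeSet) :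
    (∃ x, f.map Prod.fst = s(x, x)) ∨ ∃ e ∈ G.edgeSet, f = liftEdge φ att e := by
  rcases mem_edgeSet_localTransform hf with ⟨x, a, b, _, rfl⟩ | h
  · exact Or.inl ⟨x, rfl⟩
  · exact Or.inr h

/-- Edges inside a gadget project to loops, and edges coming from the cubic graph do not. This is
the test that separates the two kinds everywhere below. -/
theorem liftEdge_ne_internal {e : Sym2 V} (he : e ∈ G.edgeSet) (x : V) :
    (liftEdge φ att e).map Prod.fst ≠ s(x, x) := by
  rw [map_fst_liftEdge]
  rintro rfl
  exact not_mem_edgeSet_diag x he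

theorem degreeBounded_three (att : ∀ x : V, G.neighborSet x ≃ Fin 3) : DegreeBounded G 3 := by
  intro x
  have : (G.neighborSet x).encard = ENat.card (Fin 3) := ENat.card_congr (att x)
  rw [this]
  simp

theorem degreeBounded_localTransform [Finite H] :
    DegreeBounded (localTransform G φ att) (Nat.card H + 3) := by
  rintro ⟨x, a⟩
  have hsub : (localTransform G φ att).neighborSet (x, a) ⊆
      Prod.mk x '' Set.univ ∪ (fun y : G.neighborSet x =>
        (y.1, φ.outer (att y.1 ⟨x, G.symm.symm _ _ y.2⟩))) '' Set.univ := by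
    rintro ⟨y, b⟩ (⟨h1, _⟩ | ⟨h, _, h2⟩)
    · obtain rfl : x = y := h1
      exact Or.inl ⟨b, trivial, rfl⟩
    · exact Or.inr ⟨⟨y, h⟩, trivial, Prod.ext rfl h2.symm⟩
  refine (Set.encard_le_encard hsub).trans ((Set.encard_union_le _ _).trans ?_)
  refine (add_le_add (Set.encard_image_le _ _) (Set.encard_image_le _ _)).trans ?_
  rw [Set.encard_univ, Set.encard_univ, ENat.card_eq_coe_natCard]
  push_cast
  exact add_le_add_right (degreeBounded_three att x) _

/-- The inclusion of the gadget at `x`. -/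
def gadgetHom (φ : Gadget H) (att : ∀ x : V, G.neighborSet x ≃ Fin 3) (x : V) :
    φ.graph →g localTransform G φ att :=
  ⟨fun a => (x, a), fun h => Or.inl ⟨rfl, h⟩⟩

theorem exists_walk_gadget [Finite H] (x : V) (a b : H) :
    ∃ p : (localTransform G φ att).Walk (x, a) (x, b), p.length ≤ Nat.card H := by
  have := Fintype.ofFinite H
  obtain ⟨p, hp⟩ := (φ.connected a b).exists_isPath
  refine ⟨p.map (gadgetHom φ att x), ?_⟩
  rw [Nat.card_eq_fintype_card]
  exact (SimpleGraph.Walk.length_map _ _).le.trans hp.length_lt.le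

/-- Each edge of the walk costs one step plus the crossing of a gadget, and there is one more gadget
than there are edges. -/
theorem exists_walk_localTransform [Finite H] {x y : V} (p : G.Walk x y) (a b : H) :
    ∃ q : (localTransform G φ att).Walk (x, a) (y, b),
      q.length ≤ Nat.card H + (Nat.card H + 1) * p.length := by
  induction p generalizing a with
  | nil =>
    obtain ⟨q, hq⟩ := exists_walk_gadget (φ := φ) (att := att) _ a b
    exact ⟨q, by simpa using hq⟩
  | @cons x z y h p ih =>
    obtain ⟨q₁, h₁⟩ := exists_walk_gadget (φ := φ) (att := att) x a (φ.outer (att x ⟨z, h⟩))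
    obtain ⟨q₂, h₂⟩ := ih (φ.outer (att z ⟨x, h.symm⟩))
    have hadj : (localTransform G φ att).Adj (x, φ.outer (att x ⟨z, h⟩))
        (z, φ.outer (att z ⟨x, h.symm⟩)) := Or.inr ⟨h, rfl, rfl⟩
    refine ⟨q₁.append (SimpleGraph.Walk.cons hadj q₂), ?_⟩
    rw [SimpleGraph.Walk.length_append, SimpleGraph.Walk.length_cons,
      SimpleGraph.Walk.length_cons]
    nlinarith

theorem connected_localTransform [Finite H] (hG : G.Connected) :
    (localTransform G φ att).Connected := by
  have : Nonempty (V × H) := ⟨(hG.nonempty.some, φ.outer 0)⟩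
  refine SimpleGraph.Connected.mk fun p q => ?_
  obtain ⟨w⟩ := hG p.1 q.1
  exact ⟨(exists_walk_localTransform (φ := φ) (att := att) w p.2 q.2).choose⟩

theorem dist_localTransform_le [Finite H] (hG : G.Connected) (p q : V × H) :
    (localTransform G φ att).dist p q ≤
      Nat.card H + (Nat.card H + 1) * G.dist p.1 q.1 := by
  obtain ⟨w, hw⟩ := hG.exists_walk_length_eq_dist p.1 q.1
  obtain ⟨w', hw'⟩ := exists_walk_localTransform (φ := φ) (att := att) w p.2 q.2
  rw [← hw]
  exact (SimpleGraph.dist_le w').trans hw'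

/-- Projecting a geodesic moves at most one step for each of its edges, and not at all inside a
gadget. -/
theorem dist_le_dist_localTransform [Finite H] (hG : G.Connected) (p q : V × H) :
    G.dist p.1 q.1 ≤ (localTransform G φ att).dist p q := by
  obtain ⟨w, hw⟩ :=
    (connected_localTransform (φ := φ) (att := att) hG).exists_walk_length_eq_dist p q
  rw [← hw]
  clear hw
  induction w with
  | nil => simp
  | @cons p r q h w ih =>
    rw [SimpleGraph.Walk.length_cons]
    have h1 : G.dist p.1 r.1 ≤ 1 := by
      rcases h with ⟨h, _⟩ | ⟨h, _, _⟩
      · simp [h]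
      · rw [SimpleGraph.dist_eq_one_iff_adj.2 h]
    have := hG.dist_triangle (u := p.1) (v := r.1) (w := q.1)
    omega

/-! ### Distances between sets and between edges -/

theorem setDist_le {A B : Set V} {a b : V} (ha : a ∈ A) (hb : b ∈ B) :
    setDist G A B ≤ G.dist a b :=
  Nat.sInf_le (Set.mem_image2_of_mem ha hb)

theorem exists_eq_setDist {A B : Set V} (hA : A.Nonempty) (hB : B.Nonempty) :
    ∃ a ∈ A, ∃ b ∈ B, G.dist a b = setDist G A B :=
  Nat.sInf_mem (hA.image2 hB)

theorem gadgetsOver_nonempty {W : Set V} (φ : Gadget H) (hW : W.Nonempty) :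
    (gadgetsOver H W).Nonempty :=
  let ⟨x, hx⟩ := hW
  ⟨(x, φ.outer 0), hx⟩

theorem setDist_le_setDist_gadgetsOver [Finite H] (hG : G.Connected) {A B : Set V}
    (hA : A.Nonempty) (hB : B.Nonempty) : setDist G A B ≤
      setDist (localTransform G φ att) (gadgetsOver H A) (gadgetsOver H B) := by
  obtain ⟨p, hp, q, hq, h⟩ := exists_eq_setDist (G := localTransform G φ att)
    (gadgetsOver_nonempty φ hA) (gadgetsOver_nonempty φ hB)
  rw [← h]
  exact (setDist_le (a := p.1) (b := q.1) hp hq).trans (dist_le_dist_localTransform hG p q)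

theorem setDist_gadgetsOver_le [Finite H] (hG : G.Connected) {A B : Set V}
    (hA : A.Nonempty) (hB : B.Nonempty) :
    setDist (localTransform G φ att) (gadgetsOver H A) (gadgetsOver H B) ≤
      Nat.card H + (Nat.card H + 1) * setDist G A B := by
  obtain ⟨x, hx, y, hy, h⟩ := exists_eq_setDist (G := G) hA hB
  rw [← h]
  exact (setDist_le (a := (x, φ.outer 0)) (b := (y, φ.outer 0)) hx hy).trans
    (dist_localTransform_le hG _ _)

theorem sym2_nonempty (e : Sym2 V) : {x | x ∈ e}.Nonempty := by
  induction e using Sym2.ind with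
  | _ x y => exact ⟨x, Sym2.mem_mk_left x y⟩

theorem dist_le_one_of_mem {e : Sym2 V} (he : e ∈ G.edgeSet) {x y : V} (hx : x ∈ e)
    (hy : y ∈ e) : G.dist x y ≤ 1 := by
  by_cases h : x = y
  · simp [h]
  · rw [(Sym2.mem_and_mem_iff h).1 ⟨hx, hy⟩] at he
    rw [SimpleGraph.dist_eq_one_iff_adj.2 he]

theorem midEdgeDist_le_midEdgeDist_liftEdge [Finite H] (hG : G.Connected) {s t : Sym2 V}
    (hst : s ≠ t) : midEdgeDist G s t ≤
      midEdgeDist (localTransform G φ att) (liftEdge φ att s) (liftEdge φ att t) := by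
  rw [midEdgeDist, midEdgeDist, if_neg hst, if_neg (liftEdge_injective.ne hst)]
  obtain ⟨p, hp, q, hq, h⟩ := exists_eq_setDist (G := localTransform G φ att)
    (sym2_nonempty (liftEdge φ att s)) (sym2_nonempty (liftEdge φ att t))
  rw [← h]
  exact Nat.succ_le_succ ((setDist_le (mem_liftEdge.1 hp).1 (mem_liftEdge.1 hq).1).trans
    (dist_le_dist_localTransform hG p q))

/-- The edge `f` of the transformed graph comes from `e` or lies in a gadget at an end of `e`. -/
def NearEdge (φ : Gadget H) (att : ∀ x : V, G.neighborSet x ≃ Fin 3) (f : Sym2 (V × H))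
    (e : Sym2 V) : Prop :=
  f = liftEdge φ att e ∨ ∃ x ∈ e, f.map Prod.fst = s(x, x)

theorem NearEdge.fst_mem {f : Sym2 (V × H)} {e : Sym2 V} (h : NearEdge φ att f e) {p : V × H}
    (hp : p ∈ f) : p.1 ∈ e := by
  rcases h with rfl | ⟨x, hx, h⟩
  · exact (mem_liftEdge.1 hp).1
  · have := fst_mem_map hp
    rw [h, Sym2.mem_iff, or_self] at this
    exact this ▸ hx

/-- Passing to nearby edges adds at most two to the distance d of the base endpoints, and h + (h +
1)(d + 2) + 1 = (h + 1)(d + 3) is at most 3(h + 1)(d + 1). The case s = t must be excluded: two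
distinct edges can be near one and the same edge. -/
theorem midEdgeDist_le_of_nearEdge [Finite H] (hG : G.Connected) {s t : Sym2 V}
    (hs : s ∈ G.edgeSet) (ht : t ∈ G.edgeSet) (hst : s ≠ t) {s' t' : Sym2 (V × H)}
    (hs' : NearEdge φ att s' s) (ht' : NearEdge φ att t' t) :
    midEdgeDist (localTransform G φ att) s' t' ≤ 3 * (Nat.card H + 1) * midEdgeDist G s t := by
  rw [midEdgeDist, midEdgeDist, if_neg hst]
  split_ifs
  · exact Nat.zero_le _
  obtain ⟨p, hp⟩ := sym2_nonempty s'
  obtain ⟨q, hq⟩ := sym2_nonempty t'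
  obtain ⟨x, hx, y, hy, h⟩ := exists_eq_setDist (G := G) (sym2_nonempty s) (sym2_nonempty t)
  have h1 := (setDist_le (G := localTransform G φ att) (A := {p | p ∈ s'}) (B := {q | q ∈ t'})
    hp hq).trans (dist_localTransform_le hG p q)
  have h2 := dist_le_one_of_mem hs (hs'.fst_mem hp) hx
  have h3 := dist_le_one_of_mem ht hy (ht'.fst_mem hq)
  have h4 := hG.dist_triangle (u := p.1) (v := x) (w := q.1)
  have h5 := hG.dist_triangle (u := x) (v := y) (w := q.1)
  rw [← h]
  have h6 : G.dist p.1 q.1 ≤ G.dist x y + 2 := by omega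
  have h7 := Nat.mul_le_mul_left (Nat.card H + 1) h6
  nlinarith

theorem NearEdge.mem_incidentEdges {W : Set V} {f : Sym2 (V × H)} {e : Sym2 V}
    (he : e ∈ G.edgeSet) (h : NearEdge φ att f e)
    (hf : f ∈ incidentEdges (localTransform G φ att) (gadgetsOver H W)) :
    e ∈ incidentEdges G W := by
  obtain ⟨_, p, hpW, hp⟩ := hf
  exact ⟨he, p.1, hpW, h.fst_mem hp⟩

theorem liftEdge_mem_incidentEdges {W : Set V} {e : Sym2 V} (h : e ∈ incidentEdges G W) :
    liftEdge φ att e ∈ incidentEdges (localTransform G φ att) (gadgetsOver H W) := by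
  obtain ⟨he, x, hxW, hx⟩ := h
  exact ⟨liftEdge_mem he, (x, φ.outer (portIdx att x e)), hxW, mem_liftEdge.2 ⟨hx, rfl⟩⟩

theorem isFundamentalDomain_gadgetsOver [Finite H] {W : Set V} (hW : IsFundamentalDomain G W)
    (hind : ∀ α : G ≃g G, ∃ β : localTransform G φ att ≃g localTransform G φ att,
      β '' gadgetsOver H W = gadgetsOver H (α '' W)) :
    IsFundamentalDomain (localTransform G φ att) (gadgetsOver H W) := by
  constructor
  · have : gadgetsOver H W = W ×ˢ Set.univ := by ext; simp [gadgetsOver]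
    rw [this]
    exact hW.finite.prod Set.finite_univ
  · intro p
    obtain ⟨α, hα⟩ := hW.exists_mem p.1
    obtain ⟨β, hβ⟩ := hind α.symm
    have : p ∈ β '' gadgetsOver H W := by
      rw [hβ]
      exact ⟨α p.1, hα, by simp⟩
    obtain ⟨q, hq, rfl⟩ := this
    exact ⟨β.symm, by simpa using hq⟩

end Transform

/-! ### Paths through a gadget -/

section GadgetPaths

variable {H : Type*}

/-- Paths of the gadget from `a` to `b`, as lists of the vertices after `a`. -/
def gadgetPaths (φ : Gadget H) (a b : H) : Set (List H) :=
  {q | (a :: q).IsChain φ.graph.Adj ∧ (a :: q).Nodup ∧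
    (a :: q).getLast (List.cons_ne_nil a q) = b}

theorem finite_gadgetPaths [Finite H] (φ : Gadget H) (a b : H) : (gadgetPaths φ a b).Finite := by
  have : Finite {l : List H // l.Nodup} := by
    classical
    have := Fintype.ofFinite H
    exact Finite.of_fintype _
  have h : {l : List H | l.Nodup}.Finite := this
  exact h.subset fun q hq => (List.nodup_cons.1 hq.2.1).2

theorem length_lt_of_mem_gadgetPaths [Finite H] {φ : Gadget H} {a b : H} {q : List H}
    (hq : q ∈ gadgetPaths φ a b) : q.length + 1 ≤ Nat.card H := by
  have := Fintype.ofFinite H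
  rw [Nat.card_eq_fintype_card]
  exact hq.2.1.length_le_card

/-- The generating function of the paths from `a` to `b` by the number of vertices. -/
noncomputable def pathGF (φ : Gadget H) (a b : H) (t : ℝ≥0∞) : ℝ≥0∞ :=
  ∑' q : gadgetPaths φ a b, t ^ (q.1.length + 1)

theorem pathGF_symm (φ : Gadget H) (a b : H) (t : ℝ≥0∞) : pathGF φ a b t = pathGF φ b a t := by
  have key : ∀ a b, pathGF φ a b t ≤ pathGF φ b a t := by
    intro a b
    have hcons : ∀ q : gadgetPaths φ a b, b :: (a :: q.1).reverse.tail = (a :: q.1).reverse := by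
      intro q
      have hne : (a :: q.1).reverse ≠ [] := by simp
      conv_rhs => rw [← List.cons_head_tail hne]
      rw [List.head_reverse, q.2.2.2]
    have hmem : ∀ q : gadgetPaths φ a b, (a :: q.1).reverse.tail ∈ gadgetPaths φ b a := by
      intro q
      refine ⟨?_, ?_, ?_⟩
      · rw [hcons, List.isChain_reverse]
        exact q.2.1.imp fun _ _ h => SimpleGraph.Adj.symm h
      · rw [hcons, List.nodup_reverse]
        exact q.2.2.1
      · simp only [hcons]
        simp
    have hinj : Function.Injective fun q : gadgetPaths φ a b =>
        (⟨_, hmem q⟩ : gadgetPaths φ b a) := by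
      intro q q' h
      have h1 : (a :: q.1).reverse = (a :: q'.1).reverse := by
        rw [← hcons q, ← hcons q']
        exact congrArg (fun r => b :: r.1) h
      exact Subtype.ext (List.cons_injective (List.reverse_injective h1))
    refine le_trans (le_of_eq ?_) (ENNReal.tsum_comp_le_tsum_of_injective hinj _)
    exact tsum_congr fun q => by simp
  exact le_antisymm (key a b) (key b a)

theorem pathGF_map (φ : Gadget H) (f : φ.graph ≃g φ.graph) (a b : H) (t : ℝ≥0∞) :
    pathGF φ a b t = pathGF φ (f a) (f b) t := by
  have key : ∀ (f : φ.graph ≃g φ.graph) (a b : H),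
      pathGF φ a b t ≤ pathGF φ (f a) (f b) t := by
    intro f a b
    have hmem : ∀ q : gadgetPaths φ a b, q.1.map f ∈ gadgetPaths φ (f a) (f b) := by
      intro q
      refine ⟨?_, ?_, ?_⟩
      · rw [← List.map_cons]
        exact (List.isChain_map f).2 (q.2.1.imp fun _ _ h => f.map_adj_iff.2 h)
      · rw [← List.map_cons]
        exact q.2.2.1.map f.injective
      · simp only [← List.map_cons, List.getLast_map, q.2.2.2]
    have hinj : Function.Injective fun q : gadgetPaths φ a b =>
        (⟨_, hmem q⟩ : gadgetPaths φ (f a) (f b)) := fun q q' h =>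
      Subtype.ext (List.map_injective_iff.2 f.injective (congrArg Subtype.val h))
    refine le_trans (le_of_eq ?_) (ENNReal.tsum_comp_le_tsum_of_injective hinj _)
    exact tsum_congr fun q => by simp
  refine le_antisymm (key f a b) ?_
  simpa using key f.symm (f a) (f b)

/-- The generating function of the paths between two outer vertices. -/
noncomputable def gadgetGF (φ : Gadget H) (t : ℝ≥0∞) : ℝ≥0∞ :=
  pathGF φ (φ.outer 0) (φ.outer 1) t

/-- Transitivity on the outer vertices is enough. An automorphism that takes the third outer vertex
to number 2 takes the pair i, j to 0, 1 in some order, and reversal of paths corrects the order. -/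
theorem pathGF_outer (φ : Gadget H) {i j : Fin 3} (hij : i ≠ j) (t : ℝ≥0∞) :
    pathGF φ (φ.outer i) (φ.outer j) t = gadgetGF φ t := by
  obtain ⟨k, hki, hkj⟩ : ∃ k : Fin 3, k ≠ i ∧ k ≠ j := by
    revert i j; decide
  obtain ⟨f, hf1, hf2⟩ := φ.symmetric k 2
  have hr : ∀ m, ∃ n, φ.outer n = f (φ.outer m) := fun m => by
    have : f (φ.outer m) ∈ f '' Set.range φ.outer := ⟨_, ⟨m, rfl⟩, rfl⟩
    rw [hf2] at this
    exact this
  obtain ⟨u, hu⟩ := hr i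
  obtain ⟨v, hv⟩ := hr j
  have hne : ∀ {m n m' n' : Fin 3}, φ.outer m' = f (φ.outer m) → φ.outer n' = f (φ.outer n) →
      m ≠ n → m' ≠ n' := by
    rintro m n m' n' h1 h2 h rfl
    exact h (φ.outer.injective (f.injective (h1.symm.trans h2)))
  have hu2 : 2 ≠ u := hne hf1.symm hu hki
  have hv2 : 2 ≠ v := hne hf1.symm hv hkj
  have huv : u ≠ v := hne hu hv hij
  have : (u = 0 ∧ v = 1) ∨ (u = 1 ∧ v = 0) := by
    clear hu hv
    revert u v; decide
  rw [pathGF_map φ f, ← hu, ← hv]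
  rcases this with ⟨rfl, rfl⟩ | ⟨rfl, rfl⟩
  · rfl
  · exact pathGF_symm φ _ _ t

theorem continuous_gadgetGF [Finite H] (φ : Gadget H) : Continuous (gadgetGF φ) := by
  have := (finite_gadgetPaths φ (φ.outer 0) (φ.outer 1)).to_subtype
  have := Fintype.ofFinite (gadgetPaths φ (φ.outer 0) (φ.outer 1))
  have h : gadgetGF φ = fun t => ∑ q : gadgetPaths φ (φ.outer 0) (φ.outer 1),
      t ^ (q.1.length + 1) := funext fun t => tsum_fintype _
  rw [h]
  exact continuous_finsetSum _ fun q _ => ENNReal.continuous_pow _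

end GadgetPaths

/-! ### Lifting self-avoiding walks -/

section Lift

variable {V H : Type*} {G : SimpleGraph V}

/-- The steps of the transformed graph inside the gadget at `x`, from `a` along `q` to the outer
vertex of the edge `f`, followed by the step to that edge. -/
noncomputable def piece (φ : Gadget H) (att : ∀ x : V, G.neighborSet x ≃ Fin 3) (x : V)
    (f : Sym2 V) (a : H) (q : List H) : List ((V × H) × Sym2 (V × H)) :=
  pathSteps (x, a) (q.map (Prod.mk x)) ++ [((x, φ.outer (portIdx att x f)), liftEdge φ att f)]

/-- The walks of the transformed graph that follow a given walk. -/
noncomputable def liftSet (φ : Gadget H) (att : ∀ x : V, G.neighborSet x ≃ Fin 3) :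
    Sym2 V → List (V × Sym2 V) → Set (List ((V × H) × Sym2 (V × H)))
  | _, [] => {[]}
  | e, p :: l => Set.image2
      (fun q L => piece φ att p.1 p.2 (φ.outer (portIdx att p.1 e)) q ++ L)
      (gadgetPaths φ (φ.outer (portIdx att p.1 e)) (φ.outer (portIdx att p.1 p.2)))
      (liftSet φ att p.2 l)

variable {φ : Gadget H} {att : ∀ x : V, G.neighborSet x ≃ Fin 3}

theorem IsMidSAW.tail {e : Sym2 V} {p : V × Sym2 V} {l : List (V × Sym2 V)}
    (h : IsMidSAW G e (p :: l)) : IsMidSAW G p.2 l :=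
  (IsMidSAW.of_append (l := [p]) (l' := l) h).2

theorem IsMidSAW.portIdx_ne {e : Sym2 V} {p : V × Sym2 V} {l : List (V × Sym2 V)}
    (h : IsMidSAW G e (p :: l)) : portIdx att p.1 e ≠ portIdx att p.1 p.2 := by
  intro heq
  have := portIdx_inj att h.edge_mem h.chain.2.2.1 h.chain.1 h.chain.2.1 heq
  exact (List.nodup_cons.1 h.edge_nodup).1 (by simp [this])

theorem map_fst_of_mem_pathSteps {x : V} {a : H} {q : List H} {p : (V × H) × Sym2 (V × H)}
    (hp : p ∈ pathSteps (x, a) (q.map (Prod.mk x))) :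
    p.1.1 = x ∧ p.2.map Prod.fst = s(x, x) := by
  induction q generalizing a with
  | nil => simp [pathSteps] at hp
  | cons b q ih =>
    rcases List.mem_cons.1 hp with rfl | hp
    · exact ⟨rfl, rfl⟩
    · exact ih hp

theorem map_fst_piece {x : V} {f : Sym2 V} {a : H} {q : List H}
    (hq : q ∈ gadgetPaths φ a (φ.outer (portIdx att x f))) :
    (piece φ att x f a q).map Prod.fst = (a :: q).map (Prod.mk x) := by
  rw [piece, List.map_append, map_fst_pathSteps, ← List.map_cons, ← List.map_dropLast, ← hq.2.2]
  simp only [List.map_cons, List.map_nil]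
  conv_rhs => rw [← List.map_cons, ← List.dropLast_append_getLast (List.cons_ne_nil a q)]
  rw [List.map_append]
  rfl

theorem piece_length (x : V) (f : Sym2 V) (a : H) (q : List H) :
    (piece φ att x f a q).length = q.length + 1 := by
  simp [piece, pathSteps_length]

theorem endEdge_piece (F : Sym2 (V × H)) (x : V) (f : Sym2 V) (a : H) (q : List H) :
    endEdge F (piece φ att x f a q) = liftEdge φ att f := by
  rw [piece, endEdge_append]
  rfl

theorem midChain_piece {x : V} {e f : Sym2 V} {q : List H} (hxe : x ∈ e) (hxf : x ∈ f)
    (hf : f ∈ G.edgeSet)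
    (hq : q ∈ gadgetPaths φ (φ.outer (portIdx att x e)) (φ.outer (portIdx att x f))) :
    MidChain (localTransform G φ att) (liftEdge φ att e)
      (piece φ att x f (φ.outer (portIdx att x e)) q) := by
  have hchain : ((x, φ.outer (portIdx att x e)) :: q.map (Prod.mk x)).IsChain
      (localTransform G φ att).Adj := by
    rw [← List.map_cons (f := Prod.mk x)]
    exact (List.isChain_map (Prod.mk x)).2 (hq.1.imp fun _ _ h => Or.inl ⟨rfl, h⟩)
  obtain ⟨h1, h2⟩ := midChain_pathSteps (e := liftEdge φ att e)
    (mem_liftEdge.2 ⟨hxe, rfl⟩) hchain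
  rw [piece, midChain_append]
  refine ⟨h1, ?_, mem_liftEdge.2 ⟨hxf, rfl⟩, liftEdge_mem hf, trivial⟩
  convert h2 using 1
  have := hq.2.2
  rw [← this]
  simp only [← List.map_cons (f := Prod.mk x), List.getLast_map]

/-- The first edge outside the gadget marks the end of the path inside it, so the concatenation can
be parsed in only one way. -/
theorem pathSteps_append_inj {x : V} {a : H} {q q' : List H} {y : V × H} {F : Sym2 (V × H)}
    (hF : F.map Prod.fst ≠ s(x, x)) {L L' : List ((V × H) × Sym2 (V × H))}
    (h : pathSteps (x, a) (q.map (Prod.mk x)) ++ (y, F) :: L =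
      pathSteps (x, a) (q'.map (Prod.mk x)) ++ (y, F) :: L') : q = q' ∧ L = L' := by
  induction q generalizing a q' with
  | nil =>
    cases q' with
    | nil => exact ⟨rfl, (List.cons.inj h).2⟩
    | cons b q' =>
      have h1 : F = s((x, a), (x, b)) := congrArg Prod.snd (List.cons.inj h).1
      exact absurd (by rw [h1]; rfl) hF
  | cons c q ih =>
    cases q' with
    | nil =>
      have h1 : s((x, a), (x, c)) = F := congrArg Prod.snd (List.cons.inj h).1
      exact absurd (by rw [← h1]; rfl) hF
    | cons b q' =>
      have h1 : s((x, a), (x, c)) = s((x, a), (x, b)) := congrArg Prod.snd (List.cons.inj h).1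
      obtain rfl : c = b := congrArg Prod.snd (Sym2.congr_right.1 h1)
      obtain ⟨rfl, rfl⟩ := ih (List.cons.inj h).2
      exact ⟨rfl, rfl⟩

theorem piece_append_inj {x : V} {f : Sym2 V} (hf : f ∈ G.edgeSet) {a : H} {q q' : List H}
    {L L' : List ((V × H) × Sym2 (V × H))}
    (h : piece φ att x f a q ++ L = piece φ att x f a q' ++ L') : q = q' ∧ L = L' := by
  simp only [piece, List.append_assoc, List.singleton_append] at h
  exact pathSteps_append_inj (liftEdge_ne_internal hf x) h

/-- The generating function of the lifts of a walk. -/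
theorem tsum_liftSet {e : Sym2 V} {l : List (V × Sym2 V)} (h : IsMidSAW G e l) (t : ℝ≥0∞) :
    ∑' L : liftSet φ att e l, t ^ L.1.length = gadgetGF φ t ^ l.length := by
  induction l generalizing e with
  | nil =>
    have : liftSet φ att e [] = {[]} := rfl
    rw [this, tsum_singleton ([] : List ((V × H) × Sym2 (V × H))) fun L => t ^ L.length]
    simp
  | cons p l ih =>
    set P := gadgetPaths φ (φ.outer (portIdx att p.1 e)) (φ.outer (portIdx att p.1 p.2))
    have hbij : Function.Bijective fun r : P × liftSet φ att p.2 l =>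
        (⟨piece φ att p.1 p.2 (φ.outer (portIdx att p.1 e)) r.1.1 ++ r.2.1,
          Set.mem_image2_of_mem r.1.2 r.2.2⟩ : liftSet φ att e (p :: l)) := by
      constructor
      · intro r r' hr
        obtain ⟨h1, h2⟩ := piece_append_inj h.chain.2.2.1 (congrArg Subtype.val hr)
        exact Prod.ext (Subtype.ext h1) (Subtype.ext h2)
      · rintro ⟨_, q, hq, L, hL, rfl⟩
        exact ⟨⟨⟨q, hq⟩, ⟨L, hL⟩⟩, rfl⟩
    rw [← (Equiv.ofBijective _ hbij).tsum_eq]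
    simp only [Equiv.ofBijective_apply, List.length_append, piece_length, pow_add t (_ + 1)]
    rw [ENNReal.tsum_prod (f := fun (q : P) (L : liftSet φ att p.2 l) =>
      t ^ (q.1.length + 1) * t ^ L.1.length)]
    simp only [ENNReal.tsum_mul_left, ENNReal.tsum_mul_right, ih h.tail]
    rw [List.length_cons, pow_succ', ← pathGF_outer φ (h.portIdx_ne (att := att)) t]
    rfl

open Classical in
/-- The walk followed by a walk of the transformed graph. -/
noncomputable def projSteps (L : List ((V × H) × Sym2 (V × H))) : List (V × Sym2 V) :=
  L.filterMap fun p =>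
    if (p.2.map Prod.fst).IsDiag then none else some (p.1.1, p.2.map Prod.fst)

theorem projSteps_of_mem_liftSet {e : Sym2 V} {l : List (V × Sym2 V)} (h : MidChain G e l)
    {L : List ((V × H) × Sym2 (V × H))} (hL : L ∈ liftSet φ att e l) : projSteps L = l := by
  induction l generalizing e L with
  | nil =>
    obtain rfl : L = [] := hL
    rfl
  | cons p l ih =>
    obtain ⟨q, hq, L', hL', rfl⟩ := hL
    have h1 := ih h.2.2.2 hL'
    have h2 : projSteps (pathSteps (p.1, φ.outer (portIdx att p.1 e)) (q.map (Prod.mk p.1))) =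
        [] := by
      refine List.filterMap_eq_nil_iff.2 fun r hr => ?_
      rw [(map_fst_of_mem_pathSteps hr).2]
      simp
    have h3 : ¬ p.2.IsDiag := G.not_isDiag_of_mem_edgeSet h.2.2.1
    rw [projSteps] at h1 h2 ⊢
    rw [List.filterMap_append, piece, List.filterMap_append, h2, h1]
    simp [h3]

theorem endEdge_liftSet {e : Sym2 V} {l : List (V × Sym2 V)}
    {L : List ((V × H) × Sym2 (V × H))} (hL : L ∈ liftSet φ att e l) :
    endEdge (liftEdge φ att e) L = liftEdge φ att (endEdge e l) := by
  induction l generalizing e L with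
  | nil =>
    obtain rfl : L = [] := hL
    rfl
  | cons p l ih =>
    obtain ⟨q, hq, L', hL', rfl⟩ := hL
    rw [endEdge_append, endEdge_piece, ih hL', endEdge_cons]

/-- Every gadget crossed contributes at least one vertex and at most all of them. -/
theorem length_liftSet [Finite H] {e : Sym2 V} {l : List (V × Sym2 V)}
    {L : List ((V × H) × Sym2 (V × H))} (hL : L ∈ liftSet φ att e l) :
    l.length ≤ L.length ∧ L.length ≤ Nat.card H * l.length := by
  induction l generalizing e L with
  | nil =>
    obtain rfl : L = [] := hL
    simp
  | cons p l ih =>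
    obtain ⟨q, hq, L', hL', rfl⟩ := hL
    have h1 := ih hL'
    have h2 := length_lt_of_mem_gadgetPaths hq
    rw [List.length_append, piece_length, List.length_cons, mul_add, mul_one]
    omega

theorem liftEdge_mem_of_mem_liftSet {e : Sym2 V} {l : List (V × Sym2 V)}
    {L : List ((V × H) × Sym2 (V × H))} (hL : L ∈ liftSet φ att e l) {g : Sym2 V}
    (hg : g ∈ l.map Prod.snd) : liftEdge φ att g ∈ L.map Prod.snd := by
  induction l generalizing e L with
  | nil => simp at hg
  | cons p l ih =>
    obtain ⟨q, hq, L', hL', rfl⟩ := hL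
    rw [List.map_append, List.mem_append]
    rcases List.mem_cons.1 hg with rfl | hg
    · left; simp [piece]
    · right; exact ih hL' hg

theorem steps_of_mem_liftSet {e : Sym2 V} {l : List (V × Sym2 V)}
    {L : List ((V × H) × Sym2 (V × H))} (hL : L ∈ liftSet φ att e l)
    {r : (V × H) × Sym2 (V × H)} (hr : r ∈ L) : r.1.1 ∈ l.map Prod.fst ∧
      (r.2.map Prod.fst = s(r.1.1, r.1.1) ∨ ∃ g ∈ l.map Prod.snd, r.2 = liftEdge φ att g) := by
  induction l generalizing e L with
  | nil =>
    obtain rfl : L = [] := hL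
    simp at hr
  | cons p l ih =>
    obtain ⟨q, hq, L', hL', rfl⟩ := hL
    rcases List.mem_append.1 hr with hr | hr
    · rcases List.mem_append.1 hr with hr | hr
      · obtain ⟨h1, h2⟩ := map_fst_of_mem_pathSteps hr
        exact ⟨by simp [h1], Or.inl (by rw [h1, h2])⟩
      · obtain rfl := List.mem_singleton.1 hr
        exact ⟨by simp, Or.inr ⟨p.2, by simp, rfl⟩⟩
    · obtain ⟨h1, h2⟩ := ih hL' hr
      refine ⟨List.mem_cons_of_mem _ h1, h2.imp_right ?_⟩
      rintro ⟨g, hg, h⟩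
      exact ⟨g, List.mem_cons_of_mem _ hg, h⟩

/-- Different steps of the base walk use different gadgets, so the vertices and the internal edges
of different pieces are disjoint. Lifted edges are distinct because the base edges are, and they are
never internal. -/
theorem isMidSAW_of_mem_liftSet {e : Sym2 V} {l : List (V × Sym2 V)} (h : IsMidSAW G e l)
    {L : List ((V × H) × Sym2 (V × H))} (hL : L ∈ liftSet φ att e l) :
    IsMidSAW (localTransform G φ att) (liftEdge φ att e) L := by
  induction l generalizing e L with
  | nil =>
    obtain rfl : L = [] := hL
    exact ⟨liftEdge_mem h.edge_mem, trivial, List.nodup_nil, by simp⟩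
  | cons p l ih =>
    obtain ⟨q, hq, L', hL', rfl⟩ := hL
    have ih' := ih h.tail hL'
    obtain ⟨hxe, hxf, hf, _⟩ := h.chain
    have hpl : p.1 ∉ l.map Prod.fst := (List.nodup_cons.1 h.vert_nodup).1
    have hel : e ∉ p.2 :: l.map Prod.snd := (List.nodup_cons.1 h.edge_nodup).1
    refine ⟨liftEdge_mem h.edge_mem, ?_, ?_, ?_⟩
    · rw [midChain_append, endEdge_piece]
      exact ⟨midChain_piece hxe hxf hf hq, ih'.chain⟩
    · rw [List.map_append, map_fst_piece hq]
      refine List.nodup_append.2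
        ⟨hq.2.1.map (Prod.mk_right_injective p.1), ih'.vert_nodup, ?_⟩
      rintro v hv w hw rfl
      obtain ⟨a, _, rfl⟩ := List.mem_map.1 hv
      obtain ⟨r, hr, hrv⟩ := List.mem_map.1 hw
      have := (steps_of_mem_liftSet hL' hr).1
      rw [hrv] at this
      exact hpl this
    · have hin : ∀ c ∈ (pathSteps (p.1, φ.outer (portIdx att p.1 e))
          (q.map (Prod.mk p.1))).map Prod.snd, c.map Prod.fst = s(p.1, p.1) := by
        intro c hc
        obtain ⟨r, hr, rfl⟩ := List.mem_map.1 hc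
        exact (map_fst_of_mem_pathSteps hr).2
      have hout : ∀ c ∈ liftEdge φ att p.2 :: L'.map Prod.snd,
          (∃ y ∈ l.map Prod.fst, c.map Prod.fst = s(y, y)) ∨
            ∃ g ∈ p.2 :: l.map Prod.snd, c = liftEdge φ att g := by
        intro c hc
        rcases List.mem_cons.1 hc with rfl | hc
        · exact Or.inr ⟨p.2, by simp, rfl⟩
        · obtain ⟨r, hr, rfl⟩ := List.mem_map.1 hc
          obtain ⟨h1, h2⟩ := steps_of_mem_liftSet hL' hr
          rcases h2 with h2 | ⟨g, hg, h2⟩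
          · exact Or.inl ⟨_, h1, h2⟩
          · exact Or.inr ⟨g, List.mem_cons_of_mem _ hg, h2⟩
      have hedge : ∀ g ∈ p.2 :: l.map Prod.snd, g ∈ G.edgeSet := by
        intro g hg
        obtain ⟨r, hr, rfl⟩ := List.mem_map.1 (show g ∈ (p :: l).map Prod.snd from hg)
        exact (h.chain.edge_mem hr).2
      have hlist : liftEdge φ att e ::
          (piece φ att p.1 p.2 (φ.outer (portIdx att p.1 e)) q ++ L').map Prod.snd =
          (liftEdge φ att e :: (pathSteps (p.1, φ.outer (portIdx att p.1 e))
            (q.map (Prod.mk p.1))).map Prod.snd) ++ liftEdge φ att p.2 :: L'.map Prod.snd := by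
        simp [piece]
      rw [hlist]
      refine List.nodup_append.2 ⟨List.nodup_cons.2 ⟨fun hm => ?_, ?_⟩, ih'.edge_nodup, ?_⟩
      · exact liftEdge_ne_internal h.edge_mem p.1 (hin _ hm)
      · refine edges_pathSteps_nodup ?_
        rw [← List.map_cons (f := Prod.mk p.1)]
        exact hq.2.1.map (Prod.mk_right_injective p.1)
      · rintro c hc d hd rfl
        rcases List.mem_cons.1 hc with rfl | hc
        · rcases hout _ hd with ⟨y, _, hy⟩ | ⟨g, hg, hge⟩
          · exact liftEdge_ne_internal h.edge_mem y hy
          · rw [liftEdge_injective hge] at hel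
            exact hel hg
        · have h1 := hin c hc
          rcases hout _ hd with ⟨y, hy, h2⟩ | ⟨g, hg, rfl⟩
          · rw [h1] at h2
            have : p.1 = y := by simpa using h2
            exact hpl (this ▸ hy)
          · exact liftEdge_ne_internal (hedge g hg) p.1 h1

end Lift

/-! ### Decomposing self-avoiding walks of the transformed graph -/

section Decompose

variable {V H : Type*} {G : SimpleGraph V} {φ : Gadget H}
  {att : ∀ x : V, G.neighborSet x ≃ Fin 3}

/-- A step to an edge inside a gadget. -/
def IsInner (p : (V × H) × Sym2 (V × H)) : Prop :=
  ∃ x, p.2.map Prod.fst = s(x, x)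

theorem eq_of_mem_of_map_fst {F : Sym2 (V × H)} {x : V} (hF : F.map Prod.fst = s(x, x))
    {p : V × H} (hp : p ∈ F) : p.1 = x := by
  have := fst_mem_map hp
  rw [hF, Sym2.mem_iff, or_self] at this
  exact this

theorem exists_first_outer {F : Sym2 (V × H)} {L : List ((V × H) × Sym2 (V × H))}
    (h : MidChain (localTransform G φ att) F L) : (∀ p ∈ L, IsInner p) ∨
      ∃ pre y g rest, L = (pre ++ [(y, liftEdge φ att g)]) ++ rest ∧ g ∈ G.edgeSet ∧
        ∀ p ∈ pre, IsInner p := by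
  induction L generalizing F with
  | nil => exact Or.inl (by simp)
  | cons p L ih =>
    rcases map_fst_mem_or h.2.2.1 with hp | ⟨g, hg, hp⟩
    · rcases ih h.2.2.2 with h1 | ⟨pre, y, g, rest, h1, h2, h3⟩
      · exact Or.inl (List.forall_mem_cons.2 ⟨hp, h1⟩)
      · exact Or.inr ⟨p :: pre, y, g, rest, by simp [h1], h2, List.forall_mem_cons.2 ⟨hp, h3⟩⟩
    · exact Or.inr ⟨[], p.1, g, L, by rw [← hp]; rfl, hg, by simp⟩

theorem exists_last_outer {F : Sym2 (V × H)} {L : List ((V × H) × Sym2 (V × H))}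
    (h : MidChain (localTransform G φ att) F L) : (∀ p ∈ L, IsInner p) ∨
      ∃ core y g suf, L = (core ++ [(y, liftEdge φ att g)]) ++ suf ∧ g ∈ G.edgeSet ∧
        ∀ p ∈ suf, IsInner p := by
  induction L generalizing F with
  | nil => exact Or.inl (by simp)
  | cons p L ih =>
    rcases ih h.2.2.2 with h1 | ⟨core, y, g, suf, h1, h2, h3⟩
    · rcases map_fst_mem_or h.2.2.1 with hp | ⟨g, hg, hp⟩
      · exact Or.inl (List.forall_mem_cons.2 ⟨hp, h1⟩)
      · exact Or.inr ⟨[], p.1, g, L, by rw [← hp]; rfl, hg, h1⟩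
    · exact Or.inr ⟨p :: core, y, g, suf, by simp [h1], h2, h3⟩

/-- Both ends of an inner edge lie in one gadget, so the walk stays there up to and including the
vertex from which it first leaves. -/
theorem fst_eq_of_inner_prefix {G₁ : SimpleGraph (V × H)} {F : Sym2 (V × H)} {x : V}
    (hF : F.map Prod.fst = s(x, x))
    {pre : List ((V × H) × Sym2 (V × H))} {p : (V × H) × Sym2 (V × H)}
    (h : MidChain G₁ F (pre ++ [p])) (hin : ∀ r ∈ pre, IsInner r) :
    ∀ r ∈ pre ++ [p], r.1.1 = x := by
  induction pre generalizing F with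
  | nil =>
    intro r hr
    obtain rfl := List.mem_singleton.1 hr
    exact eq_of_mem_of_map_fst hF h.1
  | cons q pre ih =>
    have hq := eq_of_mem_of_map_fst hF h.1
    obtain ⟨y, hy⟩ := hin q List.mem_cons_self
    have hxy : x = y := by rw [← hq, eq_of_mem_of_map_fst hy h.2.1]
    refine List.forall_mem_cons.2 ⟨hq, ih ?_ h.2.2.2 fun r hr => hin r (List.mem_cons_of_mem _ hr)⟩
    rw [hy, hxy]

/-- The initial edge may join two gadgets. The first vertex visited decides in which of them the
walk remains. -/
theorem exists_gadget_of_inner {G₁ : SimpleGraph (V × H)} {F : Sym2 (V × H)}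
    {L : List ((V × H) × Sym2 (V × H))} (h : MidChain G₁ F L) (hne : L ≠ [])
    (hin : ∀ r ∈ L, IsInner r) : ∃ p ∈ F, ∀ r ∈ L, r.1.1 = p.1 ∧ r.2.map Prod.fst = s(p.1, p.1) := by
  induction L generalizing F with
  | nil => exact absurd rfl hne
  | cons q L ih =>
    refine ⟨q.1, h.1, ?_⟩
    obtain ⟨y, hy⟩ := hin q List.mem_cons_self
    obtain rfl := eq_of_mem_of_map_fst hy h.2.1
    refine List.forall_mem_cons.2 ⟨⟨rfl, hy⟩, fun r hr => ?_⟩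
    obtain ⟨p, hp, hpr⟩ := ih h.2.2.2 (List.ne_nil_of_mem hr)
      fun r hr => hin r (List.mem_cons_of_mem _ hr)
    rw [← eq_of_mem_of_map_fst hy hp]
    exact hpr r hr

theorem length_le_of_fst_eq [Finite H] {x : V} {L : List ((V × H) × Sym2 (V × H))}
    (hn : (L.map Prod.fst).Nodup) (h : ∀ r ∈ L, r.1.1 = x) : L.length ≤ Nat.card H := by
  have := Fintype.ofFinite H
  have h1 : ((L.map Prod.fst).map Prod.snd).Nodup := by
    refine hn.map_on fun p hp q hq hpq => Prod.ext ?_ hpq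
    obtain ⟨r, hr, rfl⟩ := List.mem_map.1 hp
    obtain ⟨r', hr', rfl⟩ := List.mem_map.1 hq
    rw [h r hr, h r' hr']
  have h2 := h1.length_le_card
  rwa [List.length_map, List.length_map, ← Nat.card_eq_fintype_card] at h2

/-- A walk of the transformed graph that ends at an edge of the original graph starts with a path
through a gadget. -/
theorem exists_first_piece {F : Sym2 (V × H)} {x : V} {a : H} {f : Sym2 (V × H)}
    {L : List ((V × H) × Sym2 (V × H))}
    (h : MidChain (localTransform G φ att) F (((x, a), f) :: L))
    (hn : ((((x, a), f) :: L).map Prod.fst).Nodup) {t : Sym2 V} (ht : t ∈ G.edgeSet)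
    (hend : endEdge F (((x, a), f) :: L) = liftEdge φ att t) :
    ∃ q b g L', g ∈ G.edgeSet ∧ (a :: q).IsChain φ.graph.Adj ∧
      (a :: q).getLast (List.cons_ne_nil a q) = b ∧ (x, b) ∈ liftEdge φ att g ∧
      ((x, a), f) :: L = pathSteps (x, a) (q.map (Prod.mk x)) ++ ((x, b), liftEdge φ att g) :: L' := by
  induction L generalizing F a f with
  | nil =>
    have hf : f = liftEdge φ att t := hend
    exact ⟨[], a, t, [], ht, List.IsChain.singleton a, rfl, hf ▸ h.2.1, by rw [hf]; rfl⟩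
  | cons r L ih =>
    obtain ⟨⟨y, c⟩, f'⟩ := r
    rcases mem_edgeSet_localTransform h.2.2.1 with ⟨z, b, d, hbd, hf⟩ | ⟨g, hg, hf⟩
    · simp only at hf
      have hxz : x = z := eq_of_mem_of_map_fst (F := f) (by rw [hf]; rfl) h.2.1
      have hyz : y = z := eq_of_mem_of_map_fst (F := f) (by rw [hf]; rfl) h.2.2.2.1
      subst hxz hyz
      have hne : ((y, a) : V × H) ≠ (y, c) := by
        intro he
        refine (List.nodup_cons.1 hn).1 ?_
        simp [he]
      have hf' : f = s((y, a), (y, c)) := (Sym2.mem_and_mem_iff hne).1 ⟨h.2.1, h.2.2.2.1⟩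
      have hac : φ.graph.Adj a c := by
        have := h.2.2.1
        rw [hf'] at this
        rcases this with ⟨_, h⟩ | ⟨h, _⟩
        · exact h
        · exact absurd h (G.loopless.irrefl y)
      obtain ⟨q, b', g, L', h1, h2, h3, h4, h5⟩ := ih h.2.2.2 (List.nodup_cons.1 hn).2 hend
      refine ⟨c :: q, b', g, L', h1, List.isChain_cons_cons.2 ⟨hac, h2⟩, ?_, h4, ?_⟩
      · rw [List.getLast_cons (List.cons_ne_nil c q)]; exact h3
      · rw [h5, hf']; rfl
    · simp only at hf
      exact ⟨[], a, g, _, hg, List.IsChain.singleton a, rfl, hf ▸ h.2.1, by rw [hf]; rfl⟩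

/-- Four distinct edges do not fit at a vertex of degree three. -/
theorem not_mem_vert_of_edge_nodup (att : ∀ x : V, G.neighborSet x ≃ Fin 3) {e f : Sym2 V} {x : V}
    {l : List (V × Sym2 V)} (h : MidChain G e ((x, f) :: l)) (he : e ∈ G.edgeSet)
    (hn : (e :: f :: l.map Prod.snd).Nodup) (hhead : ∀ p l', l = p :: l' → p.1 ≠ x) :
    x ∉ l.map Prod.fst := by
  intro hx
  obtain ⟨⟨x', g⟩, hg, rfl⟩ := List.mem_map.1 hx
  obtain ⟨A, B, rfl⟩ := List.append_of_mem hg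
  -- The step `r` just before the second visit supplies the fourth edge at the vertex. For an
  -- immediate return that edge would be `f` itself, so this case is left to `hhead`.
  rcases List.eq_nil_or_concat A with rfl | ⟨A, r, rfl⟩
  · exact hhead _ _ rfl rfl
  simp only [List.concat_eq_append, List.append_assoc, List.cons_append, List.nil_append] at h hn
  obtain ⟨hxe, hxf, hf, h⟩ := h
  have h1 := (midChain_append.1 h).2
  have hr := h1.2.2.1
  have hxr : x' ∈ r.2 := h1.2.2.2.1
  have hxg : x' ∈ g := h1.2.2.2.2.1
  have hgE : g ∈ G.edgeSet := h1.2.2.2.2.2.1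
  have hfE : f ∈ G.edgeSet := hf
  simp only [List.map_append, List.map_cons, List.nodup_cons, List.mem_cons, List.mem_append,
    not_or] at hn
  obtain ⟨⟨hef, _, her, heg, _⟩, ⟨_, hfr, hfg, _⟩, hn⟩ := hn
  have h2 := (List.nodup_cons.1 (List.nodup_append.1 hn).2.1).1
  have hrg : r.2 ≠ g := fun h => h2 (by simp [h])
  have hport : ∀ {a b : Sym2 V}, a ∈ G.edgeSet → b ∈ G.edgeSet → x' ∈ a → x' ∈ b → ¬ a = b →
      portIdx att x' a ≠ portIdx att x' b :=
    fun ha hb hxa hxb hab hp => hab (portIdx_inj att ha hb hxa hxb hp)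
  have n1 := hport he hfE hxe hxf hef
  have n2 := hport he hr hxe hxr her
  have n3 := hport he hgE hxe hxg heg
  have n4 := hport hfE hr hxf hxr hfr
  have n5 := hport hfE hgE hxf hxg hfg
  have n6 := hport hr hgE hxr hxg hrg
  omega

theorem fst_head_mem_of_mem_liftSet {e : Sym2 V} {p : V × Sym2 V} {l : List (V × Sym2 V)}
    {L : List ((V × H) × Sym2 (V × H))} (hL : L ∈ liftSet φ att e (p :: l)) :
    (p.1, φ.outer (portIdx att p.1 e)) ∈ L.map Prod.fst := by
  obtain ⟨q, hq, L', _, rfl⟩ := hL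
  rw [List.map_append, map_fst_piece hq]
  simp

/-- A self-avoiding walk of the transformed graph between edges of the original graph is the lift
of a self-avoiding walk. -/
theorem exists_mem_liftSet {e t : Sym2 V} {L : List ((V × H) × Sym2 (V × H))}
    (h : IsMidSAW (localTransform G φ att) (liftEdge φ att e) L) (he : e ∈ G.edgeSet)
    (ht : t ∈ G.edgeSet) (hend : endEdge (liftEdge φ att e) L = liftEdge φ att t) :
    ∃ l, IsMidSAW G e l ∧ L ∈ liftSet φ att e l := by
  induction hk : L.length using Nat.strong_induction_on generalizing e L with
  | _ k ih =>
  match L, h, hend, hk with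
  | [], h, hend, hk => exact ⟨[], ⟨he, trivial, List.nodup_nil, by simp⟩, rfl⟩
  | ((x, a), f') :: L, h, hend, hk =>
    obtain ⟨q, b, f, L', hf, h1, h2, h3, h4⟩ :=
      exists_first_piece h.chain h.vert_nodup ht hend
    obtain ⟨hxe, ha⟩ := mem_liftEdge.1 h.chain.1
    obtain ⟨hxf, hb⟩ := mem_liftEdge.1 h3
    simp only at hxe ha hxf hb
    subst ha hb
    have h5 : ((x, φ.outer (portIdx att x e)), f') :: L =
        piece φ att x f (φ.outer (portIdx att x e)) q ++ L' := by
      rw [h4, piece, List.append_assoc]; rfl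
    rw [h5] at h hend hk
    have hqn : (φ.outer (portIdx att x e) :: q).Nodup := by
      have hm : (piece φ att x f (φ.outer (portIdx att x e)) q).map Prod.fst =
          (φ.outer (portIdx att x e) :: q).map (Prod.mk x) := by
        rw [piece, List.map_append, map_fst_pathSteps, ← List.map_cons, ← List.map_dropLast, ← h2]
        simp only [List.map_cons, List.map_nil]
        conv_rhs => rw [← List.map_cons, ← List.dropLast_append_getLast (List.cons_ne_nil _ q)]
        rw [List.map_append]
        rfl
      have := h.of_append.1.vert_nodup
      rw [hm] at this
      exact this.of_map
    have hq : q ∈ gadgetPaths φ (φ.outer (portIdx att x e)) (φ.outer (portIdx att x f)) :=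
      ⟨h1, hqn, h2⟩
    have hsaw' := h.of_append.2
    rw [endEdge_append, endEdge_piece] at hend
    rw [endEdge_piece] at hsaw'
    rw [List.length_append, piece_length] at hk
    -- After the first gadget has been crossed, the rest is a shorter walk starting on the lifted
    -- edge of `f`, so it is a lift by induction.
    obtain ⟨l, hl, hL'⟩ := ih L'.length (by omega) hsaw' hf hend rfl
    have hchain : MidChain G e ((x, f) :: l) := ⟨hxe, hxf, hf, hl.chain⟩
    have hen : (e :: f :: l.map Prod.snd).Nodup := by
      refine List.nodup_cons.2 ⟨fun hm => (List.nodup_cons.1 h.edge_nodup).1 ?_, hl.edge_nodup⟩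
      rw [List.map_append, List.mem_append]
      rcases List.mem_cons.1 hm with rfl | hm
      · left; simp [piece]
      · right; exact liftEdge_mem_of_mem_liftSet hL' hm
    have hx : x ∉ l.map Prod.fst := by
      refine not_mem_vert_of_edge_nodup att hchain he hen ?_
      -- An immediate return to the same gadget would enter through the outer vertex of `f`, which
      -- has just been used. Degree three alone does not exclude it.
      rintro p l' rfl hpx
      have h6 := fst_head_mem_of_mem_liftSet hL'
      have h7 := h.vert_nodup
      rw [List.map_append] at h7
      refine (List.nodup_append.1 h7).2.2 (x, φ.outer (portIdx att x f)) ?_ _ h6 ?_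
      · simp [piece]
      · rw [hpx]
    exact ⟨(x, f) :: l, ⟨he, hchain, List.nodup_cons.2 ⟨hx, hl.vert_nodup⟩, hen⟩,
      q, hq, L', hL', h5.symm⟩

/-- A long self-avoiding walk of the transformed graph is the lift of a self-avoiding walk, up to
short pieces at its two ends. -/
theorem exists_decomposition [Finite H] {F : Sym2 (V × H)} {L : List ((V × H) × Sym2 (V × H))}
    (h : IsMidSAW (localTransform G φ att) F L) (hlen : 2 * Nat.card H < L.length) :
    ∃ e l pre core suf, L = pre ++ core ++ suf ∧ endEdge F pre = liftEdge φ att e ∧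
      IsMidSAW G e l ∧ l ≠ [] ∧ core ∈ liftSet φ att e l ∧ pre.length ≤ Nat.card H ∧
      suf.length ≤ Nat.card H ∧ NearEdge φ att F e ∧
      NearEdge φ att (endEdge F L) (endEdge e l) := by
  -- A walk that leaves no gadget visits at most h vertices. Thus length above 2h forces an outer
  -- edge after the prefix, and the core is a lift of a walk with at least one step.
  have hshort : ∀ {F' L'}, IsMidSAW (localTransform G φ att) F' L' → (∀ r ∈ L', IsInner r) →
      L'.length ≤ Nat.card H := by
    intro F' L' h' hin
    by_cases hne : L' = []
    · simp [hne]
    · obtain ⟨p, _, hp⟩ := exists_gadget_of_inner h'.chain hne hin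
      exact length_le_of_fst_eq h'.vert_nodup fun r hr => (hp r hr).1
  obtain ⟨e, pre, rest, hL, he, hpre, hlp, hnear⟩ : ∃ e pre rest, L = pre ++ rest ∧
      e ∈ G.edgeSet ∧ endEdge F pre = liftEdge φ att e ∧ pre.length ≤ Nat.card H ∧
      NearEdge φ att F e := by
    rcases map_fst_mem_or h.edge_mem with ⟨x, hx⟩ | ⟨e, he, rfl⟩
    · rcases exists_first_outer h.chain with hin | ⟨pre, y, g, rest, rfl, hg, hin⟩
      · have := hshort h hin
        omega
      · have h1 := h.of_append.1
        have h2 := fst_eq_of_inner_prefix hx h1.chain hin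
        refine ⟨g, _, rest, rfl, hg, ?_, length_le_of_fst_eq h1.vert_nodup h2, Or.inr ⟨x, ?_, hx⟩⟩
        · rw [endEdge_append]; rfl
        · have h3 := h2 (y, liftEdge φ att g) (by simp)
          have h4 := (midChain_append.1 h1.chain).2.2.1
          have h5 := (mem_liftEdge.1 h4).1
          simp only at h3 h5
          rwa [h3] at h5
    · exact ⟨e, [], L, rfl, he, rfl, by simp, Or.inl rfl⟩
  subst hL
  have h1 := h.of_append.2
  rw [hpre] at h1
  rw [List.length_append] at hlen
  rcases exists_last_outer h1.chain with hin | ⟨core, y, t, suf, rfl, ht, hin⟩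
  · have := hshort h1 hin
    omega
  have hend : endEdge (liftEdge φ att e) (core ++ [(y, liftEdge φ att t)]) = liftEdge φ att t := by
    rw [endEdge_append]; rfl
  obtain ⟨l, hl, hmem⟩ := exists_mem_liftSet h1.of_append.1 he ht hend
  have h2 := h1.of_append.2
  have h3 := endEdge_liftSet hmem
  rw [hend] at h2 h3
  obtain rfl := liftEdge_injective h3
  refine ⟨e, l, pre, _, suf, by simp, hpre, hl, ?_, hmem, hlp, hshort h2 hin, hnear, ?_⟩
  · rintro rfl
    have h6 : core ++ [(y, liftEdge φ att (endEdge e []))] = [] := hmem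
    simp at h6
  · rw [endEdge_append, hpre, endEdge_append, hend]
    by_cases hne : suf = []
    · exact Or.inl (by rw [hne]; rfl)
    · obtain ⟨p, hp, hpr⟩ := exists_gadget_of_inner h2.chain hne hin
      refine Or.inr ⟨p.1, (mem_liftEdge.1 hp).1, ?_⟩
      have h7 := endEdge_mem (liftEdge φ att (endEdge e l)) suf
      rcases List.mem_cons.1 h7 with h7 | h7
      · have h8 := (List.nodup_cons.1 h2.edge_nodup).1
        obtain ⟨r, suf', rfl⟩ := List.exists_cons_of_ne_nil hne
        rw [← h7] at h8
        exact absurd (by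
          have := endEdge_mem r.2 suf'
          simpa using this) h8
      · obtain ⟨r, hr, hre⟩ := List.mem_map.1 h7
        rw [← hre]
        exact (hpr r hr).2

end Decompose

/-! ### Comparing sums over walks of the two graphs -/

section Compare

variable {V H : Type*} {G : SimpleGraph V} {φ : Gadget H}
  {att : ∀ x : V, G.neighborSet x ≃ Fin 3} {W : Set V}

/-- The pairs of a walk and one of its lifts inject into the walks of the transformed graph, since
the base walk can be read off by projection. Summing t^length over the lifts produces the power of
g(t). -/
theorem walkSum_le_walkSum_localTransform [Finite H] {t c : ℝ≥0∞} {F₀ : Sym2 V → Sym2 V → ℕ → ℝ≥0∞}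
    {F₁ : Sym2 (V × H) → Sym2 (V × H) → ℕ → ℝ≥0∞}
    (hF : ∀ e f n m, n ≤ m → m ≤ Nat.card H * n → (n ≠ 0 → e ≠ f) →
      F₀ e f n ≤ c * F₁ (liftEdge φ att e) (liftEdge φ att f) m) :
    walkSum G W (fun e f n => gadgetGF φ t ^ n * F₀ e f n) ≤
      c * walkSum (localTransform G φ att) (gadgetsOver H W) fun e f n => t ^ n * F₁ e f n := by
  have hinj : Function.Injective
      fun r : Σ p : ListSAW G W, liftSet φ att p.1.1 p.1.2 =>
        (⟨(liftEdge φ att r.1.1.1, r.2.1), isMidSAW_of_mem_liftSet r.1.2.1 r.2.2,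
          liftEdge_mem_incidentEdges r.1.2.2⟩ :
            ListSAW (localTransform G φ att) (gadgetsOver H W)) := by
    rintro ⟨⟨⟨e, l⟩, h⟩, L, hL⟩ ⟨⟨⟨e', l'⟩, h'⟩, L', hL'⟩ heq
    simp only [Subtype.mk.injEq, Prod.mk.injEq] at heq
    obtain ⟨h1, rfl⟩ := heq
    obtain rfl := liftEdge_injective h1
    obtain rfl : l = l' := (projSteps_of_mem_liftSet h.1.chain hL).symm.trans
      (projSteps_of_mem_liftSet h'.1.chain hL')
    rfl
  rw [walkSum, walkSum, ← ENNReal.tsum_mul_left]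
  refine le_trans ?_ (ENNReal.tsum_comp_le_tsum_of_injective hinj _)
  rw [ENNReal.tsum_sigma']
  refine ENNReal.tsum_le_tsum fun p => ?_
  rw [← tsum_liftSet p.2.1 (φ := φ) (att := att), ← ENNReal.tsum_mul_right]
  refine ENNReal.tsum_le_tsum fun L => ?_
  have hlen := length_liftSet L.2
  have hne : p.1.2.length ≠ 0 → p.1.1 ≠ endEdge p.1.1 p.1.2 := by
    obtain ⟨⟨e, l⟩, h⟩ := p
    cases l with
    | nil => simp
    | cons q l =>
      intro _ he
      have h1 := (List.nodup_cons.1 h.1.edge_nodup).1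
      rw [endEdge_cons] at he
      simp only at he
      rw [he] at h1
      exact h1 (endEdge_mem q.2 l)
  have := hF p.1.1 (endEdge p.1.1 p.1.2) _ _ hlen.1 hlen.2 hne
  simp only [endEdge_liftSet L.2]
  calc _ ≤ t ^ L.1.length * (c * _) := by gcongr
    _ = _ := by ring

/-- The constant that accounts for the choices of the two ends of a walk. -/
noncomputable def endsConst (H : Type*) : ℝ≥0∞ :=
  (∑ i ∈ Finset.range (Nat.card H + 1), (2 * (Nat.card H + 3)) ^ i : ℕ) ^ 2

theorem endsConst_ne_top : endsConst H ≠ ⊤ :=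
  ENNReal.pow_ne_top (ENNReal.natCast_ne_top _)

/-- A long walk is encoded by a base walk, a lift of it and two end pieces of at most h steps. The
encoding is injective, and the end pieces cost only a constant: their number and their powers of t
are bounded. -/
theorem walkSum_localTransform_le [Finite H] {t c : ℝ≥0∞} {F₀ : Sym2 V → Sym2 V → ℕ → ℝ≥0∞}
    {F₁ : Sym2 (V × H) → Sym2 (V × H) → ℕ → ℝ≥0∞}
    (hF : ∀ e f n e' f' m, e ∈ G.edgeSet → f ∈ G.edgeSet → e ≠ f → n ≠ 0 →
      NearEdge φ att e' e → NearEdge φ att f' f →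
      f' ∈ (localTransform G φ att).edgeSet →
      n ≤ m → m ≤ 3 * Nat.card H * n → 2 * Nat.card H < m → F₁ e' f' m ≤ c * F₀ e f n) :
    walkSum (localTransform G φ att) (gadgetsOver H W)
        (fun e f n => if n ≤ 2 * Nat.card H then 0 else t ^ n * F₁ e f n) ≤
      c * max 1 t ^ (2 * Nat.card H) * endsConst H *
        walkSum G W fun e f n => gadgetGF φ t ^ n * F₀ e f n := by
  set h := Nat.card H
  set G₁ := localTransform G φ att
  let J := Σ p : ListSAW G W, liftSet φ att p.1.1 p.1.2 ×
    (ShortChain G₁ (liftEdge φ att p.1.1) h ×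
      ShortChain G₁ (liftEdge φ att (endEdge p.1.1 p.1.2)) h)
  let I := {p : ListSAW G₁ (gadgetsOver H W) // ¬ p.1.2.length ≤ 2 * h}
  have hex : ∀ p : I, ∃ j : J,
      p.1.1.1 = endEdge (liftEdge φ att j.1.1.1) j.2.2.1.1 ∧
      p.1.1.2 = revSteps (liftEdge φ att j.1.1.1) j.2.2.1.1 ++ j.2.1.1 ++ j.2.2.2.1 ∧
      F₁ p.1.1.1 (endEdge p.1.1.1 p.1.1.2) p.1.1.2.length ≤
        c * F₀ j.1.1.1 (endEdge j.1.1.1 j.1.1.2) j.1.1.2.length := by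
    rintro ⟨⟨⟨F, L⟩, hL, hW⟩, hlen⟩
    change IsMidSAW G₁ F L at hL
    change F ∈ incidentEdges G₁ (gadgetsOver H W) at hW
    replace hlen : 2 * h < L.length := not_le.1 hlen
    obtain ⟨e, l, pre, core, suf, hdec, hpre, hl, hne, hcore, hlp, hls, hn1, hn2⟩ :=
      exists_decomposition hL hlen
    have hL' := hL
    rw [hdec, List.append_assoc] at hL'
    have hc1 := hL'.of_append.1
    have hc2 := hL'.of_append.2.of_append.2
    rw [hpre, endEdge_liftSet hcore] at hc2
    have hW' : e ∈ incidentEdges G W := hn1.mem_incidentEdges hl.edge_mem hW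
    have hr := hc1.chain.revSteps hc1.edge_mem
    rw [hpre] at hr
    -- The prefix is stored reversed, so that it starts at the lifted edge of `e` and its number of
    -- choices is controlled by the base walk alone. The starting edge `F` is recovered as its last
    -- edge.
    refine ⟨⟨⟨(e, l), hl, hW'⟩, ⟨core, hcore⟩, ⟨LocalSAW.revSteps F pre, hr, ?_⟩,
      ⟨suf, hc2.chain, hls⟩⟩, ?_, ?_, ?_⟩
    · rw [revSteps_length]; exact hlp
    · simp only
      rw [← hpre, endEdge_revSteps]
    · simp only
      rw [← hpre, revSteps_revSteps, hdec]
    · simp only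
      have hcl := length_liftSet hcore
      have hl0 : l.length ≠ 0 := fun h0 => hne (List.length_eq_zero_iff.1 h0)
      have hLl : L.length = pre.length + core.length + suf.length := by
        rw [hdec, List.length_append, List.length_append]
      have hef : e ≠ endEdge e l := by
        obtain ⟨q, l, rfl⟩ := List.exists_cons_of_ne_nil hne
        intro he
        have h1 := (List.nodup_cons.1 hl.edge_nodup).1
        rw [endEdge_cons] at he
        rw [he] at h1
        exact h1 (endEdge_mem q.2 l)
      refine hF _ _ _ _ _ _ hl.edge_mem (hl.chain.endEdge_mem hl.edge_mem) hef hl0 hn1 hn2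
        (hL.chain.endEdge_mem hL.edge_mem) (by omega) ?_ hlen
      -- The core has at most hn steps and the two ends together at most 2h ≤ 2hn. This is the
      -- source of the factor 3h.
      have h1 : h ≤ h * l.length := Nat.le_mul_of_pos_right h (Nat.pos_of_ne_zero hl0)
      have h2 : 3 * h * l.length = 3 * (h * l.length) := by ring
      have h3 := hcl.2
      change core.length ≤ h * l.length at h3
      omega
  choose Φ hΦ1 hΦ2 hΦ3 using hex
  have hinj : Function.Injective Φ := by
    intro p p' hp
    refine Subtype.ext (Subtype.ext (Prod.ext ?_ ?_))
    · rw [hΦ1, hΦ1, hp]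
    · rw [hΦ2, hΦ2, hp]
  -- The maximum with 1 makes the bound valid on both sides of t = 1.
  have hpow : ∀ k, k ≤ 2 * h → t ^ k ≤ max 1 t ^ (2 * h) := fun k hk =>
    (pow_le_pow_left₀ zero_le (le_max_right 1 t) k).trans
      (pow_le_pow_right₀ (le_max_left 1 t) hk)
  let g : J → ℝ≥0∞ := fun j => t ^ j.2.1.1.length * (c * max 1 t ^ (2 * h) *
    F₀ j.1.1.1 (endEdge j.1.1.1 j.1.1.2) j.1.1.2.length)
  have hstep1 : walkSum G₁ (gadgetsOver H W)
      (fun e f n => if n ≤ 2 * h then 0 else t ^ n * F₁ e f n) ≤ ∑' p : I, g (Φ p) := by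
    rw [walkSum]
    have h1 := tsum_subtype {p : ListSAW G₁ (gadgetsOver H W) | ¬ p.1.2.length ≤ 2 * h}
      fun p => t ^ p.1.2.length * F₁ p.1.1 (endEdge p.1.1 p.1.2) p.1.2.length
    refine le_trans (le_of_eq ?_) (h1.ge.trans (ENNReal.tsum_le_tsum fun p => ?_))
    · refine tsum_congr fun p => ?_
      by_cases hp : p.1.2.length ≤ 2 * h
      · simp [hp]
      · rw [if_neg hp, Set.indicator_of_mem (by exact hp)]
    · have h2 : p.1.1.2.length ≤ _ := (congrArg List.length (hΦ2 p)).le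
      have h3 := congrArg List.length (hΦ2 p)
      rw [List.length_append, List.length_append, revSteps_length] at h3
      have h4 := (Φ p).2.2.1.2.2
      have h5 := (Φ p).2.2.2.2.2
      have h6 : t ^ p.1.1.2.length ≤ t ^ (Φ p).2.1.1.length * max 1 t ^ (2 * h) := by
        rw [h3, show ∀ a b c : ℕ, a + b + c = b + (a + c) by intros; ring, pow_add]
        refine mul_le_mul' le_rfl (hpow _ ?_)
        omega
      calc _ ≤ (t ^ (Φ p).2.1.1.length * max 1 t ^ (2 * h)) * (c * _) :=
            mul_le_mul' h6 (hΦ3 p)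
        _ = g (Φ p) := by simp only [g]; ring
  refine hstep1.trans ((ENNReal.tsum_comp_le_tsum_of_injective hinj g).trans ?_)
  rw [ENNReal.tsum_sigma', walkSum, ← ENNReal.tsum_mul_left]
  refine ENNReal.tsum_le_tsum fun p => ?_
  have hdeg : DegreeBounded G₁ (h + 3) := degreeBounded_localTransform
  have hbound : ∀ C : ℝ≥0∞, ∑' _ : ShortChain G₁ (liftEdge φ att p.1.1) h ×
      ShortChain G₁ (liftEdge φ att (endEdge p.1.1 p.1.2)) h, C ≤ endsConst H * C := by
    intro C
    rw [ENNReal.tsum_prod (f := fun _ _ => C)]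
    refine (ENNReal.tsum_le_tsum fun _ => hdeg.tsum_shortChain _ h C).trans ?_
    refine (hdeg.tsum_shortChain _ h _).trans (le_of_eq ?_)
    rw [endsConst, sq, mul_assoc]
  set A := c * max 1 t ^ (2 * h) * F₀ p.1.1 (endEdge p.1.1 p.1.2) p.1.2.length with hA
  have h1 : ∑' j : liftSet φ att p.1.1 p.1.2 × (ShortChain G₁ (liftEdge φ att p.1.1) h ×
      ShortChain G₁ (liftEdge φ att (endEdge p.1.1 p.1.2)) h), g ⟨p, j⟩ =
      ∑' L : liftSet φ att p.1.1 p.1.2, ∑' _ : ShortChain G₁ (liftEdge φ att p.1.1) h ×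
        ShortChain G₁ (liftEdge φ att (endEdge p.1.1 p.1.2)) h, t ^ L.1.length * A :=
    ENNReal.tsum_prod (f := fun (L : liftSet φ att p.1.1 p.1.2)
      (_ : ShortChain G₁ (liftEdge φ att p.1.1) h ×
        ShortChain G₁ (liftEdge φ att (endEdge p.1.1 p.1.2)) h) => t ^ L.1.length * A)
  rw [h1]
  refine (ENNReal.tsum_le_tsum fun L => hbound _).trans (le_of_eq ?_)
  rw [ENNReal.tsum_mul_left, ENNReal.tsum_mul_right, tsum_liftSet p.2.1, hA]
  ring

end Compare

/-! ### Polynomial weights -/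

theorem exists_rpow_ratio_bound (y : ℝ) (K : ℕ) : ∃ C : ℝ, 1 ≤ C ∧ ∀ n m : ℕ, 1 ≤ n → n ≤ m →
    m ≤ K * n → (m : ℝ) ^ y ≤ C * (n : ℝ) ^ y ∧ (n : ℝ) ^ y ≤ C * (m : ℝ) ^ y := by
  have hK : (1 : ℝ) ≤ max 1 (K : ℝ) := le_max_left _ _
  refine ⟨max 1 (K : ℝ) ^ |y|, Real.one_le_rpow hK (abs_nonneg y), fun n m h1 h2 h3 => ?_⟩
  have hn : (0 : ℝ) < n := by exact_mod_cast h1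
  have hnm : (n : ℝ) ≤ m := by exact_mod_cast h2
  have hm : (0 : ℝ) < m := hn.trans_le hnm
  have hC : 1 ≤ max 1 (K : ℝ) ^ |y| := Real.one_le_rpow hK (abs_nonneg y)
  have hmK : (m : ℝ) ≤ max 1 (K : ℝ) * n :=
    le_trans (by exact_mod_cast h3) (mul_le_mul_of_nonneg_right (le_max_right _ _) hn.le)
  rcases le_total 0 y with hy | hy
  · rw [abs_of_nonneg hy] at hC ⊢
    constructor
    · rw [← Real.mul_rpow (by linarith) hn.le]
      exact Real.rpow_le_rpow hm.le hmK hy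
    · exact (Real.rpow_le_rpow hn.le hnm hy).trans
        (le_mul_of_one_le_left (Real.rpow_nonneg hm.le y) hC)
  · rw [abs_of_nonpos hy] at hC ⊢
    constructor
    · exact (Real.rpow_le_rpow_of_nonpos hn hnm hy).trans
        (le_mul_of_one_le_left (Real.rpow_nonneg hn.le y) hC)
    · have h4 := Real.rpow_le_rpow hm.le hmK (neg_nonneg.2 hy)
      rw [Real.mul_rpow (by linarith) hn.le, Real.rpow_neg hm.le, Real.rpow_neg hn.le] at h4
      have hny := Real.rpow_pos_of_pos hn y
      have hmy := Real.rpow_pos_of_pos hm y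
      rw [← div_eq_mul_inv, le_div_iff₀ hny, inv_mul_le_iff₀ hmy] at h4
      linarith

theorem natCast_rpow_eq_ofReal {n : ℕ} (hn : 1 ≤ n) (y : ℝ) :
    (n : ℝ≥0∞) ^ y = ENNReal.ofReal ((n : ℝ) ^ y) := by
  rw [← ENNReal.ofReal_rpow_of_pos (by exact_mod_cast hn), ENNReal.ofReal_natCast]

theorem exists_ennreal_rpow_ratio_bound (y : ℝ) (K : ℕ) : ∃ C : ℝ≥0∞, C ≠ 0 ∧ C ≠ ⊤ ∧
    ∀ n m : ℕ, 1 ≤ n → n ≤ m → m ≤ K * n →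
      (m : ℝ≥0∞) ^ y ≤ C * (n : ℝ≥0∞) ^ y ∧ (n : ℝ≥0∞) ^ y ≤ C * (m : ℝ≥0∞) ^ y := by
  obtain ⟨C, hC, h⟩ := exists_rpow_ratio_bound y K
  have hC0 : 0 < C := by linarith
  refine ⟨ENNReal.ofReal C, by simpa using hC0, ENNReal.ofReal_ne_top, fun n m h1 h2 h3 => ?_⟩
  rw [natCast_rpow_eq_ofReal h1, natCast_rpow_eq_ofReal (h1.trans h2),
    ← ENNReal.ofReal_mul hC0.le, ← ENNReal.ofReal_mul hC0.le]
  exact ⟨ENNReal.ofReal_le_ofReal (h n m h1 h2 h3).1, ENNReal.ofReal_le_ofReal (h n m h1 h2 h3).2⟩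

/-! ### The critical points of the two graphs -/

section Critical

variable {V H : Type*} [Finite H] {G : SimpleGraph V} {φ : Gadget H}
  {att : ∀ x : V, G.neighborSet x ≃ Fin 3} {W : Set V}

theorem exists_real_between {a : ℝ} {b : ℝ≥0∞} (h : ENNReal.ofReal a < b) :
    ∃ y : ℝ, a < y ∧ ENNReal.ofReal y ≤ b := by
  obtain ⟨c, h1, h2⟩ := ENNReal.lt_iff_exists_nnreal_btwn.1 h
  refine ⟨c, ?_, by simpa using h2.le⟩
  rw [← ENNReal.ofReal_coe_nnreal] at h1
  by_contra hle
  exact absurd h1 (not_lt.2 (ENNReal.ofReal_le_ofReal (not_lt.1 hle)))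

/-- The walks of length at most 2h, which need not decompose, are finitely many and have finite
weights. -/
theorem walkSum_lt_top_iff {t c₀ c₁ : ℝ≥0∞} (ht : t ≠ ⊤) (hc₀ : c₀ ≠ ⊤) (hc₁ : c₁ ≠ ⊤)
    (hW : (gadgetsOver H W).Finite) {F₀ : Sym2 V → Sym2 V → ℕ → ℝ≥0∞}
    {F₁ : Sym2 (V × H) → Sym2 (V × H) → ℕ → ℝ≥0∞} (hF₁ : ∀ e f n, F₁ e f n ≠ ⊤)
    (hlow : ∀ e f n m, n ≤ m → m ≤ Nat.card H * n → (n ≠ 0 → e ≠ f) →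
      F₀ e f n ≤ c₀ * F₁ (liftEdge φ att e) (liftEdge φ att f) m)
    (hup : ∀ e f n e' f' m, e ∈ G.edgeSet → f ∈ G.edgeSet → e ≠ f → n ≠ 0 →
      NearEdge φ att e' e → NearEdge φ att f' f →
      f' ∈ (localTransform G φ att).edgeSet →
      n ≤ m → m ≤ 3 * Nat.card H * n → 2 * Nat.card H < m → F₁ e' f' m ≤ c₁ * F₀ e f n) :
    walkSum (localTransform G φ att) (gadgetsOver H W) (fun e f n => t ^ n * F₁ e f n) < ⊤ ↔
      walkSum G W (fun e f n => gadgetGF φ t ^ n * F₀ e f n) < ⊤ := by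
  constructor
  · intro h
    exact (walkSum_le_walkSum_localTransform hlow).trans_lt
      (ENNReal.mul_lt_top hc₀.lt_top h)
  · intro h
    have hsplit : (fun (e f : Sym2 (V × H)) n => t ^ n * F₁ e f n) =
        fun e f n => (if n ≤ 2 * Nat.card H then t ^ n * F₁ e f n else 0) +
          (if n ≤ 2 * Nat.card H then 0 else t ^ n * F₁ e f n) := by
      funext e f n
      split_ifs <;> simp
    rw [hsplit, walkSum_add]
    refine ENNReal.add_lt_top.2 ⟨?_, ?_⟩
    · exact degreeBounded_localTransform.walkSum_short_lt_top hW _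
        fun e f n => ENNReal.mul_ne_top (ENNReal.pow_ne_top ht) (hF₁ e f n)
    · refine (walkSum_localTransform_le hup).trans_lt (ENNReal.mul_lt_top ?_ h)
      refine ENNReal.mul_lt_top (ENNReal.mul_lt_top hc₁.lt_top ?_) endsConst_ne_top.lt_top
      exact (ENNReal.pow_ne_top (max_lt ENNReal.one_lt_top ht.lt_top).ne).lt_top

theorem walkSum_pow_lt_top_iff {t : ℝ≥0∞} (ht : t ≠ ⊤) (hW : (gadgetsOver H W).Finite) :
    walkSum (localTransform G φ att) (gadgetsOver H W) (fun _ _ n => t ^ n) < ⊤ ↔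
      walkSum G W (fun _ _ n => gadgetGF φ t ^ n) < ⊤ := by
  have := walkSum_lt_top_iff (G := G) (φ := φ) (att := att) (W := W) (F₀ := fun _ _ _ => 1)
    (F₁ := fun _ _ _ => 1) ht ENNReal.one_ne_top ENNReal.one_ne_top hW
    (fun _ _ _ => ENNReal.one_ne_top) (fun _ _ _ _ _ _ _ => by simp)
    (fun _ _ _ _ _ _ _ _ _ _ _ _ _ _ _ _ => by simp)
  simpa only [mul_one] using this

variable [Infinite V]

/-- The gadget maps the critical point of the transformed graph to that of the graph. -/
theorem gadgetGF_inv_connectiveConstant (hG : G.Connected) (hW : IsFundamentalDomain G W)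
    (hW₁ : IsFundamentalDomain (localTransform G φ att) (gadgetsOver H W)) :
    gadgetGF φ (ENNReal.ofReal (connectiveConstant (localTransform G φ att))⁻¹) =
      ENNReal.ofReal (connectiveConstant G)⁻¹ := by
  have : Nonempty H := ⟨φ.outer 0⟩
  have hG₁ := connected_localTransform (φ := φ) (att := att) hG
  have hΔ := degreeBounded_three att
  have hΔ₁ := degreeBounded_localTransform (φ := φ) (att := att)
  obtain ⟨h1, -⟩ := connectiveConstant_spec hG₁ hΔ₁ hW₁
  set μ₁ := connectiveConstant (localTransform G φ att)
  have hμ : 0 < μ₁⁻¹ := inv_pos.2 (by linarith)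
  have hcont : Continuous fun x : ℝ => gadgetGF φ (ENNReal.ofReal x) :=
    (continuous_gadgetGF φ).comp ENNReal.continuous_ofReal
  have hmono : ∀ {s t : ℝ≥0∞}, s ≤ t →
      walkSum G W (fun _ _ n => s ^ n) ≤ walkSum G W (fun _ _ n => t ^ n) := fun hst =>
    walkSum_mono fun _ _ _ _ => pow_le_pow_left₀ zero_le hst _
  refine le_antisymm ?_ ?_
  -- Below its critical point the series of the transformed graph converges, hence so does the
  -- original series at g(x), and g(x) cannot exceed the original critical point. Then x increases
  -- to μ₁⁻¹; the other inequality comes from above in the same way.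
  · refine le_of_tendsto (hcont.tendsto μ₁⁻¹ |>.mono_left nhdsWithin_le_nhds)
      (?_ : ∀ᶠ x in 𝓝[<] μ₁⁻¹, _)
    filter_upwards [self_mem_nhdsWithin, mem_nhdsWithin_of_mem_nhds (Ioi_mem_nhds hμ)] with x hx hx0
    by_contra hlt
    obtain ⟨y, hy1, hy2⟩ := exists_real_between (not_le.1 hlt)
    have h2 := walkSum_pow_lt_top hG₁ hΔ₁ hW₁ (le_of_lt hx0) hx
    rw [walkSum_pow_lt_top_iff ENNReal.ofReal_ne_top hW₁.finite] at h2
    exact absurd ((hmono hy2).trans_lt h2) (by rw [walkSum_pow_eq_top hG hΔ hW hy1]; simp)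
  · refine ge_of_tendsto (hcont.tendsto μ₁⁻¹ |>.mono_left nhdsWithin_le_nhds)
      (?_ : ∀ᶠ x in 𝓝[>] μ₁⁻¹, _)
    filter_upwards [self_mem_nhdsWithin] with x hx
    by_contra hlt
    have hlt' := not_le.1 hlt
    have hne : gadgetGF φ (ENNReal.ofReal x) ≠ ⊤ := (hlt'.trans_le le_top).ne
    have h2 := walkSum_pow_eq_top hG₁ hΔ₁ hW₁ hx
    have h3 : ¬ walkSum G W (fun _ _ n => gadgetGF φ (ENNReal.ofReal x) ^ n) < ⊤ := by
      rw [← walkSum_pow_lt_top_iff (att := att) ENNReal.ofReal_ne_top hW₁.finite, h2]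
      simp
    refine h3 ?_
    have h4 := walkSum_pow_lt_top hG hΔ hW
      (x := (gadgetGF φ (ENNReal.ofReal x)).toReal) ENNReal.toReal_nonneg
      ((ENNReal.lt_ofReal_iff_toReal_lt hne).1 hlt')
    rwa [ENNReal.ofReal_toReal hne] at h4

end Critical

/-! ### The exponents `γ` and `ν` -/

section GammaNu

variable {V H : Type*} {G : SimpleGraph V} {φ : Gadget H}
  {att : ∀ x : V, G.neighborSet x ≃ Fin 3} {W : Set V}

/-- This is the comparison at the two critical points in the form common to both exponents: γ uses D
= 1 and k = 1, ν uses the squared displacement and k = 0. -/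
theorem weighted_walkSum_lt_top_iff [Finite H] [Infinite V] (hG : G.Connected) (hW : IsFundamentalDomain G W)
    (hW₁ : IsFundamentalDomain (localTransform G φ att) (gadgetsOver H W))
    {g₀ g₁ : ℕ → ℝ} {C : ℝ} (hC : 1 ≤ C) (hg : ∀ n m, 1 ≤ n → n ≤ m → m ≤ 3 * Nat.card H * n →
      g₀ n ≤ C * g₁ m ∧ g₁ m ≤ C * g₀ n)
    {D₀ : Sym2 V → Sym2 V → ℕ} {D₁ : Sym2 (V × H) → Sym2 (V × H) → ℕ} {B k : ℕ}
    (hD₀ : ∀ e f, e ≠ f → D₀ e f ≤ D₁ (liftEdge φ att e) (liftEdge φ att f))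
    (hD₁ : ∀ e f e' f', e ∈ G.edgeSet → f ∈ G.edgeSet → e ≠ f → NearEdge φ att e' e →
      NearEdge φ att f' f → D₁ e' f' ≤ B * D₀ e f) :
    walkSum (localTransform G φ att) (gadgetsOver H W) (fun e f n =>
        ENNReal.ofReal (connectiveConstant (localTransform G φ att))⁻¹ ^ n *
          (if n = 0 then (k : ℝ≥0∞) else D₁ e f * ENNReal.ofReal (g₁ n))) < ⊤ ↔
      walkSum G W (fun e f n => ENNReal.ofReal (connectiveConstant G)⁻¹ ^ n *
          (if n = 0 then (k : ℝ≥0∞) else D₀ e f * ENNReal.ofReal (g₀ n))) < ⊤ := by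
  have hC0 : 0 ≤ C := by linarith
  rw [← gadgetGF_inv_connectiveConstant hG hW hW₁]
  refine walkSum_lt_top_iff (c₀ := ENNReal.ofReal C) (c₁ := B * ENNReal.ofReal C)
    (F₀ := fun e f n => if n = 0 then (k : ℝ≥0∞) else D₀ e f * ENNReal.ofReal (g₀ n))
    (F₁ := fun e f n => if n = 0 then (k : ℝ≥0∞) else D₁ e f * ENNReal.ofReal (g₁ n))
    ENNReal.ofReal_ne_top ENNReal.ofReal_ne_top
    (ENNReal.mul_ne_top (ENNReal.natCast_ne_top _) ENNReal.ofReal_ne_top) hW₁.finite ?_ ?_ ?_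
  · intro e f n
    split_ifs
    · exact ENNReal.natCast_ne_top _
    · exact ENNReal.mul_ne_top (ENNReal.natCast_ne_top _) ENNReal.ofReal_ne_top
  · intro e f n m h1 h2 hne
    by_cases hn : n = 0
    · subst hn
      obtain rfl : m = 0 := by simpa using h2
      simp only [if_true]
      exact le_mul_of_one_le_left zero_le (by simpa using hC)
    · have hm : m ≠ 0 := by omega
      simp only [if_neg hn, if_neg hm]
      have h3 : m ≤ 3 * Nat.card H * n := by
        rw [mul_assoc]; omega
      have h4 := (hg n m (Nat.one_le_iff_ne_zero.2 hn) h1 h3).1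
      calc (D₀ e f : ℝ≥0∞) * ENNReal.ofReal (g₀ n)
          ≤ D₁ (liftEdge φ att e) (liftEdge φ att f) * ENNReal.ofReal (C * g₁ m) :=
            mul_le_mul' (by exact_mod_cast hD₀ e f (hne hn)) (ENNReal.ofReal_le_ofReal h4)
        _ = _ := by rw [ENNReal.ofReal_mul hC0]; ring
  · intro e f n e' f' m he hf hef hn he' hf' _ h1 h2 _
    have hm : m ≠ 0 := by omega
    simp only [if_neg hn, if_neg hm]
    have h4 := (hg n m (Nat.one_le_iff_ne_zero.2 hn) h1 h2).2
    calc (D₁ e' f' : ℝ≥0∞) * ENNReal.ofReal (g₁ m)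
        ≤ (B * D₀ e f : ℝ≥0∞) * ENNReal.ofReal (C * g₀ n) :=
          mul_le_mul' (by exact_mod_cast hD₁ e f e' f' he hf hef he' hf')
            (ENNReal.ofReal_le_ofReal h4)
      _ = _ := by rw [ENNReal.ofReal_mul hC0]; ring

theorem seriesY_eq {x : ℝ} (hx : 0 ≤ x) (y : ℝ) :
    seriesY G W x y = walkSum G W fun _ _ n => ENNReal.ofReal x ^ n *
      (if n = 0 then ((1 : ℕ) : ℝ≥0∞) else (1 : ℕ) * ENNReal.ofReal (((n : ℝ) ^ y)⁻¹)) := by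
  rw [seriesY_eq_walkSum]
  congr 1
  funext _ _ n
  split_ifs with hn
  · simp [hn]
  · rw [div_eq_mul_inv, ENNReal.ofReal_mul (pow_nonneg hx n), ENNReal.ofReal_pow hx]
    simp

theorem gammaExp_localTransform [Finite H] [Infinite V] (hG : G.Connected) (hW : IsFundamentalDomain G W)
    (hW₁ : IsFundamentalDomain (localTransform G φ att) (gadgetsOver H W)) :
    gammaExp (localTransform G φ att) (gadgetsOver H W) = gammaExp G W := by
  have : Nonempty H := ⟨φ.outer 0⟩
  have hμ := (connectiveConstant_spec hG (degreeBounded_three att) hW).1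
  have hμ₁ := (connectiveConstant_spec (connected_localTransform (φ := φ) (att := att) hG)
    degreeBounded_localTransform hW₁).1
  rw [gammaExp, gammaExp, criticalIndex, criticalIndex]
  congr 2
  ext y
  change seriesY _ _ _ y < ⊤ ↔ seriesY _ _ _ y < ⊤
  rw [seriesY_eq (inv_nonneg.2 (by linarith)), seriesY_eq (inv_nonneg.2 (by linarith))]
  obtain ⟨C, hC, h⟩ := exists_rpow_ratio_bound y (3 * Nat.card H)
  refine weighted_walkSum_lt_top_iff hG hW hW₁ (D₀ := fun _ _ => 1) (D₁ := fun _ _ => 1)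
    (B := 1) hC (fun n m h1 h2 h3 => ?_) (fun _ _ _ => le_rfl) (fun _ _ _ _ _ _ _ _ _ => le_rfl)
  have hn := Real.rpow_pos_of_pos (by exact_mod_cast h1 : (0 : ℝ) < n) y
  have hm := Real.rpow_pos_of_pos (by exact_mod_cast h1.trans h2 : (0 : ℝ) < m) y
  obtain ⟨h4, h5⟩ := h n m h1 h2 h3
  constructor
  · rw [inv_le_iff_one_le_mul₀ hn, mul_assoc, mul_comm, mul_assoc, ← div_eq_inv_mul,
      le_div_iff₀ hm]
    linarith
  · rw [inv_le_iff_one_le_mul₀ hm, mul_assoc, mul_comm, mul_assoc, ← div_eq_inv_mul,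
      le_div_iff₀ hn]
    linarith

/-- Extracting μ^{-n} puts V at the critical point. The remaining factor μ^n/σ_n is, under the
assumed asymptotics, of order n^{1-γ}/L(n) and so varies slowly enough to be compared. -/
theorem seriesV_eq (hμ : 1 ≤ connectiveConstant G) (hσ : ∀ n, 1 ≤ n → 0 < sawCount G W n) (z : ℝ) :
    seriesV G W z = walkSum G W fun e f n =>
      ENNReal.ofReal (connectiveConstant G)⁻¹ ^ n * (if n = 0 then ((0 : ℕ) : ℝ≥0∞) else
        ((midEdgeDist G e f ^ 2 : ℕ) : ℝ≥0∞) * ENNReal.ofReal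
          (connectiveConstant G ^ n / (sawCount G W n * (n : ℝ) ^ (2 * z + 1)))) := by
  have hμ0 : 0 < connectiveConstant G := by linarith
  rw [seriesV_eq_walkSum]
  congr 1
  funext e f n
  split_ifs with hn
  · simp
  · have hn1 := Nat.one_le_iff_ne_zero.2 hn
    have hs : (0 : ℝ) < sawCount G W n := by exact_mod_cast hσ n hn1
    have hp := Real.rpow_pos_of_pos (by exact_mod_cast hn1 : (0 : ℝ) < n) (2 * z + 1)
    rw [natCast_rpow_eq_ofReal hn1, ← ENNReal.ofReal_pow (inv_nonneg.2 hμ0.le), mul_left_comm,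
      ← ENNReal.ofReal_mul (by positivity), inv_pow, ← mul_div_assoc,
      inv_mul_cancel₀ (by positivity), div_eq_mul_inv, div_eq_mul_inv, mul_assoc,
      ← ENNReal.ofReal_natCast (sawCount G W n), ← ENNReal.ofReal_inv_of_pos hs,
      ← ENNReal.ofReal_inv_of_pos hp, ← ENNReal.ofReal_mul (by positivity), one_div, mul_inv]
    push_cast
    rfl

theorem sawCount_pos_of_hasSlowCorrection {L : ℝ → ℝ} (hL : SlowlyVarying L)
    (hμ : 1 ≤ connectiveConstant G) (h : HasSlowCorrection G W L) :
    ∀ n, 1 ≤ n → 0 < sawCount G W n := by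
  obtain ⟨C₁, C₂, h1, h2, h⟩ := h
  intro n hn
  have hn0 : (0 : ℝ) < n := by exact_mod_cast hn
  have h3 := hL.pos n hn0
  have h4 : 0 < connectiveConstant G := by linarith
  have h5 := Real.rpow_pos_of_pos hn0 ((gammaExp G W).toReal - 1)
  have h6 : (0 : ℝ) < sawCount G W n := lt_of_lt_of_le (by positivity) (h n hn).1
  exact_mod_cast h6

theorem weight_bounds {C₁ C₂ l a p s m : ℝ} (h1 : 0 < C₁) (h2 : 0 < C₂) (hl : 0 < l) (ha : 0 < a)
    (hp : 0 < p) (hm : 0 < m) (hs1 : C₁ * l * a * m ≤ s) (hs2 : s ≤ C₂ * l * a * m) :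
    C₂⁻¹ * (l * a * p)⁻¹ ≤ m / (s * p) ∧ m / (s * p) ≤ C₁⁻¹ * (l * a * p)⁻¹ := by
  have hs : 0 < s := lt_of_lt_of_le (by positivity) hs1
  rw [← mul_inv, ← mul_inv, ← one_div, ← one_div, div_le_div_iff₀ (by positivity) (by positivity),
    div_le_div_iff₀ (by positivity) (by positivity)]
  constructor <;> nlinarith

theorem nuExp_localTransform [Finite H] [Infinite V] (hG : G.Connected) (hW : IsFundamentalDomain G W)
    (hW₁ : IsFundamentalDomain (localTransform G φ att) (gadgetsOver H W)) {L : ℝ → ℝ}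
    (hL : SlowlyVarying L) (h₀ : HasSlowCorrection G W L)
    (h₁ : HasSlowCorrection (localTransform G φ att) (gadgetsOver H W) L) :
    nuExp (localTransform G φ att) (gadgetsOver H W) = nuExp G W := by
  have : Nonempty H := ⟨φ.outer 0⟩
  have hμ := (connectiveConstant_spec hG (degreeBounded_three att) hW).1
  have hμ₁ := (connectiveConstant_spec (connected_localTransform (φ := φ) (att := att) hG)
    degreeBounded_localTransform hW₁).1
  rw [nuExp, nuExp, criticalIndex, criticalIndex]
  congr 2
  ext z
  change seriesV _ _ z < ⊤ ↔ seriesV _ _ z < ⊤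
  rw [seriesV_eq hμ₁ (sawCount_pos_of_hasSlowCorrection hL hμ₁ h₁),
    seriesV_eq hμ (sawCount_pos_of_hasSlowCorrection hL hμ h₀)]
  obtain ⟨A₁, A₂, hA₁, hA₂, hA⟩ := h₀
  obtain ⟨B₁, B₂, hB₁, hB₂, hB⟩ := h₁
  -- Equality of the two values of γ makes both counts carry the same power of n.
  rw [gammaExp_localTransform hG hW hW₁] at hB
  set a := (gammaExp G W).toReal - 1
  obtain ⟨C, hC, hLC⟩ := hL.exists_ratio_bound (3 * Nat.card H)
  obtain ⟨C', hC', haC⟩ := exists_rpow_ratio_bound a (3 * Nat.card H)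
  obtain ⟨C'', hC'', hzC⟩ := exists_rpow_ratio_bound (2 * z + 1) (3 * Nat.card H)
  have hC'0 : 0 < C' := by linarith
  have hC''0 : 0 < C'' := by linarith
  -- The two ratios serve the two directions of the comparison. The factors C, C', C'' compare L,
  -- n^{γ-1} and n^{2z+1} at n and m.
  set E := C * C' * C'' * (B₂ / A₁ + A₂ / B₁)
  have hE : 0 < E := by positivity
  refine weighted_walkSum_lt_top_iff hG hW hW₁ (C := 1 + E)
    (g₀ := fun n => connectiveConstant G ^ n / (sawCount G W n * (n : ℝ) ^ (2 * z + 1)))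
    (g₁ := fun n => connectiveConstant (localTransform G φ att) ^ n /
      (sawCount (localTransform G φ att) (gadgetsOver H W) n * (n : ℝ) ^ (2 * z + 1)))
    (D₀ := fun e f => midEdgeDist G e f ^ 2)
    (D₁ := fun e f => midEdgeDist (localTransform G φ att) e f ^ 2)
    (B := (3 * (Nat.card H + 1)) ^ 2) (by linarith) (fun n m h1 h2 h3 => ?_)
    (fun e f hef => Nat.pow_le_pow_left (midEdgeDist_le_midEdgeDist_liftEdge hG hef) 2)
    (fun e f e' f' he hf hef he' hf' => ?_)
  swap
  · rw [← mul_pow]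
    exact Nat.pow_le_pow_left (midEdgeDist_le_of_nearEdge hG he hf hef he' hf') 2
  have hn0 : (0 : ℝ) < n := by exact_mod_cast h1
  have hm0 : (0 : ℝ) < m := by exact_mod_cast h1.trans h2
  have hLn := hL.pos n hn0
  have hLm := hL.pos m hm0
  have han := Real.rpow_pos_of_pos hn0 a
  have ham := Real.rpow_pos_of_pos hm0 a
  have hpn := Real.rpow_pos_of_pos hn0 (2 * z + 1)
  have hpm := Real.rpow_pos_of_pos hm0 (2 * z + 1)
  obtain ⟨b1, b2⟩ := weight_bounds hA₁ hA₂ hLn han hpn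
    (pow_pos (by linarith : 0 < connectiveConstant G) n) (hA n h1).1 (hA n h1).2
  obtain ⟨b3, b4⟩ := weight_bounds hB₁ hB₂ hLm ham hpm
    (pow_pos (by linarith : 0 < connectiveConstant (localTransform G φ att)) m)
    (hB m (h1.trans h2)).1 (hB m (h1.trans h2)).2
  obtain ⟨l1, l2⟩ := hLC n m h1 h2 h3
  obtain ⟨l3, l4⟩ := haC n m h1 h2 h3
  obtain ⟨l5, l6⟩ := hzC n m h1 h2 h3
  set u := L n * (n : ℝ) ^ a * (n : ℝ) ^ (2 * z + 1) with hu
  set v := L m * (m : ℝ) ^ a * (m : ℝ) ^ (2 * z + 1) with hv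
  have hu0 : 0 < u := by positivity
  have hv0 : 0 < v := by positivity
  have huv : u ≤ C * C' * C'' * v := by
    calc u ≤ (C * L m) * (C' * (m : ℝ) ^ a) * (C'' * (m : ℝ) ^ (2 * z + 1)) := by
          rw [hu]; gcongr
      _ = C * C' * C'' * v := by rw [hv]; ring
  have hvu : v ≤ C * C' * C'' * u := by
    calc v ≤ (C * L n) * (C' * (n : ℝ) ^ a) * (C'' * (n : ℝ) ^ (2 * z + 1)) := by
          rw [hv]; gcongr
      _ = C * C' * C'' * u := by rw [hu]; ring
  have inv_bound : ∀ {r s : ℝ}, 0 < r → 0 < s → s ≤ C * C' * C'' * r →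
      r⁻¹ ≤ C * C' * C'' * s⁻¹ := by
    intro r s hr hs h
    rw [← div_eq_mul_inv, le_div_iff₀ hs, inv_mul_le_iff₀ hr]
    linarith
  constructor
  · have hw : 0 ≤ B₂⁻¹ * v⁻¹ := by positivity
    have hX : E * (B₂⁻¹ * v⁻¹) = A₁⁻¹ * (C * C' * C'' * v⁻¹) +
        C * C' * C'' * (A₂ / B₁) * (B₂⁻¹ * v⁻¹) := by
      simp only [E]; field_simp
    have hY : 0 ≤ C * C' * C'' * (A₂ / B₁) * (B₂⁻¹ * v⁻¹) := by positivity
    have h5 := mul_le_mul_of_nonneg_left (inv_bound hu0 hv0 hvu) (inv_nonneg.2 hA₁.le)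
    have h6 := mul_le_mul_of_nonneg_left b3 hE.le
    have h7 := hw.trans b3
    linarith
  · have hw : 0 ≤ A₂⁻¹ * u⁻¹ := by positivity
    have hX : E * (A₂⁻¹ * u⁻¹) = B₁⁻¹ * (C * C' * C'' * u⁻¹) +
        C * C' * C'' * (B₂ / A₁) * (A₂⁻¹ * u⁻¹) := by
      simp only [E]; field_simp; ring
    have hY : 0 ≤ C * C' * C'' * (B₂ / A₁) * (A₂⁻¹ * u⁻¹) := by positivity
    have h5 := mul_le_mul_of_nonneg_left (inv_bound hv0 hu0 huv) (inv_nonneg.2 hB₁.le)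
    have h6 := mul_le_mul_of_nonneg_left b1 hE.le
    have h7 := hw.trans b1
    linarith

end GammaNu

/-! ### The exponent `η` -/

section Eta

variable {V H : Type*} {G : SimpleGraph V} {φ : Gadget H}
  {att : ∀ x : V, G.neighborSet x ≃ Fin 3} {W : Set V}

theorem MidChain.dist_le (hG : G.Connected) {e : Sym2 V} {l : List (V × Sym2 V)}
    (h : MidChain G e l) (he : e ∈ G.edgeSet) {x y : V} (hx : x ∈ e) (hy : y ∈ endEdge e l) :
    G.dist x y ≤ l.length + 1 := by
  induction l generalizing e x with
  | nil => exact (dist_le_one_of_mem he hx hy).trans (Nat.le_add_left _ _)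
  | cons p l ih =>
    have h1 := dist_le_one_of_mem he hx h.1
    have h2 := ih h.2.2.2 h.2.2.1 h.2.1 hy
    have h3 := hG.dist_triangle (u := x) (v := p.1) (w := y)
    rw [List.length_cons]
    omega

theorem dist_iso (hG : G.Connected) (α : G ≃g G) (x y : V) : G.dist (α x) (α y) = G.dist x y := by
  have key : ∀ (α : G ≃g G) (x y : V), G.dist (α x) (α y) ≤ G.dist x y := by
    intro α x y
    obtain ⟨p, hp⟩ := hG.exists_walk_length_eq_dist x y
    rw [← hp]
    exact (SimpleGraph.dist_le (p.map α.toHom)).trans (SimpleGraph.Walk.length_map _ _).le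
  refine le_antisymm (key α x y) ?_
  simpa using key α.symm (α x) (α y)

/-- There are automorphisms that move a fundamental domain arbitrarily far. -/
theorem exists_tendsto_setDist [Infinite V] {Δ : ℕ} (hΔ : DegreeBounded G Δ) (hG : G.Connected)
    (hW : IsFundamentalDomain G W) :
    ∃ α : ℕ → (G ≃g G), Tendsto (fun k => setDist G W (α k '' W)) atTop atTop := by
  obtain ⟨w₀, hw₀⟩ := hW.nonempty
  obtain ⟨D, hD⟩ : ∃ D, ∀ a ∈ W, ∀ b ∈ W, G.dist a b ≤ D := by
    obtain ⟨D, hD⟩ := ((hW.finite.prod hW.finite).image fun p => G.dist p.1 p.2).bddAbove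
    exact ⟨D, fun a ha b hb => hD ⟨(a, b), ⟨ha, hb⟩, rfl⟩⟩
  have hfar : ∀ k : ℕ, ∃ α : G ≃g G, k ≤ setDist G W (α '' W) := by
    intro k
    -- The loss 2D covers the diameter of `W` at `w₀` and that of its image, which contains `y`.
    obtain ⟨y, hy⟩ := exists_le_dist hΔ hG w₀ (k + 2 * D)
    obtain ⟨α, hα⟩ := hW.exists_mem y
    refine ⟨α.symm, ?_⟩
    obtain ⟨a, ha, _, ⟨b, hb, rfl⟩, hab⟩ :=
      exists_eq_setDist (G := G) hW.nonempty (hW.nonempty.image α.symm)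
    have h1 := hD w₀ hw₀ a ha
    have h2 := hD b hb _ hα
    have h3 := dist_iso hG α (α.symm b) y
    rw [RelIso.apply_symm_apply] at h3
    have h4 := hG.dist_triangle (u := w₀) (v := a) (w := y)
    have h5 := hG.dist_triangle (u := a) (v := α.symm b) (w := y)
    omega
  choose α hα using hfar
  exact ⟨α, tendsto_atTop_mono hα tendsto_id⟩

/-- For a real w strictly between two exponents the same sequence would tend to both 0 and ∞.
Without a sequence going to infinity the definition would be vacuous. -/
theorem IsEta.eq (hex : ∃ α : ℕ → (G ≃g G), Tendsto (fun k => setDist G W (α k '' W)) atTop atTop)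
    {η η' : EReal} (h : IsEta G W η) (h' : IsEta G W η') : η = η' := by
  obtain ⟨α, hα⟩ := hex
  have key : ∀ {η η' : EReal}, IsEta G W η → IsEta G W η' → ¬ η < η' := by
    intro η η' h h' hlt
    obtain ⟨w, h1, h2⟩ := EReal.lt_iff_exists_real_btwn.1 hlt
    exact ENNReal.zero_ne_top
      (tendsto_nhds_unique ((h' α hα w).1 h2) ((h α hα w).2 h1))
  exact le_antisymm (not_lt.1 (key h' h)) (not_lt.1 (key h h'))

variable [Finite H] [Infinite V]

/-- Lifts of walks ending at `W'` end at the gadgets over `W'`, and decomposition goes back. Once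
the two sets are more than 2h + 1 apart, no walk of length at most 2h joins them, so the walks that
need not decompose contribute nothing. -/
theorem seriesZ_comparison (hG : G.Connected) (hW : IsFundamentalDomain G W)
    (hW₁ : IsFundamentalDomain (localTransform G φ att) (gadgetsOver H W)) (W' : Set V) :
    seriesZ G W W' (connectiveConstant G)⁻¹ ≤
        seriesZ (localTransform G φ att) (gadgetsOver H W) (gadgetsOver H W')
          (connectiveConstant (localTransform G φ att))⁻¹ ∧
      (2 * Nat.card H + 1 <
          setDist (localTransform G φ att) (gadgetsOver H W) (gadgetsOver H W') →
        seriesZ (localTransform G φ att) (gadgetsOver H W) (gadgetsOver H W')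
            (connectiveConstant (localTransform G φ att))⁻¹ ≤
          max 1 (ENNReal.ofReal (connectiveConstant (localTransform G φ att))⁻¹) ^
            (2 * Nat.card H) * endsConst H * seriesZ G W W' (connectiveConstant G)⁻¹) := by
  classical
  have : Nonempty H := ⟨φ.outer 0⟩
  have hG₁ := connected_localTransform (φ := φ) (att := att) hG
  have hμ := (connectiveConstant_spec hG (degreeBounded_three att) hW).1
  have hμ₁ := (connectiveConstant_spec hG₁ degreeBounded_localTransform hW₁).1
  set G₁ := localTransform G φ att
  set t := ENNReal.ofReal (connectiveConstant G₁)⁻¹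
  have hgf : gadgetGF φ t = ENNReal.ofReal (connectiveConstant G)⁻¹ :=
    gadgetGF_inv_connectiveConstant hG hW hW₁
  have e₀ : seriesZ G W W' (connectiveConstant G)⁻¹ = walkSum G W fun _ f n =>
      gadgetGF φ t ^ n * (if f ∈ incidentEdges G W' then 1 else 0) := by
    rw [seriesZ_eq_walkSum, hgf]
    simp only [mul_ite, mul_one, mul_zero, ENNReal.ofReal_pow (inv_nonneg.2
      (show 0 ≤ connectiveConstant G by linarith))]
  have e₁ : seriesZ G₁ (gadgetsOver H W) (gadgetsOver H W') (connectiveConstant G₁)⁻¹ =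
      walkSum G₁ (gadgetsOver H W) fun _ f n =>
        t ^ n * (if f ∈ incidentEdges G₁ (gadgetsOver H W') then 1 else 0) := by
    rw [seriesZ_eq_walkSum]
    simp only [t, mul_ite, mul_one, mul_zero, ENNReal.ofReal_pow (inv_nonneg.2
      (show 0 ≤ connectiveConstant G₁ by linarith))]
  rw [e₀, e₁]
  constructor
  · have := walkSum_le_walkSum_localTransform (G := G) (φ := φ) (att := att) (W := W) (t := t)
      (c := 1) (F₀ := fun _ f _ => if f ∈ incidentEdges G W' then 1 else 0)
      (F₁ := fun _ f _ => if f ∈ incidentEdges G₁ (gadgetsOver H W') then 1 else 0)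
      (fun e f n m _ _ _ => by
        by_cases hf : f ∈ incidentEdges G W'
        · simp only [if_pos hf, if_pos (liftEdge_mem_incidentEdges hf), mul_one, le_refl, G₁]
        · simp [hf])
    rwa [one_mul] at this
  · intro hd
    have := walkSum_localTransform_le (G := G) (φ := φ) (att := att) (W := W) (t := t)
      (c := 1) (F₀ := fun _ f _ => if f ∈ incidentEdges G W' then 1 else 0)
      (F₁ := fun _ f _ => if f ∈ incidentEdges G₁ (gadgetsOver H W') then 1 else 0)
      (fun e f n e' f' m _ hf _ _ _ hf' _ _ _ _ => by
        by_cases h : f' ∈ incidentEdges G₁ (gadgetsOver H W')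
        · simp only [if_pos h, if_pos (hf'.mem_incidentEdges hf h), mul_one, le_refl]
        · simp [h])
    rw [one_mul] at this
    refine le_trans (walkSum_mono fun e l hl he => ?_) this
    by_cases hlen : l.length ≤ 2 * Nat.card H
    · have hnot : endEdge e l ∉ incidentEdges G₁ (gadgetsOver H W') := by
        rintro ⟨_, q, hqW, hq⟩
        obtain ⟨_, p, hpW, hp⟩ := he
        have h1 := hl.chain.dist_le hG₁ hl.edge_mem hp hq
        have h2 := setDist_le (G := G₁) hpW hqW
        omega
      simp [hlen, hnot]
    · simp [hlen]

/-- Every sequence of automorphisms of the base graph induces one of the transformed graph, with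
comparable distances and comparable Z. Only this direction is available, since the transformed graph
may have automorphisms that are not induced. -/
theorem IsEta.of_localTransform (hG : G.Connected) (hW : IsFundamentalDomain G W)
    (hind : ∀ α : G ≃g G, ∃ β : localTransform G φ att ≃g localTransform G φ att,
      β '' gadgetsOver H W = gadgetsOver H (α '' W)) {η : EReal}
    (h : IsEta (localTransform G φ att) (gadgetsOver H W) η) : IsEta G W η := by
  have hW₁ := isFundamentalDomain_gadgetsOver hW hind
  intro α hα w
  choose B hB using hind
  have hd : ∀ k, setDist G W (α k '' W) ≤ setDist (localTransform G φ att) (gadgetsOver H W)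
      (B (α k) '' gadgetsOver H W) := fun k => by
    rw [hB]
    exact setDist_le_setDist_gadgetsOver hG hW.nonempty (hW.nonempty.image _)
  have hd' : ∀ k, 1 ≤ setDist G W (α k '' W) →
      setDist (localTransform G φ att) (gadgetsOver H W) (B (α k) '' gadgetsOver H W) ≤
        (2 * Nat.card H + 1) * setDist G W (α k '' W) := fun k hk => by
    rw [hB]
    refine (setDist_gadgetsOver_le hG hW.nonempty (hW.nonempty.image _)).trans ?_
    nlinarith
  have hB' := h (fun k => B (α k)) (tendsto_atTop_mono hd hα) w
  obtain ⟨C, hC0, hC, hratio⟩ := exists_ennreal_rpow_ratio_bound w (2 * Nat.card H + 1)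
  have hcmp := fun k => seriesZ_comparison hG hW hW₁ (α k '' W)
  simp only [← hB] at hcmp
  refine ⟨fun hw => ?_, fun hw => ?_⟩
  · have h1 := ENNReal.Tendsto.const_mul (hB'.1 hw) (Or.inr hC)
    rw [mul_zero] at h1
    refine tendsto_of_tendsto_of_tendsto_of_le_of_le' tendsto_const_nhds h1
      (Eventually.of_forall fun _ => zero_le) ?_
    filter_upwards [hα.eventually_ge_atTop 1] with k hk
    calc _ ≤ _ * (C * _) := mul_le_mul' (hcmp k).1 (hratio _ _ hk (hd k) (hd' k hk)).2
      _ = _ := by ring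
  · set E := max 1 (ENNReal.ofReal (connectiveConstant (localTransform G φ att))⁻¹) ^
      (2 * Nat.card H) * endsConst H
    have hE : E ≠ ⊤ := ENNReal.mul_ne_top
      (ENNReal.pow_ne_top (max_lt ENNReal.one_lt_top ENNReal.ofReal_lt_top).ne) endsConst_ne_top
    have hEC : (E * C)⁻¹ ≠ 0 := ENNReal.inv_ne_zero.2 (ENNReal.mul_ne_top hE hC)
    have h1 := ENNReal.Tendsto.const_mul (a := (E * C)⁻¹) (hB'.2 hw) (Or.inl ENNReal.top_ne_zero)
    rw [ENNReal.mul_top hEC] at h1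
    refine tendsto_nhds_top_mono h1 ?_
    filter_upwards [hα.eventually_gt_atTop (2 * Nat.card H + 1)] with k hk
    have hk1 : 1 ≤ setDist G W (α k '' W) := by omega
    rw [mul_comm, ← div_eq_mul_inv]
    refine ENNReal.div_le_of_le_mul' ?_
    calc _ ≤ (E * _) * (C * _) :=
          mul_le_mul' ((hcmp k).2 (hk.trans_le (hd k))) (hratio _ _ hk1 (hd k) (hd' k hk1)).1
      _ = _ := by ring

end Eta

end LocalSAW

open LocalSAW

theorem theorem3p4 {V : Type*} {H : Type*} [Infinite V] [Finite H]
    (G₀ : SimpleGraph V) [G₀.LocallyFinite]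
    (hconn : G₀.Connected) (hcubic : G₀.IsRegularOfDegree 3)
    (W₀ : Set V) (hW₀ : IsFundamentalDomain G₀ W₀)
    (φ : Gadget H) (att : ∀ x : V, G₀.neighborSet x ≃ Fin 3)
    (G₁ : SimpleGraph (V × H)) (hG₁ : G₁ = localTransform G₀ φ att)
    (W₁ : Set (V × H)) (hW₁ : W₁ = gadgetsOver H W₀)
    (hind : ∀ α : G₀ ≃g G₀, ∃ β : G₁ ≃g G₁, β '' W₁ = gadgetsOver H (α '' W₀))
    (hγ : gammaExp G₀ W₀ ≠ ⊥ ∧ gammaExp G₀ W₀ ≠ ⊤)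
    (hη : ∃ η : EReal, IsEta G₁ W₁ η) :
    (gammaExp G₁ W₁ = gammaExp G₀ W₀ ∧
      ∃ η : EReal, (∀ η' : EReal, IsEta G₀ W₀ η' ↔ η' = η) ∧
        (∀ η' : EReal, IsEta G₁ W₁ η' ↔ η' = η)) ∧
    (∀ L : ℝ → ℝ, SlowlyVarying L →
      HasSlowCorrection G₀ W₀ L → HasSlowCorrection G₁ W₁ L →
        nuExp G₁ W₁ = nuExp G₀ W₀) := by
  subst hG₁ hW₁
  have hW := isFundamentalDomain_gadgetsOver hW₀ hind
  refine ⟨⟨gammaExp_localTransform hconn hW₀ hW, ?_⟩, fun L hL h₀ h₁ =>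
    nuExp_localTransform hconn hW₀ hW hL h₀ h₁⟩
  obtain ⟨η, hη⟩ := hη
  have hex := exists_tendsto_setDist (degreeBounded_three att) hconn hW₀
  -- Uniqueness is needed only on the base graph: any exponent of the transformed graph is also one
  -- of the base graph.
  have hη₀ := hη.of_localTransform hconn hW₀ hind
  refine ⟨η, fun η' => ⟨fun h => h.eq hex hη₀, fun h => h ▸ hη₀⟩, fun η' =>
    ⟨fun h => (h.of_localTransform hconn hW₀ hind).eq hex hη₀, fun h => h ▸ hη⟩⟩
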